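/- Let $G$ be the free two-step nilpotent Lie group on three generators, written in exponential coordinates $(X,Z)\in\mathfrak v\times\mathfrak z=\mathbb R^3\times\mathbb R^3$ with bracket $[X_1,X_2]=Z_3$, $[X_2,X_3]=Z_1$, $[X_3,X_1]=Z_2$ and product $(X,Z)(X',Z')=(X+X',\,Z+Z'+\tfrac12[X,X'])$. Let $X_1,X_2,X_3$ be the left-invariant vector fields and $L=-X_1^2-X_2^2-X_3^2$ the subLaplacian. Identify $\mathfrak z^*$ with $\mathbb R^3$ through the dual basis of $Z_1,Z_2,Z_3$, and let $S$ be its unit sphere, with surface measure $d\omega$. For $\omega\in S$ let $\mathfrak r_\omega=\{X\in\mathfrak v:\omega([X,Y])=0\ \forall\,Y\in\mathfrak v\}$, choose a positively oriented orthonormal basis $X_\omega,Y_\omega,V_\omega$ of $\mathfrak v$ with $V_\omega\in\mathfrak r_\omega$ and $\omega([X_\omega,Y_\omega])=1$ (any choice for each $\omega$), and let $R_\omega\in SO(3)$ map $X=x_\omega X_\omega+y_\omega Y_\omega+v_\omega V_\omega$ to $(x_\omega,y_\omega,v_\omega)$; write $\omega(X)=v_\omega$. For $\lambda>0$ let $$\Delta^\lambda=-\partial_s^2-\partial_t^2+i\lambda\,(t\partial_s-s\partial_t)+\tfrac{\lambda^2}{4}(s^2+t^2)$$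 be the twisted Laplacian on $\mathbb R^2$, and let $\Lambda_k^\lambda$ be the orthogonal projection of $L^2(\mathbb R^2)$ onto the eigenspace of $\Delta^\lambda$ for the eigenvalue $\lambda(2k+1)$, $k=0,1,2,\dots$ (functions in this eigenspace are taken to be continuous). For a Schwartz function $f$ on $G$ put $$f^{\nu}(X)=\int_{\mathfrak z}e^{-i\nu(Z)}f(X,Z)\,dZ\quad(\nu\in\mathfrak z^*),\qquad \mathfrak F_\omega g(x,y;\xi)=\int_{\mathbb R}e^{-iv\xi}g(x,y,v)\,dv,$$ and, for $\mu>0$, $$\mathcal P_\mu f(X,Z)=\frac1{(2\pi)^4}\int_S\sum_{k=0}^\infty(2k+1)^{-3}\int_{-\sqrt\mu}^{\sqrt\mu}e^{i\lambda\,\omega(Z)}e^{i\omega(X)\xi}(\mu-\xi^2)^2\;\Lambda_k^{\lambda}\,\mathfrak F_\omega\big(f^{\lambda\omega}\circ R_\omega^{-1}\big)(x_\omega,y_\omega;\xi)\,d\xi\,d\omega,\qquad \lambda=\frac{\mu-\xi^2}{2k+1}.$$ Then, for every Schwartz function $f$ on $G$: 1. for every $\mu>0$ and $(X,Z)\in G$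 the formula for $\mathcal P_\mu f(X,Z)$ converges absolutely (jointly in $\omega$, $k$, $\xi$); 2. for every $(X,Z)\in G$, $f(X,Z)=\int_0^\infty\mathcal P_\mu f(X,Z)\,d\mu$, with an absolutely convergent integral; 3. for every $\mu>0$, $\mathcal P_\mu f$ is of class $C^2$ and $L\mathcal P_\mu f=\mu\,\mathcal P_\mu f$ on $G$; 4. for every $(X,Z)\in G$, $Lf(X,Z)=\int_0^\infty\mu\,\mathcal P_\mu f(X,Z)\,d\mu$, with an absolutely convergent integral. Moreover this is the spectral resolution of $L$: there is a projection-valued measure $E$ on the Borel subsets of $\mathbb R$, acting on $L^2(G)$, such that $E(B)f=\int_{B\cap(0,\infty)}\mathcal P_\mu f\,d\mu$ almost everywhere for all Schwartz $f$ and all Borel sets $B$, and such that the self-adjoint operator $\int t\,dE(t)$ extends $L$ from the Schwartz class: for each Schwartz $f$ the measure $\nu_f(B)=\|E(B)f\|^2$ has $\int t^2\,d\nu_f<\infty$, $\langle Lf,f\rangle=\int t\,d\nu_f(t)$ and $\|Lf\|^2=\int t^2\,d\nu_f(t)$. -/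

import Mathlib

open MeasureTheory Set
open scoped SchwartzMap RealInnerProductSpace

noncomputable section

namespace FreeTwoStep

/-- Three dimensional Euclidean space: the model, in orthonormal coordinates, of the first layer
`𝔳`, of the centre `𝔷`, and (through the dual basis of `Z₁, Z₂, Z₃`) of the dual space `𝔷*`,
so that `ω(Z) = ⟪ω, Z⟫` and `ω_a = ω(Z_a)`. -/
abbrev V : Type := EuclideanSpace ℝ (Fin 3)

/-- The Euclidean plane, on which the twisted Laplacian lives. -/
abbrev Plane : Type := EuclideanSpace ℝ (Fin 2)

/-- The free two step nilpotent Lie group on three generators in exponential coordinates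
`(X, Z) ∈ 𝔳 × 𝔷`; its Haar measure is Lebesgue measure `volume`. -/
abbrev G : Type := V × V

/-- Lebesgue measure on `G` is a Haar measure of the vector space `𝔳 × 𝔷`. -/
instance : (volume : Measure G).IsAddHaarMeasure :=
  inferInstanceAs (((volume : Measure V).prod (volume : Measure V)).IsAddHaarMeasure)

/-- The Hilbert space `L²(G)`. -/
abbrev L2G : Type := Lp ℂ 2 (volume : Measure G)

/-- The unit sphere of `𝔷*`. -/
abbrev S : Type := Metric.sphere (0 : V) 1

/-- The Lie bracket `𝔳 × 𝔳 → 𝔷`: `[X₁, X₂] = Z₃`, `[X₂, X₃] = Z₁`, `[X₃, X₁] = Z₂`. -/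
def bracket (X Y : V) : V :=
  !₂[X 1 * Y 2 - X 2 * Y 1, X 2 * Y 0 - X 0 * Y 2, X 0 * Y 1 - X 1 * Y 0]

/-- The group law of `G` given by the Baker-Campbell-Hausdorff formula. -/
def gmul (p q : G) : G := (p.1 + q.1, p.2 + q.2 + (2⁻¹ : ℝ) • bracket p.1 q.1)

/-- The left invariant vector field `X_a`, that is `X_a F (p) = d/dt F (p · exp (t X_a))` at
`t = 0`. For instance `X₁ = ∂_{x₁} + (x₃/2) ∂_{z₂} - (x₂/2) ∂_{z₃}`. -/
def leftField (a : Fin 3) (F : G → ℂ) (p : G) : ℂ :=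
  deriv (fun t : ℝ => F (gmul p (t • EuclideanSpace.single a (1 : ℝ), 0))) 0

/-- The subLaplacian `L = -X₁² - X₂² - X₃²`. -/
def subLaplacian (F : G → ℂ) (p : G) : ℂ :=
  -∑ a : Fin 3, leftField a (leftField a F) p

/-- The radical `𝔯_ω` of the skew-symmetric form `(X, Y) ↦ ω([X, Y])` on `𝔳`. -/
def radical (ω : V) : Set V := {X | ∀ Y : V, ⟪ω, bracket X Y⟫ = 0}

/-- `R` is an admissible rotation `R_ω ∈ SO(3)`, `X ↦ (x_ω, y_ω, v_ω)`: it gives the coordinates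
with respect to a positively oriented orthonormal basis `X_ω, Y_ω, V_ω` of `𝔳` such that `V_ω`
spans the radical `𝔯_ω` and `ω([X_ω, Y_ω]) = 1`. -/
structure IsAdaptedRotation (ω : V) (R : V ≃ₗᵢ[ℝ] V) : Prop where
  radical_mem : R.symm (EuclideanSpace.single 2 1) ∈ radical ω
  bracket_eq_one : ⟪ω, bracket (R.symm (EuclideanSpace.single 0 1))
    (R.symm (EuclideanSpace.single 1 1))⟫ = 1
  det_eq_one : LinearMap.det (R.toLinearEquiv : V →ₗ[ℝ] V) = 1

/-- The partial derivative `∂_j` on the plane. -/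
def pd (j : Fin 2) (g : Plane → ℂ) (p : Plane) : ℂ :=
  fderiv ℝ g p (EuclideanSpace.single j 1)

/-- The twisted Laplacian
`Δ^lam = -∂_s² - ∂_t² + i lam (t ∂_s - s ∂_t) + (lam² / 4) (s² + t²)` at `p = (s, t)`. -/
def twistedLaplacian (lam : ℝ) (g : Plane → ℂ) (p : Plane) : ℂ :=
  -pd 0 (pd 0 g) p - pd 1 (pd 1 g) p
    + Complex.I * lam * ((p 1 : ℂ) * pd 0 g p - (p 0 : ℂ) * pd 1 g p)
    + (lam : ℂ) ^ 2 / 4 * ((p 0 : ℂ) ^ 2 + (p 1 : ℂ) ^ 2) * g p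

/-- The eigenspace in `L²(ℝ²)` of the twisted Laplacian for the eigenvalue `lam (2 k + 1)`:
all `u ∈ L²(ℝ²)` with `⟨u, Δ^lam φ⟩ = lam (2 k + 1) ⟨u, φ⟩` for every Schwartz function `φ`,
that is the square integrable weak solutions of `Δ^lam u = lam (2 k + 1) u`
(the eigenspace of the adjoint of `Δ^lam` on the Schwartz space). It is written as the
orthogonal complement of the functions `Δ^lam φ - lam (2 k + 1) φ`. -/
def eigenspace (k : ℕ) (lam : ℝ) : Submodule ℂ (Lp ℂ 2 (volume : Measure Plane)) :=
  (Submodule.span ℂ {w | ∃ φ : 𝓢(Plane, ℂ), w =ᵐ[volume] fun p =>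
    twistedLaplacian lam φ p - ((lam * (2 * k + 1) : ℝ) : ℂ) * φ p})ᗮ

instance (k : ℕ) (lam : ℝ) : (eigenspace k lam).HasOrthogonalProjection := by
  unfold eigenspace
  infer_instance

open Classical in
/-- The continuous representative of an `L²` class on the plane (it is unique if it exists;
otherwise the value is the zero function). -/
def continuousRep (u : Lp ℂ 2 (volume : Measure Plane)) : Plane → ℂ :=
  if h : ∃ g : Plane → ℂ, Continuous g ∧ u =ᵐ[volume] g then h.choose else 0

open Classical in
/-- The spectral projection `Λ_k^lam` of the twisted Laplacian: the orthogonal projection of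
`L²(ℝ²)` onto the eigenspace for `lam (2 k + 1)`. The functions in its range are continuous and
are evaluated pointwise. -/
def Lam (k : ℕ) (lam : ℝ) (g : Plane → ℂ) : Plane → ℂ :=
  if h : MemLp g 2 volume then continuousRep ((eigenspace k lam).starProjection (h.toLp g)) else 0

/-- The partial Fourier transform in the central variables,
`f^ν (X) = ∫_𝔷 exp (-i ν(Z)) f (X, Z) dZ`. -/
def centralFT (f : G → ℂ) (ν X : V) : ℂ :=
  ∫ Z : V, Complex.exp (-Complex.I * (⟪ν, Z⟫ : ℝ)) * f (X, Z)

/-- The partial Fourier transform of `g` in the direction of the radical, in coordinates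
`(s, t, v) = (x_ω, y_ω, v_ω)`: `𝔉 g (s, t; ξ) = ∫ exp (-i v ξ) g (s, t, v) dv`. -/
def radicalFT (g : V → ℂ) (ξ : ℝ) (p : Plane) : ℂ :=
  ∫ v : ℝ, Complex.exp (-Complex.I * (v * ξ : ℝ)) * g !₂[p 0, p 1, v]

/-- The integrand, for the parameters `ω ∈ S`, `k ∈ ℕ`, `ξ ∈ ℝ`, in the formula for
`𝒫_μ f (X, Z)`. With `lam = (μ - ξ²) / (2 k + 1)` it equals
`(2 k + 1)⁻³ exp (i lam ω(Z)) exp (i ω(X) ξ) (μ - ξ²)²`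
` × Λ_k^lam 𝔉_ω (f^{lam ω} ∘ R_ω⁻¹) (x_ω, y_ω; ξ)`, where `R_ω X = (x_ω, y_ω, v_ω)` and
`ω(X) = v_ω`. -/
def spectralIntegrand (R : S → V ≃ₗᵢ[ℝ] V) (μ : ℝ) (f : G → ℂ) (p : G)
    (ω : S) (k : ℕ) (ξ : ℝ) : ℂ :=
  let lam : ℝ := (μ - ξ ^ 2) / (2 * k + 1)
  let Y : V := R ω p.1
  (((2 * k + 1 : ℝ) ^ 3)⁻¹ : ℝ) * Complex.exp (Complex.I * (lam * ⟪(ω : V), p.2⟫ : ℝ))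
    * Complex.exp (Complex.I * (Y 2 * ξ : ℝ)) * ((μ - ξ ^ 2) ^ 2 : ℝ)
    * Lam k lam (radicalFT (centralFT f (lam • (ω : V)) ∘ (R ω).symm) ξ) !₂[Y 0, Y 1]

/-- The operator `𝒫_μ`,
`𝒫_μ f (X, Z) = (2π)⁻⁴ ∫_S ∑_k (2 k + 1)⁻³ ∫_{-√μ}^{√μ} ⋯ dξ dω`, where `dω` is the surface
measure of the unit sphere. -/
def P (R : S → V ≃ₗᵢ[ℝ] V) (μ : ℝ) (f : G → ℂ) (p : G) : ℂ :=
  (((2 * Real.pi) ^ 4)⁻¹ : ℝ) *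
    ∫ ω : S, (∑' k : ℕ, ∫ ξ in (-√μ)..(√μ), spectralIntegrand R μ f p ω k ξ)
      ∂(volume : Measure V).toSphere

/-- `E` is a spectral measure (projection-valued measure) on the Borel sets of `ℝ`, with values
the orthogonal projections of the Hilbert space `H`. -/
structure IsSpectralMeasure {H : Type*} [NormedAddCommGroup H] [InnerProductSpace ℂ H]
    [CompleteSpace H] (E : Set ℝ → H →L[ℂ] H) : Prop where
  isStarProjection : ∀ B, MeasurableSet B → IsStarProjection (E B)
  map_univ : E univ = 1
  hasSum_iUnion : ∀ B : ℕ → Set ℝ, (∀ n, MeasurableSet (B n)) →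
    Pairwise (fun m n => Disjoint (B m) (B n)) →
    ∀ u : H, HasSum (fun n => E (B n) u) (E (⋃ n, B n) u)

/-- The self-adjoint operator `∫ t dE(t)` of the spectral measure `E` on `L²(G)` extends the
subLaplacian on the Schwartz space, expressed through the scalar measures `ν = ‖E(·) f‖²`:
each Schwartz function `f` is in the domain, `∫ t² dν < ∞`, with `⟨L f, f⟩ = ∫ t dν` and
`‖L f‖² = ∫ t² dν`. By polarization and density of the Schwartz functions this determines
`(∫ t dE(t)) f = L f`. -/
def ResolvesSubLaplacian (E : Set ℝ → L2G →L[ℂ] L2G) : Prop :=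
  ∀ f : 𝓢(G, ℂ), ∃ ν : Measure ℝ,
    (∀ B, MeasurableSet B → ν B = ENNReal.ofReal (‖E B (f.toLp 2 volume)‖ ^ 2)) ∧
    Integrable (fun t : ℝ => t ^ 2) ν ∧
    ∫ p : G, subLaplacian f p * starRingEnd ℂ (f p) = ((∫ t : ℝ, t ∂ν : ℝ) : ℂ) ∧
    ∫ p : G, ‖subLaplacian f p‖ ^ 2 = ∫ t : ℝ, t ^ 2 ∂ν

end FreeTwoStep

end

/-! For a unit vector `ω`, `λ > 0`, `k` and `ξ`, let `ℓ_k(x) = e^{-x/2} L_k(x)` be the Laguerre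
function and consider the bounded function `wave` on `G`, namely `exp(i(λ ω(Z) + ξ ω(X)))
ℓ_k(λ|X_⊥|²/2)` with `X_⊥` the part of `X` orthogonal to `ω`. By the Laguerre equation it is an
eigenfunction of `L` with eigenvalue `λ(2k+1) + ξ²` (`subLaplacian_wave`). The choice `λ = (μ -
ξ²)/(2k+1)` makes this eigenvalue `μ`. The projection `Λ_k^λ` is an integral operator with an
explicit Laguerre kernel, so the integrand of `𝒫_μ f` is a constant times the group convolution
`coeff` of `f` with `wave` (`coeff_eq_proj`, `spectralIntegrand_eq`). In particular the choice of
`R_ω` does not matter.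

That `Λ_k^λ` has the kernel `pker` is proved by Abel summation. The columns of `pker` are
eigenfunctions, and they are orthogonal to the other eigenspaces. The sum `∑ r^k pker k` is the
Mehler kernel, an approximate identity as `r → 1`. Hence `⟨g, u⟩ = lim r^k ⟨proj k g, u⟩` for `u` in
the `k`-th eigenspace (`integral_conj_mul_eq_of_mem_eigenspace`). The same limit gives pointwise
completeness (`tsum_proj`). The reproducing property of the kernel gives `|ℓ_k| ≤ 1`, uniformly in
`k`.

Since `wave` is bounded and `L` is symmetric, the coefficients of a Schwartz function satisfy `(1 +
eigenvalue)^N |coeff| ≤ C λ` (`exists_norm_coeff_le`). Absolute convergence follows everywhere.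
Fubini, the substitution `μ ↔ λ` and polar coordinates `ν = λω` turn `∫ m(μ) 𝒫_μ f dμ` into `(2π)⁻⁴
∫ slice m f ν dν` for bounded measurable `m` (`integral_mul_P`). For `m = 1`, completeness in `k`
and Fourier inversion in `ξ` and in `ν` give back `f`; the factors `2π` and `(2π)³` cancel the
constant.

For `|m| = 1`, orthogonality in `k` and Plancherel in `ξ` and `ν` show that `m(L)` preserves the
`L²` norm (`lintegral_mulP_sq`). Taking `m = ζ` on `B` and `1` elsewhere, `f + (ζ - 1) E(B) f` has
the norm of `f` for every `|ζ| = 1`, which forces `E(B) f ⟂ f - E(B) f`. So `E(B)` is a contraction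
on Schwartz functions and extends to an orthogonal projection. Countable additivity comes from the
integrable density `rho` of `B ↦ ⟨E(B) f, f⟩`, and the relation with `L` from `𝒫_μ (L f) = μ 𝒫_μ f`.
Finally `𝒫_μ f` is the convolution of `f` with a bounded kernel, so it is `C²` because `f` is
smooth, and moving `L` onto the waves gives `L 𝒫_μ f = μ 𝒫_μ f`. -/

noncomputable section
namespace FreeTwoStep

/-! ### Laguerre functions -/

/-- The Laguerre polynomial `L_k`. -/
def laguerre (k : ℕ) : Polynomial ℝ :=
  ∑ i ∈ Finset.range (k + 1), Polynomial.monomial i ((-1) ^ i * (k.choose i : ℝ) / i.factorial)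

lemma coeff_laguerre (k i : ℕ) :
    (laguerre k).coeff i = (-1) ^ i * (k.choose i : ℝ) / i.factorial := by
  simp only [laguerre, Polynomial.finsetSum_coeff, Polynomial.coeff_monomial]
  rw [Finset.sum_ite_eq' (Finset.range (k + 1)) i]
  split_ifs with h
  · rfl
  · rw [Nat.choose_eq_zero_of_lt (by simpa using h)]; simp

/-- Comparing coefficients, the equation is the two-term recursion `key`, that is, `(i+1) C(k,i+1) =
(k-i) C(k,i)`. -/
lemma laguerre_ode (k : ℕ) :
    Polynomial.X * (laguerre k).derivative.derivative
      + (1 - Polynomial.X) * (laguerre k).derivative + (k : Polynomial ℝ) * laguerre k = 0 := by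
  ext i
  have key : ((i : ℝ) + 1) * ((i : ℝ) + 1) * (laguerre k).coeff (i + 1)
      = ((i : ℝ) - k) * (laguerre k).coeff i := by
    have h1 : ((k.choose (i + 1) : ℝ)) * (i + 1) = (k.choose i : ℝ) * ((k : ℝ) - i) := by
      rcases le_or_gt i k with h | h
      · have := Nat.choose_succ_right_eq k i
        rw [← Nat.cast_sub h]
        exact_mod_cast this
      · rw [Nat.choose_eq_zero_of_lt h, Nat.choose_eq_zero_of_lt (by omega)]; simp
    rw [coeff_laguerre, coeff_laguerre, Nat.factorial_succ, pow_succ]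
    have := Nat.factorial_ne_zero i
    push_cast
    field_simp
    linear_combination -h1
  cases i with
  | zero =>
    simp only [sub_mul, Polynomial.coeff_derivative, Polynomial.coeff_add, Polynomial.coeff_sub,
      Polynomial.mul_coeff_zero, Polynomial.coeff_X_zero, one_mul, Polynomial.natCast_coeff_zero,
      Polynomial.coeff_zero, zero_mul] at key ⊢
    push_cast at key ⊢
    linarith
  | succ i =>
    simp only [sub_mul, Polynomial.coeff_derivative, Polynomial.coeff_add, Polynomial.coeff_sub,
      Polynomial.coeff_X_mul, one_mul, Polynomial.coeff_natCast_mul, Polynomial.coeff_zero] at key ⊢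
    push_cast at key ⊢
    linear_combination key

/-- The Laguerre function `exp (-x / 2) L_k (x)`. -/
def lagF (k : ℕ) (x : ℝ) : ℝ := Real.exp (-x / 2) * (laguerre k).eval x

lemma lagF_zero (k : ℕ) : lagF k 0 = 1 := by
  have : (laguerre k).eval 0 = 1 := by
    rw [← Polynomial.coeff_zero_eq_eval_zero, coeff_laguerre]; simp
  simp [lagF, this]

/-- The derivative of the Laguerre function. -/
def lagF' (k : ℕ) (x : ℝ) : ℝ :=
  Real.exp (-x / 2) * ((laguerre k).derivative - Polynomial.C (1 / 2) * laguerre k).eval x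

/-- The second derivative of the Laguerre function. -/
def lagF'' (k : ℕ) (x : ℝ) : ℝ :=
  Real.exp (-x / 2) * ((laguerre k).derivative.derivative - (laguerre k).derivative
    + Polynomial.C (1 / 4) * laguerre k).eval x

lemma hasDerivAt_exp_mul_poly (p : Polynomial ℝ) (x : ℝ) :
    HasDerivAt (fun x => Real.exp (-x / 2) * p.eval x)
      (Real.exp (-x / 2) * (p.derivative - Polynomial.C (1 / 2) * p).eval x) x := by
  have h1 : HasDerivAt (fun x : ℝ => Real.exp (-x / 2)) (Real.exp (-x / 2) * (-1 / 2)) x :=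
    ((hasDerivAt_id x).neg.div_const 2).exp
  convert! h1.mul (p.hasDerivAt x) using 1
  simp only [Polynomial.eval_sub, Polynomial.eval_mul, Polynomial.eval_C]
  ring

lemma hasDerivAt_lagF (k : ℕ) (x : ℝ) : HasDerivAt (lagF k) (lagF' k x) x :=
  hasDerivAt_exp_mul_poly _ x

lemma hasDerivAt_lagF' (k : ℕ) (x : ℝ) : HasDerivAt (lagF' k) (lagF'' k x) x := by
  convert! hasDerivAt_exp_mul_poly _ x using 1
  simp only [lagF'', Polynomial.derivative_sub, Polynomial.derivative_mul,
    Polynomial.derivative_C, Polynomial.eval_sub, Polynomial.eval_mul, Polynomial.eval_C,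
    Polynomial.eval_add]
  ring_nf
  simp

lemma lagF_ode (k : ℕ) (x : ℝ) :
    x * lagF'' k x + lagF' k x + (k + 1 / 2 - x / 4) * lagF k x = 0 := by
  have h := congrArg (Polynomial.eval x) (laguerre_ode k)
  simp only [Polynomial.eval_sub, Polynomial.eval_mul, Polynomial.eval_add, Polynomial.eval_X,
    Polynomial.eval_one, Polynomial.eval_natCast, Polynomial.eval_zero] at h
  simp only [lagF, lagF', lagF'', Polynomial.eval_sub, Polynomial.eval_mul, Polynomial.eval_C,
    Polynomial.eval_add]
  linear_combination Real.exp (-x / 2) * h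

/-- Written with `i` running over all of `ℕ`, so that the double series in `(i, k)` can be summed in
the other order. -/
lemma eval_laguerre_eq_tsum (k : ℕ) (x : ℝ) (z : ℂ) :
    z ^ k * ((laguerre k).eval x : ℝ) =
      ∑' i : ℕ, ((-x : ℂ) ^ i / i.factorial) * ((k.choose i : ℂ) * z ^ k) := by
  rw [tsum_eq_sum (s := Finset.range (k + 1))]
  · simp only [laguerre, Polynomial.eval_finsetSum, Polynomial.eval_monomial]
    push_cast
    rw [Finset.mul_sum]
    refine Finset.sum_congr rfl fun i _ => ?_
    rw [neg_pow (x : ℂ)]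
    ring
  · intro i hi
    rw [Nat.choose_eq_zero_of_lt (by simpa using hi)]; simp

lemma hasSum_choose_mul_pow (i : ℕ) {z : ℂ} (hz : ‖z‖ < 1) :
    HasSum (fun k : ℕ => (k.choose i : ℂ) * z ^ k) (z ^ i / (1 - z) ^ (i + 1)) := by
  have h := (hasSum_choose_mul_geometric_of_norm_lt_one i hz).mul_right (z ^ i)
  rw [show z ^ i / (1 - z) ^ (i + 1) = 1 / (1 - z) ^ (i + 1) * z ^ i by ring]
  have h2 : (fun n : ℕ => ((n + i).choose i : ℂ) * z ^ n * z ^ i)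
      = (fun k : ℕ => (k.choose i : ℂ) * z ^ k) ∘ (fun n => n + i) := by
    funext n; simp [pow_add, mul_assoc]
  rw [h2] at h
  refine (Function.Injective.hasSum_iff (add_left_injective i) ?_).1 h
  intro k hk
  have : k < i := by
    by_contra hlt
    exact hk ⟨k - i, by simp; omega⟩
  rw [Nat.choose_eq_zero_of_lt this]; simp

/-- Summing over `k` first gives binomial series, and what remains is the exponential series of
`-xz/(1-z)`. The order may be exchanged because the series of norms is the same computation with
`|x|` and `|z|`. -/
lemma hasSum_laguerre (x : ℝ) {z : ℂ} (hz : ‖z‖ < 1) :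
    HasSum (fun k : ℕ => z ^ k * (((laguerre k).eval x : ℝ) : ℂ))
      ((1 - z)⁻¹ * Complex.exp (-x * z / (1 - z))) := by
  have hz1 : (1 - z) ≠ 0 := by
    intro h
    rw [sub_eq_zero] at h
    simp [← h] at hz
  set f : ℕ × ℕ → ℂ := fun q => ((-x : ℂ) ^ q.1 / q.1.factorial) * ((q.2.choose q.1 : ℂ) * z ^ q.2)
  have hzr : ‖((‖z‖ : ℝ) : ℂ)‖ < 1 := by simpa using hz
  have hnorm : ∀ i, HasSum (fun k : ℕ => ‖f (i, k)‖)
      (‖x‖ ^ i / i.factorial * (‖z‖ ^ i / (1 - ‖z‖) ^ (i + 1))) := by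
    intro i
    have h := (hasSum_choose_mul_pow i hzr).mul_left ((‖x‖ : ℂ) ^ i / i.factorial)
    rw [← Complex.hasSum_ofReal]
    convert! h using 1
    · funext k; simp [f]
    · push_cast; ring
  have hsumf : Summable f := by
    refine Summable.of_norm ((summable_prod_of_nonneg fun _ => norm_nonneg _).2
      ⟨fun i => (hnorm i).summable, ?_⟩)
    simp_rw [(hnorm _).tsum_eq]
    have h := (Real.summable_pow_div_factorial (‖x‖ * ‖z‖ / (1 - ‖z‖))).mul_right (1 - ‖z‖)⁻¹
    refine h.congr fun i => ?_
    have : 1 - ‖z‖ ≠ 0 := by linarith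
    rw [pow_succ, div_pow]
    field_simp
    ring
  have h1 : HasSum (fun i : ℕ => (-x : ℂ) ^ i / i.factorial * (z ^ i / (1 - z) ^ (i + 1)))
      ((1 - z)⁻¹ * Complex.exp (-x * z / (1 - z))) := by
    have h := (NormedSpace.expSeries_div_hasSum_exp (-x * z / (1 - z) : ℂ)).mul_left (1 - z)⁻¹
    rw [← Complex.exp_eq_exp_ℂ] at h
    convert! h using 1
    funext i
    rw [pow_succ, div_pow]
    field_simp
    ring
  have h2 : HasSum f ((1 - z)⁻¹ * Complex.exp (-x * z / (1 - z))) := by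
    have h3 := hsumf.hasSum.prod_fiberwise
      (fun i => (hasSum_choose_mul_pow i hz).mul_left ((-x : ℂ) ^ i / i.factorial))
    rw [← h3.unique h1]
    exact hsumf.hasSum
  have h4 := (Equiv.prodComm ℕ ℕ).hasSum_iff.2 h2
  simp_rw [eval_laguerre_eq_tsum]
  exact h4.prod_fiberwise fun k => (h4.summable.prod_factor k).hasSum

/-- The factor `e^{-x/2}` turns the exponent into a Cayley transform, whose real part has a sign in
the disc. All Gaussian decay below comes from this. -/
lemma hasSum_lagF (x : ℝ) {z : ℂ} (hz : ‖z‖ < 1) :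
    HasSum (fun k : ℕ => z ^ k * (lagF k x : ℂ))
      ((1 - z)⁻¹ * Complex.exp (-(x / 2) * ((1 + z) / (1 - z)))) := by
  have hz1 : (1 - z) ≠ 0 := by
    intro h
    rw [sub_eq_zero] at h
    simp [← h] at hz
  have h := (hasSum_laguerre x hz).mul_left (Complex.exp (-x / 2))
  convert! h using 1
  · funext k
    simp only [lagF]
    push_cast
    ring
  · rw [mul_left_comm, ← Complex.exp_add]
    congr 2
    field_simp
    ring

/-- Cauchy's estimate for the coefficients of a power series in the unit disc. -/
lemma norm_coeff_le_of_hasSum {a : ℕ → ℂ} {F : ℂ → ℂ}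
    (h : ∀ z : ℂ, ‖z‖ < 1 → HasSum (fun n => z ^ n * a n) (F z)) {ρ M : ℝ} (hρ : 0 < ρ)
    (hρ1 : ρ < 1) (hM : ∀ z : ℂ, ‖z‖ = ρ → ‖F z‖ ≤ M) (n : ℕ) : ‖a n‖ ≤ M / ρ ^ n := by
  have hp : HasFPowerSeriesOnBall F (FormalMultilinearSeries.ofScalars ℂ a) 0 1 := by
    refine ⟨?_, one_pos, ?_⟩
    · refine ENNReal.le_of_forall_nnreal_lt fun r hr => ?_
      refine FormalMultilinearSeries.le_radius_of_summable_norm _ ?_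
      have hr1 : ‖((r : ℝ) : ℂ)‖ < 1 := by
        simpa using hr
      refine (h _ hr1).summable.norm.congr fun n => ?_
      rw [FormalMultilinearSeries.ofScalars_norm]
      simp [mul_comm]
    · intro y hy
      have : ‖y‖ < 1 := by
        rw [← ENNReal.ofReal_one, Metric.eball_ofReal] at hy
        simpa using hy
      simpa [FormalMultilinearSeries.ofScalars_apply_eq, mul_comm] using h y this
  have hd : DifferentiableOn ℂ F (Metric.ball 0 1) := by
    have := hp.differentiableOn
    rwa [← ENNReal.ofReal_one, Metric.eball_ofReal] at this
  have hd2 : DifferentiableOn ℂ F (Metric.closedBall 0 (⟨ρ, hρ.le⟩ : NNReal)) :=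
    hd.mono (Metric.closedBall_subset_ball hρ1)
  -- Uniqueness of power series identifies `a n` with the Cauchy integrals over the circle of radius
  -- `ρ`.
  have heq : FormalMultilinearSeries.ofScalars ℂ a = cauchyPowerSeries F 0 ρ :=
    hp.hasFPowerSeriesAt.eq_formalMultilinearSeries
    (hd2.hasFPowerSeriesOnBall (by exact_mod_cast hρ)).hasFPowerSeriesAt
  have h1 : ‖a n‖ = ‖cauchyPowerSeries F 0 ρ n‖ := by
    rw [← heq, FormalMultilinearSeries.ofScalars_norm]
  rw [h1]
  refine (norm_cauchyPowerSeries_le F 0 ρ n).trans ?_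
  rw [abs_of_pos hρ, inv_pow, ← div_eq_mul_inv]
  gcongr
  have h2 : ∫ θ in (0 : ℝ)..2 * Real.pi, ‖F (circleMap 0 ρ θ)‖ ≤ M * (2 * Real.pi) := by
    refine (le_abs_self _).trans ?_
    rw [← Real.norm_eq_abs]
    refine (intervalIntegral.norm_integral_le_of_norm_le_const (C := M) fun θ _ => ?_).trans ?_
    · rw [norm_norm]
      exact hM _ (by simp [abs_of_pos hρ])
    · rw [sub_zero, abs_of_pos Real.two_pi_pos]
  calc (2 * Real.pi)⁻¹ * ∫ θ in (0 : ℝ)..2 * Real.pi, ‖F (circleMap 0 ρ θ)‖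
      ≤ (2 * Real.pi)⁻¹ * (M * (2 * Real.pi)) := by gcongr
    _ = M := by field_simp

/-- On `|z| = ρ` the real part of `(1+z)/(1-z)` is `(1-ρ²)/|1-z|² ≥ (1-ρ)/(1+ρ)`, and Cauchy's
estimate applies. The loss `ρ^{-k}` is harmless against a factor `r^k` with `r < ρ`. -/
lemma abs_lagF_le (k : ℕ) {x ρ : ℝ} (hx : 0 ≤ x) (hρ : 0 < ρ) (hρ1 : ρ < 1) :
    |lagF k x| ≤ (1 - ρ)⁻¹ * Real.exp (-(x / 2) * ((1 - ρ) / (1 + ρ))) / ρ ^ k := by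
  have h := norm_coeff_le_of_hasSum (fun z hz => hasSum_lagF x hz) hρ hρ1
    (M := (1 - ρ)⁻¹ * Real.exp (-(x / 2) * ((1 - ρ) / (1 + ρ)))) ?_ k
  · simpa using h
  intro z hz
  have h0 : 1 - ρ ≤ ‖1 - z‖ := by
    have := norm_sub_norm_le (1 : ℂ) z
    simpa [hz] using this
  have h1 : ‖1 - z‖ ≤ 1 + ρ := by
    have := norm_sub_le (1 : ℂ) z
    simpa [hz] using this
  have hpos : 0 < ‖1 - z‖ := by linarith
  rw [norm_mul, norm_inv, Complex.norm_exp]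
  have hre : (-((x : ℂ) / 2) * ((1 + z) / (1 - z))).re
      = -(x / 2) * ((1 - ρ ^ 2) / ‖1 - z‖ ^ 2) := by
    have e1 : ((1 + z) / (1 - z)).re = (1 - ρ ^ 2) / ‖1 - z‖ ^ 2 := by
      rw [Complex.div_re, ← Complex.normSq_eq_norm_sq, ← add_div]
      congr 1
      have : ρ ^ 2 = z.re * z.re + z.im * z.im := by
        rw [← hz, ← Complex.normSq_eq_norm_sq, Complex.normSq_apply]
      simp
      linarith
    have e2 : (-((x : ℂ) / 2)) = ((-(x / 2) : ℝ) : ℂ) := by push_cast; ring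
    rw [e2, Complex.re_ofReal_mul, e1]
  rw [hre]
  have h2 : (1 - ρ) / (1 + ρ) ≤ (1 - ρ ^ 2) / ‖1 - z‖ ^ 2 := by
    rw [div_le_div_iff₀ (by linarith) (by positivity)]
    have : ‖1 - z‖ ^ 2 ≤ (1 + ρ) ^ 2 := by gcongr
    nlinarith
  have h3 : -(x / 2) * ((1 - ρ ^ 2) / ‖1 - z‖ ^ 2) ≤ -(x / 2) * ((1 - ρ) / (1 + ρ)) := by
    rw [neg_mul, neg_mul, neg_le_neg_iff]
    gcongr
  have h4 : ‖1 - z‖⁻¹ ≤ (1 - ρ)⁻¹ := by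
    gcongr
  gcongr

lemma continuous_lagF (k : ℕ) : Continuous (lagF k) :=
  continuous_iff_continuousAt.2 fun x => (hasDerivAt_lagF k x).continuousAt

end FreeTwoStep
end

noncomputable section
namespace FreeTwoStep
open scoped LineDeriv ContDiff

/-! ### Functions of temperate growth and Gaussians -/

@[fun_prop]
lemma hasTemperateGrowth_coord {ι : Type*} [Fintype ι] (i : ι) :
    Function.HasTemperateGrowth (fun p : EuclideanSpace ℝ ι => p i) :=
  (EuclideanSpace.proj i : EuclideanSpace ℝ ι →L[ℝ] ℝ).hasTemperateGrowth

lemma hasTemperateGrowth_cexp_I :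
    Function.HasTemperateGrowth (fun t : ℝ => Complex.exp (Complex.I * t)) := by
  have h1 : ContDiff ℝ ∞ (fun t : ℝ => Complex.exp (Complex.I * t)) :=
    (contDiff_const.mul Complex.ofRealCLM.contDiff).cexp
  refine ⟨h1, fun n => ⟨0, 1, fun t => ?_⟩⟩
  rw [norm_iteratedFDeriv_eq_norm_iteratedDeriv]
  have h2 : ∀ n : ℕ, iteratedDeriv n (fun t : ℝ => Complex.exp (Complex.I * t))
      = fun t : ℝ => Complex.I ^ n * Complex.exp (Complex.I * t) := by
    intro n
    induction n with
    | zero => simp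
    | succ n ih =>
      rw [iteratedDeriv_succ, ih]
      funext t
      have h3 : HasDerivAt (fun t : ℝ => Complex.exp (Complex.I * t))
          (Complex.exp (Complex.I * t) * (Complex.I * 1)) t :=
        ((Complex.ofRealCLM.hasDerivAt (x := t)).const_mul Complex.I).cexp
      rw [(h3.const_mul (Complex.I ^ n)).deriv]
      ring
  rw [h2 n, norm_mul, norm_pow, Complex.norm_I, Complex.norm_exp]
  simp

lemma hasTemperateGrowth_cexp_I_mul {E : Type*} [NormedAddCommGroup E] [NormedSpace ℝ E]
    {f : E → ℝ} (hf : f.HasTemperateGrowth) :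
    Function.HasTemperateGrowth (fun x : E => Complex.exp (Complex.I * f x)) :=
  hasTemperateGrowth_cexp_I.comp hf

lemma hasTemperateGrowth_poly {E : Type*} [NormedAddCommGroup E] [NormedSpace ℝ E]
    (p : Polynomial ℝ) {f : E → ℝ} (hf : f.HasTemperateGrowth) :
    Function.HasTemperateGrowth (fun x : E => p.eval (f x)) := by
  simp_rw [Polynomial.eval_eq_sum_range]
  exact Function.HasTemperateGrowth.sum fun i _ =>
    (Function.HasTemperateGrowth.const _).mul (hf.pow i)

lemma hasTemperateGrowth_ofReal {E : Type*} [NormedAddCommGroup E] [NormedSpace ℝ E]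
    {f : E → ℝ} (hf : f.HasTemperateGrowth) :
    Function.HasTemperateGrowth (fun x : E => (f x : ℂ)) :=
  Function.HasTemperateGrowth.comp Function.Complex.hasTemperateGrowth_ofReal hf

lemma exists_pow_mul_exp_neg_le {a : ℝ} (ha : 0 < a) (N : ℕ) :
    ∃ C : ℝ, 0 ≤ C ∧ ∀ y : ℝ, 0 ≤ y → (1 + y) ^ N * Real.exp (-a * y ^ 2) ≤ C := by
  refine ⟨2 ^ N * (Real.exp a * (N.factorial / a ^ N)), by positivity, fun y hy => ?_⟩
  have h1 : (1 + y) ^ N ≤ (2 * (1 + y ^ 2)) ^ N :=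
    calc (1 + y) ^ N ≤ ((1 + y) ^ 2) ^ N := by
          gcongr
          nlinarith
      _ ≤ (2 * (1 + y ^ 2)) ^ N := by
          gcongr
          nlinarith [sq_nonneg (1 - y)]
  have h2 := Real.pow_div_factorial_le_exp (x := a * (1 + y ^ 2)) (by positivity) N
  have h3 : Real.exp (-a * y ^ 2) = Real.exp a * (Real.exp (a * (1 + y ^ 2)))⁻¹ := by
    rw [← Real.exp_neg, ← Real.exp_add]; congr 1; ring
  have h4 : (1 + y ^ 2) ^ N ≤ N.factorial / a ^ N * Real.exp (a * (1 + y ^ 2)) := by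
    rw [mul_pow, div_le_iff₀ (by positivity)] at h2
    rw [div_mul_eq_mul_div, le_div_iff₀ (by positivity)]
    linarith
  rw [h3]
  calc (1 + y) ^ N * (Real.exp a * (Real.exp (a * (1 + y ^ 2)))⁻¹)
      ≤ (2 * (1 + y ^ 2)) ^ N * (Real.exp a * (Real.exp (a * (1 + y ^ 2)))⁻¹) := by gcongr
    _ = 2 ^ N * Real.exp a * ((1 + y ^ 2) ^ N * (Real.exp (a * (1 + y ^ 2)))⁻¹) := by
        rw [mul_pow]; ring
    _ ≤ 2 ^ N * Real.exp a * ((N.factorial / a ^ N * Real.exp (a * (1 + y ^ 2)))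
          * (Real.exp (a * (1 + y ^ 2)))⁻¹) := by gcongr
    _ = _ := by
        have := (Real.exp_pos (a * (1 + y ^ 2))).ne'
        field_simp

/-- Every derivative of `exp` is `exp`, so the factor `exp (f x)` survives in the bound. It gives
rapid decay for Gaussians and temperate growth whenever `f ≤ 0`. -/
lemma norm_iteratedFDeriv_exp_comp_le {E : Type*} [NormedAddCommGroup E] [NormedSpace ℝ E]
    {f : E → ℝ} (hf : f.HasTemperateGrowth) (n : ℕ) :
    ∃ (k : ℕ) (C : ℝ), 0 ≤ C ∧ ∀ x,
      ‖iteratedFDeriv ℝ n (fun x => Real.exp (f x)) x‖ ≤ C * (1 + ‖x‖) ^ k * Real.exp (f x) := by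
  obtain ⟨k, C, hC, h⟩ := hf.norm_iteratedFDeriv_le_uniform n
  refine ⟨k * n, n.factorial * (1 + C) ^ n, by positivity, fun x => ?_⟩
  -- `1 + C` instead of `C` makes the base `D` at least `1`, so that `D ≤ D ^ i` for `i ≥ 1`.
  have h1 := norm_iteratedFDeriv_comp_le (g := Real.exp) (f := f) (n := n) (N := ∞)
    Real.contDiff_exp hf.1 (mod_cast le_top) x (C := Real.exp (f x))
    (D := (1 + C) * (1 + ‖x‖) ^ k) ?_ ?_
  · refine h1.trans (le_of_eq ?_)
    rw [mul_pow, ← pow_mul]; ring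
  · intro i _
    rw [norm_iteratedFDeriv_eq_norm_iteratedDeriv, iteratedDeriv_eq_iterate, Real.iter_deriv_exp,
      Real.norm_of_nonneg (Real.exp_pos _).le]
  · intro i hi hin
    calc _ ≤ C * (1 + ‖x‖) ^ k := h i hin x
      _ ≤ (1 + C) * (1 + ‖x‖) ^ k := by gcongr; simp
      _ ≤ _ := le_self_pow₀
        (one_le_mul_of_one_le_of_one_le (by simp [hC]) (by simp [one_le_pow₀])) (by omega)

lemma hasTemperateGrowth_exp_of_nonpos {E : Type*} [NormedAddCommGroup E] [NormedSpace ℝ E]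
    {f : E → ℝ} (hf : f.HasTemperateGrowth) (h0 : ∀ x, f x ≤ 0) :
    Function.HasTemperateGrowth (fun x : E => Real.exp (f x)) := by
  refine ⟨Real.contDiff_exp.comp hf.1, fun n => ?_⟩
  obtain ⟨k, C, hC, h⟩ := norm_iteratedFDeriv_exp_comp_le hf n
  refine ⟨k, C, fun x => (h x).trans ?_⟩
  exact mul_le_of_le_one_right (by positivity) (Real.exp_le_one_iff.2 (h0 x))

/-- The Gaussian `exp (-a ‖x‖ ^ 2)` as a Schwartz function. -/
def gaussian {E : Type*} [NormedAddCommGroup E] [InnerProductSpace ℝ E] (a : ℝ) (ha : 0 < a) :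
    𝓢(E, ℝ) where
  toFun x := Real.exp (-a * ‖x‖ ^ 2)
  smooth' := Real.contDiff_exp.comp
    ((Function.HasTemperateGrowth.const (-a)).mul (Function.hasTemperateGrowth_norm_sq E)).1
  decay' := by
    intro m n
    obtain ⟨k, C, hC, h⟩ := norm_iteratedFDeriv_exp_comp_le
      ((Function.HasTemperateGrowth.const (-a)).mul (Function.hasTemperateGrowth_norm_sq E)) n
    obtain ⟨C', hC', h'⟩ := exists_pow_mul_exp_neg_le ha (m + k)
    refine ⟨C * C', fun x => ?_⟩
    calc _ ≤ (1 + ‖x‖) ^ m * (C * (1 + ‖x‖) ^ k * Real.exp (-a * ‖x‖ ^ 2)) := by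
          gcongr
          · simp
          · exact h x
      _ = C * ((1 + ‖x‖) ^ (m + k) * Real.exp (-a * ‖x‖ ^ 2)) := by rw [pow_add]; ring
      _ ≤ C * C' := by gcongr; exact h' _ (norm_nonneg x)

/-! ### Waves along lines -/

/-- Along a line in the plane the kernel `pker` has this shape up to a constant, and so does `wave`
along the flow of a left invariant field. One computation serves both operators. -/
lemma hasDerivAt_wave (k : ℕ) (b α A B C t : ℝ) :
    HasDerivAt (fun t : ℝ => Complex.exp (Complex.I * ((b + α * t : ℝ) : ℂ))
        * (lagF k (A + B * t + C * t ^ 2) : ℂ))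
      (Complex.exp (Complex.I * ((b + α * t : ℝ) : ℂ)) *
        (Complex.I * α * lagF k (A + B * t + C * t ^ 2)
          + (B + 2 * C * t) * lagF' k (A + B * t + C * t ^ 2))) t := by
  have h1 : HasDerivAt (fun t : ℝ => b + α * t) α t := by
    simpa using ((hasDerivAt_id t).const_mul α).const_add b
  have h2 : HasDerivAt (fun t : ℝ => A + B * t + C * t ^ 2) (B + 2 * C * t) t := by
    convert! (((hasDerivAt_id t).const_mul B).const_add A).add
      (((hasDerivAt_id t).pow 2).const_mul C) using 1
    simp; ring
  have h3 := (h1.ofReal_comp.const_mul Complex.I).cexp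
  have h4 := ((hasDerivAt_lagF k _).comp t h2).ofReal_comp
  convert! h3.mul h4 using 1
  simp only [Function.comp_apply]
  push_cast
  ring

lemma hasDerivAt_wave' (k : ℕ) (b α A B C t : ℝ) :
    HasDerivAt (fun t : ℝ => Complex.exp (Complex.I * ((b + α * t : ℝ) : ℂ)) *
        (Complex.I * α * lagF k (A + B * t + C * t ^ 2)
          + (B + 2 * C * t) * lagF' k (A + B * t + C * t ^ 2)))
      (Complex.exp (Complex.I * ((b + α * t : ℝ) : ℂ)) *
        (-α ^ 2 * lagF k (A + B * t + C * t ^ 2)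
          + 2 * Complex.I * α * (B + 2 * C * t) * lagF' k (A + B * t + C * t ^ 2)
          + 2 * C * lagF' k (A + B * t + C * t ^ 2)
          + (B + 2 * C * t) ^ 2 * lagF'' k (A + B * t + C * t ^ 2))) t := by
  have h1 : HasDerivAt (fun t : ℝ => b + α * t) α t := by
    simpa using ((hasDerivAt_id t).const_mul α).const_add b
  have h2 : HasDerivAt (fun t : ℝ => A + B * t + C * t ^ 2) (B + 2 * C * t) t := by
    convert! (((hasDerivAt_id t).const_mul B).const_add A).add
      (((hasDerivAt_id t).pow 2).const_mul C) using 1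
    simp; ring
  have h5 : HasDerivAt (fun t : ℝ => B + 2 * C * t) (2 * C) t := by
    simpa using ((hasDerivAt_id t).const_mul (2 * C)).const_add B
  have h3 := (h1.ofReal_comp.const_mul Complex.I).cexp
  have h4 := ((hasDerivAt_lagF k _).comp t h2).ofReal_comp
  have h6 := ((hasDerivAt_lagF' k _).comp t h2).ofReal_comp
  convert! h3.mul ((h4.const_mul (Complex.I * α)).add (h5.ofReal_comp.mul h6)) using 1
  · funext s
    simp only [Function.comp_apply, Pi.mul_apply, Pi.add_apply]
    push_cast
    ring
  · simp only [Function.comp_apply, Pi.mul_apply, Pi.add_apply]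
    push_cast
    linear_combination (-Complex.exp (Complex.I * (b + α * t)) * α ^ 2
      * lagF k (A + B * t + C * t ^ 2)) * Complex.I_sq

/-! ### The kernel of the spectral projections of the twisted Laplacian -/

/-- The symplectic form on the plane. -/
def twist (p w : Plane) : ℝ := p 0 * w 1 - p 1 * w 0

/-- The kernel of the `k`-th spectral projection of the twisted Laplacian. -/
def pker (k : ℕ) (lam : ℝ) (p w : Plane) : ℂ :=
  ((lam / (2 * Real.pi) : ℝ) : ℂ) * (Complex.exp (Complex.I * ((lam / 2 * twist p w : ℝ) : ℂ))
    * (lagF k (lam / 2 * ‖p - w‖ ^ 2) : ℂ))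

lemma norm_sq_plane (p : Plane) : ‖p‖ ^ 2 = p 0 ^ 2 + p 1 ^ 2 := by
  simp [EuclideanSpace.norm_sq_eq, Fin.sum_univ_two]

lemma pker_conj (k : ℕ) (lam : ℝ) (p w : Plane) :
    starRingEnd ℂ (pker k lam p w) = pker k lam w p := by
  simp only [pker, map_mul, Complex.conj_ofReal, ← Complex.exp_conj, Complex.conj_I,
    norm_sub_rev w p]
  congr 3
  simp only [twist]
  push_cast
  ring

lemma hasTemperateGrowth_twist (w : Plane) :
    Function.HasTemperateGrowth (fun p : Plane => twist p w) :=
  ((hasTemperateGrowth_coord 0).mul (Function.HasTemperateGrowth.const _)).sub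
    ((hasTemperateGrowth_coord 1).mul (Function.HasTemperateGrowth.const _))

lemma hasTemperateGrowth_norm_sub_sq {E : Type*} [NormedAddCommGroup E] [InnerProductSpace ℝ E]
    (w : E) : Function.HasTemperateGrowth (fun p : E => ‖p - w‖ ^ 2) :=
  (Function.hasTemperateGrowth_norm_sq E).comp
    (Function.HasTemperateGrowth.id'.sub (Function.HasTemperateGrowth.const w))

/-- The kernel `pker k lam · w` as a Schwartz function. -/
def pkerS (k : ℕ) (lam : ℝ) (hlam : 0 < lam) (w : Plane) : 𝓢(Plane, ℂ) :=
  SchwartzMap.smulLeftCLM ℂ (fun p : Plane => ((lam / (2 * Real.pi) : ℝ) : ℂ)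
      * (Complex.exp (Complex.I * ((lam / 2 * twist p w : ℝ) : ℂ))
        * (((laguerre k).eval (lam / 2 * ‖p - w‖ ^ 2) : ℝ) : ℂ)))
    (SchwartzMap.postcompCLM (𝕜 := ℝ) Complex.ofRealCLM
      (SchwartzMap.compSubConstCLM ℝ w (gaussian (E := Plane) (lam / 4) (by positivity))))

lemma pkerS_apply (k : ℕ) (lam : ℝ) (hlam : 0 < lam) (w p : Plane) :
    pkerS k lam hlam w p = pker k lam p w := by
  rw [pkerS, SchwartzMap.smulLeftCLM_apply_apply]
  · simp only [SchwartzMap.postcompCLM_apply, SchwartzMap.compSubConstCLM_apply]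
    change _ • (((Real.exp (-(lam / 4) * ‖p - w‖ ^ 2) : ℝ)) : ℂ) = _
    simp only [pker, lagF, smul_eq_mul]
    rw [show -(lam / 2 * ‖p - w‖ ^ 2) / 2 = -(lam / 4) * ‖p - w‖ ^ 2 by ring]
    push_cast
    ring
  · exact (Function.HasTemperateGrowth.const _).mul ((hasTemperateGrowth_cexp_I_mul
      ((Function.HasTemperateGrowth.const _).mul (hasTemperateGrowth_twist w))).mul
      (hasTemperateGrowth_ofReal (hasTemperateGrowth_poly _
        ((Function.HasTemperateGrowth.const _).mul (hasTemperateGrowth_norm_sub_sq w)))))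

lemma pkerS_coe (k : ℕ) (lam : ℝ) (hlam : 0 < lam) (w : Plane) :
    ⇑(pkerS k lam hlam w) = fun p => pker k lam p w := funext (pkerS_apply k lam hlam w)

lemma pd_eq_lineDerivOp (j : Fin 2) (φ : 𝓢(Plane, ℂ)) :
    pd j φ = ⇑(∂_{(EuclideanSpace.single j (1 : ℝ) : Plane)} φ : 𝓢(Plane, ℂ)) := by
  funext p
  rw [SchwartzMap.lineDerivOp_apply_eq_fderiv]
  rfl

lemma pd_eq_deriv (j : Fin 2) (φ : 𝓢(Plane, ℂ)) (p : Plane) :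
    pd j φ p = deriv (fun t : ℝ => φ (p + t • EuclideanSpace.single j 1)) 0 := by
  rw [pd_eq_lineDerivOp, SchwartzMap.lineDerivOp_apply]
  rfl

lemma pd_pd_eq_deriv (j : Fin 2) (φ : 𝓢(Plane, ℂ)) (p : Plane) :
    pd j (pd j φ) p
      = deriv (deriv (fun t : ℝ => φ (p + t • EuclideanSpace.single j 1))) 0 := by
  have h : deriv (fun t : ℝ => φ (p + t • EuclideanSpace.single j 1))
      = fun t : ℝ => pd j φ (p + t • EuclideanSpace.single j 1) := by
    funext t
    rw [pd_eq_deriv]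
    have := deriv_comp_const_add (f := fun t : ℝ => φ (p + t • EuclideanSpace.single j 1)) t 0
    rw [add_zero] at this
    rw [← this]
    congr 1
    funext s
    rw [add_smul, add_assoc]
  rw [h, pd_eq_lineDerivOp, pd_eq_deriv]

lemma pker_line (k : ℕ) (lam : ℝ) (p w v : Plane) (t : ℝ) :
    pker k lam (p + t • v) w = ((lam / (2 * Real.pi) : ℝ) : ℂ) *
      (Complex.exp (Complex.I * ((lam / 2 * twist p w + lam / 2 * twist v w * t : ℝ) : ℂ))
        * (lagF k (lam / 2 * ‖p - w‖ ^ 2 + lam * ((p 0 - w 0) * v 0 + (p 1 - w 1) * v 1) * t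
          + lam / 2 * (v 0 ^ 2 + v 1 ^ 2) * t ^ 2) : ℂ)) := by
  simp only [pker]
  congr 3
  · congr 2
    simp [twist]; ring
  · congr 1
    simp [norm_sq_plane]; ring

lemma pd_pkerS (k : ℕ) (lam : ℝ) (hlam : 0 < lam) (w p : Plane) (j : Fin 2) :
    pd j (pkerS k lam hlam w) p = ((lam / (2 * Real.pi) : ℝ) : ℂ) *
      (Complex.exp (Complex.I * ((lam / 2 * twist p w : ℝ) : ℂ)) *
        (Complex.I * ((lam / 2 * twist (EuclideanSpace.single j 1) w : ℝ) : ℂ)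
            * lagF k (lam / 2 * ‖p - w‖ ^ 2)
          + (lam * (p j - w j) : ℝ) * lagF' k (lam / 2 * ‖p - w‖ ^ 2))) := by
  rw [pd_eq_deriv]
  simp_rw [pkerS_apply, pker_line]
  rw [((hasDerivAt_wave k _ _ _ _ _ 0).const_mul _).deriv]
  fin_cases j <;> simp

lemma pd_pd_pkerS (k : ℕ) (lam : ℝ) (hlam : 0 < lam) (w p : Plane) (j : Fin 2) :
    pd j (pd j (pkerS k lam hlam w)) p = ((lam / (2 * Real.pi) : ℝ) : ℂ) *
      (Complex.exp (Complex.I * ((lam / 2 * twist p w : ℝ) : ℂ)) *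
        (-((lam / 2 * twist (EuclideanSpace.single j 1) w : ℝ) : ℂ) ^ 2
            * lagF k (lam / 2 * ‖p - w‖ ^ 2)
          + 2 * Complex.I * ((lam / 2 * twist (EuclideanSpace.single j 1) w : ℝ) : ℂ)
            * (lam * (p j - w j) : ℝ) * lagF' k (lam / 2 * ‖p - w‖ ^ 2)
          + lam * lagF' k (lam / 2 * ‖p - w‖ ^ 2)
          + ((lam * (p j - w j) : ℝ) : ℂ) ^ 2 * lagF'' k (lam / 2 * ‖p - w‖ ^ 2))) := by
  rw [pd_pd_eq_deriv]
  simp_rw [pkerS_apply, pker_line]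
  have h : ∀ c b α A B C, deriv (deriv fun t : ℝ => c * (Complex.exp (Complex.I * ((b + α * t : ℝ) : ℂ))
        * (lagF k (A + B * t + C * t ^ 2) : ℂ))) 0
      = c * (Complex.exp (Complex.I * ((b + α * 0 : ℝ) : ℂ)) *
        (-α ^ 2 * lagF k (A + B * 0 + C * 0 ^ 2)
          + 2 * Complex.I * α * (B + 2 * C * (0 : ℝ)) * lagF' k (A + B * 0 + C * 0 ^ 2)
          + 2 * C * lagF' k (A + B * 0 + C * 0 ^ 2)
          + (B + 2 * C * (0 : ℝ)) ^ 2 * lagF'' k (A + B * 0 + C * 0 ^ 2))) := by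
    intro c b α A B C
    rw [show deriv (fun t : ℝ => c * (Complex.exp (Complex.I * ((b + α * t : ℝ) : ℂ))
        * (lagF k (A + B * t + C * t ^ 2) : ℂ))) = _ from
      funext fun t => ((hasDerivAt_wave k b α A B C t).const_mul c).deriv]
    exact ((hasDerivAt_wave' k b α A B C 0).const_mul c).deriv
  rw [h]
  fin_cases j
  all_goals
    simp only [mul_zero, add_zero, Complex.ofReal_zero, ne_eq, OfNat.ofNat_ne_zero,
      not_false_eq_true, zero_pow]
    simp
    ring_nf
    simp

/-- The phase `exp(iλ twist/2)` is the gauge factor of a magnetic translation, so the terms in which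
it is differentiated cancel against the rotation term and the potential. What is left is `-2λ` times
the Laguerre equation at `λ|p-w|²/2`. -/
lemma twistedLaplacian_pkerS (k : ℕ) (lam : ℝ) (hlam : 0 < lam) (w p : Plane) :
    twistedLaplacian lam (pkerS k lam hlam w) p
      = ((lam * (2 * k + 1) : ℝ) : ℂ) * pkerS k lam hlam w p := by
  have hode := congrArg (fun x : ℝ => (x : ℂ)) (lagF_ode k (lam / 2 * ‖p - w‖ ^ 2))
  simp only [twistedLaplacian, pd_pkerS, pd_pd_pkerS, pkerS_apply, pker]
  rw [norm_sq_plane] at hode ⊢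
  set c : ℂ := ((lam / (2 * Real.pi) : ℝ) : ℂ)
  set e : ℂ := Complex.exp (Complex.I * ((lam / 2 * twist p w : ℝ) : ℂ))
  simp [twist] at hode ⊢
  linear_combination (-2 * lam * c * e) * hode + (c * e * lam ^ 2 / 2 * (p 0 * w 0 + p 1 * w 1)
    * lagF k (lam / 2 * ((p 0 - w 0) ^ 2 + (p 1 - w 1) ^ 2))) * Complex.I_sq

end FreeTwoStep
end

noncomputable section
namespace FreeTwoStep
open scoped LineDeriv ContDiff

/-! ### The eigenspaces of the twisted Laplacian -/

/-- The multiplication form `-i ∂_j + c` of a magnetic momentum operator on Schwartz functions. -/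
def momentum (j : Fin 2) (c : Plane → ℝ) (φ : 𝓢(Plane, ℂ)) : 𝓢(Plane, ℂ) :=
  (-Complex.I) • ∂_{(EuclideanSpace.single j (1 : ℝ) : Plane)} φ + SchwartzMap.smulLeftCLM ℂ c φ

lemma momentum_apply (j : Fin 2) {c : Plane → ℝ} (hc : c.HasTemperateGrowth) (φ : 𝓢(Plane, ℂ))
    (p : Plane) : momentum j c φ p = -Complex.I * pd j φ p + c p * φ p := by
  simp [momentum, SchwartzMap.smulLeftCLM_apply_apply hc, pd_eq_lineDerivOp]

lemma integral_conj_mul_lineDeriv {E : Type*} [NormedAddCommGroup E] [NormedSpace ℝ E]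
    [MeasurableSpace E] [BorelSpace E] [FiniteDimensional ℝ E] {μ : Measure E}
    [μ.IsAddHaarMeasure] (φ ψ : 𝓢(E, ℂ)) (v : E) :
    ∫ p, starRingEnd ℂ (φ p) * (∂_{v} ψ : 𝓢(E, ℂ)) p ∂μ
      = -∫ p, starRingEnd ℂ ((∂_{v} φ : 𝓢(E, ℂ)) p) * ψ p ∂μ :=
  SchwartzMap.integral_bilinear_lineDerivOp_right_eq_neg_left (μ := μ) φ ψ
    ((ContinuousLinearMap.mul ℝ ℂ).comp (Complex.conjCLE : ℂ →L[ℝ] ℂ)) v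

lemma integrable_conj_mul {E : Type*} [NormedAddCommGroup E] [NormedSpace ℝ E]
    [MeasurableSpace E] [BorelSpace E] [FiniteDimensional ℝ E] {μ : Measure E}
    [μ.IsAddHaarMeasure] (φ ψ : 𝓢(E, ℂ)) :
    Integrable (fun p => starRingEnd ℂ (φ p) * ψ p) μ := by
  have h := (ψ.integrable (μ := μ)).bdd_mul (f := fun p => starRingEnd ℂ (φ p))
    (c := SchwartzMap.seminorm ℝ 0 0 φ)
    (Complex.continuous_conj.comp φ.continuous).aestronglyMeasurable
    (Filter.Eventually.of_forall fun p => by simpa using SchwartzMap.norm_le_seminorm ℝ φ p)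
  exact h

lemma momentum_symm (j : Fin 2) {c : Plane → ℝ} (hc : c.HasTemperateGrowth) (φ ψ : 𝓢(Plane, ℂ)) :
    ∫ p, starRingEnd ℂ (momentum j c φ p) * ψ p = ∫ p, starRingEnd ℂ (φ p) * momentum j c ψ p := by
  have h := integral_conj_mul_lineDeriv (μ := volume) φ ψ (EuclideanSpace.single j (1 : ℝ))
  have i1 := integrable_conj_mul (μ := volume)
    (∂_{(EuclideanSpace.single j (1 : ℝ) : Plane)} φ) ψ
  have i2 := integrable_conj_mul (μ := volume) φ
    (∂_{(EuclideanSpace.single j (1 : ℝ) : Plane)} ψ)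
  have i3 := integrable_conj_mul (μ := volume) φ (SchwartzMap.smulLeftCLM ℂ c ψ)
  rw [← sub_eq_zero, ← integral_sub (integrable_conj_mul _ _) (integrable_conj_mul _ _)]
  have e : ∀ p, starRingEnd ℂ (momentum j c φ p) * ψ p
      - starRingEnd ℂ (φ p) * momentum j c ψ p =
      Complex.I * (starRingEnd ℂ ((∂_{(EuclideanSpace.single j (1 : ℝ) : Plane)} φ :
        𝓢(Plane, ℂ)) p) * ψ p) + Complex.I * (starRingEnd ℂ (φ p) *
        (∂_{(EuclideanSpace.single j (1 : ℝ) : Plane)} ψ : 𝓢(Plane, ℂ)) p) := by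
    intro p
    simp only [momentum_apply j hc, pd_eq_lineDerivOp, map_add, map_mul, map_neg,
      Complex.conj_I, Complex.conj_ofReal]
    ring
  simp_rw [e]
  rw [integral_add (i1.const_mul _) (i2.const_mul _), integral_const_mul, integral_const_mul, h]
  ring

/-- The twisted Laplacian on Schwartz functions. -/
def twistedLaplacianS (lam : ℝ) (φ : 𝓢(Plane, ℂ)) : 𝓢(Plane, ℂ) :=
  momentum 0 (fun p => -(lam / 2) * p 1) (momentum 0 (fun p => -(lam / 2) * p 1) φ)
    + momentum 1 (fun p => lam / 2 * p 0) (momentum 1 (fun p => lam / 2 * p 0) φ)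

lemma hasTemperateGrowth_const_mul_coord (c : ℝ) (j : Fin 2) :
    Function.HasTemperateGrowth (fun p : Plane => c * p j) :=
  (Function.HasTemperateGrowth.const c).mul (hasTemperateGrowth_coord j)

lemma pd_momentum (i j : Fin 2) (hij : i ≠ j) (c : ℝ) (φ : 𝓢(Plane, ℂ)) (p : Plane) :
    pd i (momentum i (fun p => c * p j) φ) p
      = -Complex.I * pd i (pd i φ) p + (c * p j : ℝ) * pd i φ p := by
  have hs : ∀ ψ : 𝓢(Plane, ℂ), HasDerivAt
      (fun t : ℝ => ψ (p + t • EuclideanSpace.single i 1)) (pd i ψ p) 0 := by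
    intro ψ
    have h0 : HasDerivAt (fun t : ℝ => p + t • (EuclideanSpace.single i 1 : Plane))
        (EuclideanSpace.single i 1) 0 := by
      simpa using ((hasDerivAt_id (0 : ℝ)).smul_const (EuclideanSpace.single i 1 : Plane)).const_add p
    have h1 : HasFDerivAt ψ (fderiv ℝ ψ p) (p + (0 : ℝ) • (EuclideanSpace.single i 1 : Plane)) := by
      rw [zero_smul, add_zero]
      exact ψ.hasFDerivAt p
    exact h1.comp_hasDerivAt 0 h0
  have hpd := hs (∂_{(EuclideanSpace.single i (1 : ℝ) : Plane)} φ)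
  rw [← pd_eq_lineDerivOp] at hpd
  refine (hs (momentum i (fun p => c * p j) φ)).unique ?_
  simp only [momentum_apply i (hasTemperateGrowth_const_mul_coord c j)]
  refine ((hpd.const_mul (-Complex.I)).add ((hs φ).const_mul ((c * p j : ℝ) : ℂ))).congr_of_eventuallyEq
    (Filter.Eventually.of_forall fun t => ?_)
  simp [hij.symm]

/-- Expansion of `(-i∂_s - λt/2)² + (-i∂_t + λs/2)²`; each potential is independent of the variable
being differentiated. The sum of squares makes symmetry evident. -/
lemma twistedLaplacianS_apply (lam : ℝ) (φ : 𝓢(Plane, ℂ)) (p : Plane) :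
    twistedLaplacianS lam φ p = twistedLaplacian lam φ p := by
  simp only [twistedLaplacianS, add_apply,
    momentum_apply _ (hasTemperateGrowth_const_mul_coord _ _), pd_momentum _ _ zero_ne_one,
    pd_momentum _ _ one_ne_zero, twistedLaplacian]
  push_cast
  linear_combination (pd 0 (pd 0 φ) p + pd 1 (pd 1 φ) p) * Complex.I_sq

lemma twistedLaplacianS_symm (lam : ℝ) (φ ψ : 𝓢(Plane, ℂ)) :
    ∫ p, starRingEnd ℂ (twistedLaplacianS lam φ p) * ψ p
      = ∫ p, starRingEnd ℂ (φ p) * twistedLaplacianS lam ψ p := by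
  simp only [twistedLaplacianS, add_apply, map_add, add_mul, mul_add]
  rw [integral_add (integrable_conj_mul _ _) (integrable_conj_mul _ _),
    integral_add (integrable_conj_mul _ _) (integrable_conj_mul _ _),
    momentum_symm 0 (hasTemperateGrowth_const_mul_coord _ _),
    momentum_symm 0 (hasTemperateGrowth_const_mul_coord _ _),
    momentum_symm 1 (hasTemperateGrowth_const_mul_coord _ _),
    momentum_symm 1 (hasTemperateGrowth_const_mul_coord _ _)]

/-- The function `Δ^lam φ - lam (2 k + 1) φ` as a Schwartz function. -/
def eigenDefect (k : ℕ) (lam : ℝ) (φ : 𝓢(Plane, ℂ)) : 𝓢(Plane, ℂ) :=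
  twistedLaplacianS lam φ - ((lam * (2 * k + 1) : ℝ) : ℂ) • φ

lemma L2_inner_eq {α : Type*} [MeasurableSpace α] {μ : Measure α} (f g : Lp ℂ 2 μ) :
    inner ℂ f g = ∫ p, starRingEnd ℂ (f p) * g p ∂μ := by
  rw [L2.inner_def]
  simp_rw [RCLike.inner_apply, mul_comm]

lemma mem_eigenspace_iff (k : ℕ) (lam : ℝ) (u : Lp ℂ 2 (volume : Measure Plane)) :
    u ∈ eigenspace k lam ↔
      ∀ φ : 𝓢(Plane, ℂ), ∫ p, starRingEnd ℂ (eigenDefect k lam φ p) * u p = 0 := by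
  have hdef : ∀ φ : 𝓢(Plane, ℂ), ∀ p, eigenDefect k lam φ p
      = twistedLaplacian lam φ p - ((lam * (2 * k + 1) : ℝ) : ℂ) * φ p := by
    intro φ p
    simp [eigenDefect, twistedLaplacianS_apply]
  have hin : ∀ (φ : 𝓢(Plane, ℂ)) (w : Lp ℂ 2 (volume : Measure Plane)),
      (w =ᵐ[volume] fun p => twistedLaplacian lam φ p - ((lam * (2 * k + 1) : ℝ) : ℂ) * φ p) →
      inner ℂ w u = ∫ p, starRingEnd ℂ (eigenDefect k lam φ p) * u p := by
    intro φ w hw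
    rw [L2_inner_eq]
    refine integral_congr_ae ?_
    filter_upwards [hw] with p hp
    rw [hp, hdef]
  rw [eigenspace, Submodule.mem_orthogonal]
  constructor
  · intro h φ
    rw [← hin φ ((eigenDefect k lam φ).toLp 2 volume) ?_]
    · refine h _ (Submodule.subset_span ⟨φ, ?_⟩)
      filter_upwards [(eigenDefect k lam φ).coeFn_toLp 2 volume] with p hp
      rw [hp, hdef]
    · filter_upwards [(eigenDefect k lam φ).coeFn_toLp 2 volume] with p hp
      rw [hp, hdef]
  · intro h w hw
    induction hw using Submodule.span_induction with
    | mem w hw =>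
      obtain ⟨φ, hφ⟩ := hw
      rw [hin φ w hφ, h φ]
    | zero => simp
    | add x y _ _ hx hy => rw [inner_add_left, hx, hy, add_zero]
    | smul a x _ hx => rw [inner_smul_left, hx, mul_zero]

lemma eigenDefect_pkerS (j k : ℕ) (lam : ℝ) (hlam : 0 < lam) (w p : Plane) :
    eigenDefect k lam (pkerS j lam hlam w) p
      = ((lam * (2 * j + 1) - lam * (2 * k + 1) : ℝ) : ℂ) * pker j lam p w := by
  simp only [eigenDefect, sub_apply, twistedLaplacianS_apply, twistedLaplacian_pkerS,
    smul_apply, pkerS_apply, smul_eq_mul]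
  push_cast
  ring

lemma integral_conj_eigenDefect_mul_pker (k : ℕ) (lam : ℝ) (hlam : 0 < lam) (w : Plane)
    (φ : 𝓢(Plane, ℂ)) :
    ∫ p, starRingEnd ℂ (eigenDefect k lam φ p) * pker k lam p w = 0 := by
  simp_rw [← pkerS_apply k lam hlam]
  have h := twistedLaplacianS_symm lam φ (pkerS k lam hlam w)
  simp_rw [twistedLaplacianS_apply lam (pkerS k lam hlam w), twistedLaplacian_pkerS] at h
  have e : ∀ p, starRingEnd ℂ (eigenDefect k lam φ p) * pkerS k lam hlam w p
      = starRingEnd ℂ (twistedLaplacianS lam φ p) * pkerS k lam hlam w p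
        - ((lam * (2 * k + 1) : ℝ) : ℂ) * (starRingEnd ℂ (φ p) * pkerS k lam hlam w p) := by
    intro p
    simp only [eigenDefect, sub_apply, smul_apply, smul_eq_mul, map_sub,
      map_mul, Complex.conj_ofReal]
    ring
  simp_rw [e]
  rw [integral_sub (integrable_conj_mul _ _) ((integrable_conj_mul _ _).const_mul _), h,
    integral_const_mul, ← integral_const_mul, sub_eq_zero]
  congr 1
  funext p
  ring

/-- The weak equation for `u` is tested against the Schwartz function `pker j lam · w`, whose defect
is `2λ(j-k) ≠ 0` times itself. -/
lemma integral_conj_pker_mul_eq_zero {j k : ℕ} (hjk : j ≠ k) (lam : ℝ) (hlam : 0 < lam)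
    (w : Plane) {u : Lp ℂ 2 (volume : Measure Plane)} (hu : u ∈ eigenspace k lam) :
    ∫ p, starRingEnd ℂ (pker j lam p w) * u p = 0 := by
  have h := (mem_eigenspace_iff k lam u).1 hu (pkerS j lam hlam w)
  simp_rw [eigenDefect_pkerS, map_mul, Complex.conj_ofReal, mul_assoc] at h
  rw [integral_const_mul, mul_eq_zero] at h
  refine h.resolve_left ?_
  have hjk' : (j : ℝ) ≠ k := by exact_mod_cast hjk
  have : lam * (2 * j + 1) - lam * (2 * k + 1) ≠ 0 := by
    have : lam * (2 * j + 1) - lam * (2 * k + 1) = 2 * lam * (j - k) := by ring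
    rw [this]
    exact mul_ne_zero (by positivity) (sub_ne_zero.2 hjk')
  exact_mod_cast this

end FreeTwoStep
end

noncomputable section
namespace FreeTwoStep
open scoped LineDeriv ContDiff
open Filter Topology

/-! ### Integral operators on the plane -/

lemma integrable_inv_one_add_norm_pow {E : Type*} [NormedAddCommGroup E] [NormedSpace ℝ E]
    [FiniteDimensional ℝ E] [MeasurableSpace E] [BorelSpace E] (μ : Measure E)
    [μ.IsAddHaarMeasure] {n : ℕ} (h : Module.finrank ℝ E < n) :
    Integrable (fun x : E => ((1 + ‖x‖) ^ n)⁻¹) μ := by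
  have h1 := integrable_one_add_norm (E := E) (μ := μ) (r := n) (by exact_mod_cast h)
  refine h1.congr (Eventually.of_forall fun x => ?_)
  simp only
  rw [Real.rpow_neg (by positivity), Real.rpow_natCast]

lemma finrank_plane : Module.finrank ℝ Plane = 2 := by simp

/-- A continuous function on the plane that decays like `‖p‖⁻³`. -/
structure PlaneDecay (g : Plane → ℂ) (C : ℝ) : Prop where
  continuous : Continuous g
  bound : ∀ p, ‖g p‖ * (1 + ‖p‖) ^ 3 ≤ C

namespace PlaneDecay
variable {g : Plane → ℂ} {C : ℝ}

lemma nonneg (hg : PlaneDecay g C) : 0 ≤ C :=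
  le_trans (by positivity) (hg.bound 0)

lemma norm_le (hg : PlaneDecay g C) (p : Plane) : ‖g p‖ ≤ C * ((1 + ‖p‖) ^ 3)⁻¹ := by
  rw [← div_eq_mul_inv, le_div_iff₀ (by positivity)]
  exact hg.bound p

lemma norm_le_const (hg : PlaneDecay g C) (p : Plane) : ‖g p‖ ≤ C :=
  (hg.norm_le p).trans (mul_le_of_le_one_right hg.nonneg
    (inv_le_one_of_one_le₀ (one_le_pow₀ (by simp))))

lemma integrable (hg : PlaneDecay g C) : Integrable g := by
  refine ((integrable_inv_one_add_norm_pow (E := Plane) volume (n := 3)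
    (by rw [finrank_plane]; norm_num)).const_mul C).mono' hg.continuous.aestronglyMeasurable
    (Eventually.of_forall hg.norm_le)

lemma memLp (hg : PlaneDecay g C) : MemLp g 2 volume := by
  rw [memLp_two_iff_integrable_sq_norm hg.continuous.aestronglyMeasurable]
  refine (hg.integrable.norm.const_mul C).mono'
    (hg.continuous.norm.pow 2).aestronglyMeasurable (Eventually.of_forall fun p => ?_)
  rw [Real.norm_of_nonneg (by positivity), pow_two]
  gcongr
  exact hg.norm_le_const p

end PlaneDecay

lemma integrable_exp_neg_mul_weight {c : ℝ} (hc : 0 < c) (n : ℕ) :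
    Integrable (fun z : Plane => Real.exp (-c * ‖z‖ ^ 2) * (1 + ‖z‖) ^ n) := by
  obtain ⟨C, hC, h⟩ := exists_pow_mul_exp_neg_le hc (n + 3)
  refine ((integrable_inv_one_add_norm_pow (E := Plane) volume (n := 3)
    (by rw [finrank_plane]; norm_num)).const_mul C).mono'
    (by fun_prop) (Eventually.of_forall fun z => ?_)
  rw [Real.norm_of_nonneg (by positivity), ← div_eq_mul_inv, le_div_iff₀ (by positivity)]
  have := h ‖z‖ (norm_nonneg z)
  rw [pow_add] at this
  linarith

lemma integrable_exp_neg {c : ℝ} (hc : 0 < c) :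
    Integrable (fun z : Plane => Real.exp (-c * ‖z‖ ^ 2)) := by
  simpa using integrable_exp_neg_mul_weight hc 0

/-- A continuous kernel on the plane with Gaussian decay off the diagonal. -/
structure GaussKernel (K : Plane → Plane → ℂ) (C c : ℝ) : Prop where
  continuous : Continuous (Function.uncurry K)
  pos : 0 < c
  bound : ∀ p w, ‖K p w‖ ≤ C * Real.exp (-c * ‖p - w‖ ^ 2)

/-- The integral operator with kernel `K`. -/
def intOp (K : Plane → Plane → ℂ) (g : Plane → ℂ) (p : Plane) : ℂ := ∫ w, K p w * g w

lemma integrable_norm_sq_of_memLp {α : Type*} [MeasurableSpace α] {μ : Measure α} {u : α → ℂ}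
    (hu : MemLp u 2 μ) : Integrable (fun p => ‖u p‖ ^ 2) μ :=
  (memLp_two_iff_integrable_sq_norm hu.aestronglyMeasurable).1 hu

lemma weight_le (p w : Plane) : (1 + ‖p‖) ^ 3 ≤ (1 + ‖p - w‖) ^ 3 * (1 + ‖w‖) ^ 3 := by
  rw [← mul_pow]
  gcongr
  have := norm_add_le (p - w) w
  rw [sub_add_cancel] at this
  nlinarith [mul_nonneg (norm_nonneg (p - w)) (norm_nonneg w)]

namespace GaussKernel
variable {K : Plane → Plane → ℂ} {C c : ℝ}

lemma nonneg (hK : GaussKernel K C c) : 0 ≤ C := by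
  have := (norm_nonneg _).trans (hK.bound 0 0)
  simpa using this

lemma continuous_left (hK : GaussKernel K C c) (w : Plane) : Continuous fun p => K p w :=
  hK.continuous.comp (by fun_prop : Continuous fun p : Plane => (p, w))

lemma continuous_right (hK : GaussKernel K C c) (p : Plane) : Continuous fun w => K p w :=
  hK.continuous.comp (by fun_prop : Continuous fun w : Plane => (p, w))

lemma norm_le (hK : GaussKernel K C c) (p w : Plane) : ‖K p w‖ ≤ C :=
  (hK.bound p w).trans (mul_le_of_le_one_right hK.nonneg (Real.exp_le_one_iff.2 (by
    have := hK.pos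
    have : 0 ≤ c * ‖p - w‖ ^ 2 := by positivity
    linarith)))

lemma integrable_mul (hK : GaussKernel K C c) {g : Plane → ℂ} (hg : Integrable g) (p : Plane) :
    Integrable fun w => K p w * g w :=
  hg.bdd_mul (hK.continuous_right p).aestronglyMeasurable (Eventually.of_forall (hK.norm_le p))

lemma planeDecay_intOp (hK : GaussKernel K C c) {g : Plane → ℂ} {Cg : ℝ} (hg : PlaneDecay g Cg) :
    PlaneDecay (intOp K g)
      (C * Cg * ∫ z : Plane, Real.exp (-c * ‖z‖ ^ 2) * (1 + ‖z‖) ^ 3) where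
  continuous := by
    refine continuous_of_dominated (bound := fun w => C * ‖g w‖)
      (fun p => (hK.integrable_mul hg.integrable p).aestronglyMeasurable)
      (fun p => Eventually.of_forall fun w => ?_) (hg.integrable.norm.const_mul C)
      (Eventually.of_forall fun w => (hK.continuous_left w).mul continuous_const)
    rw [norm_mul]
    gcongr
    exact hK.norm_le p w
  bound := by
    intro p
    have hi := (integrable_exp_neg_mul_weight hK.pos 3).comp_sub_left p
    have hC := hK.nonneg
    have hCg := hg.nonneg
    calc ‖intOp K g p‖ * (1 + ‖p‖) ^ 3
        ≤ (∫ w, ‖K p w * g w‖) * (1 + ‖p‖) ^ 3 := by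
          gcongr
          exact norm_integral_le_integral_norm _
      _ = ∫ w, ‖K p w * g w‖ * (1 + ‖p‖) ^ 3 := (integral_mul_const _ _).symm
      _ ≤ ∫ w, C * Cg * (Real.exp (-c * ‖p - w‖ ^ 2) * (1 + ‖p - w‖) ^ 3) := by
          refine integral_mono_of_nonneg (Eventually.of_forall fun w => by positivity)
            (hi.const_mul _) (Eventually.of_forall fun w => ?_)
          simp only
          rw [norm_mul]
          calc ‖K p w‖ * ‖g w‖ * (1 + ‖p‖) ^ 3
              ≤ (C * Real.exp (-c * ‖p - w‖ ^ 2)) * ‖g w‖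
                * ((1 + ‖p - w‖) ^ 3 * (1 + ‖w‖) ^ 3) := by
                gcongr
                · exact hK.bound p w
                · exact weight_le p w
            _ = (C * Real.exp (-c * ‖p - w‖ ^ 2)) * (1 + ‖p - w‖) ^ 3
                * (‖g w‖ * (1 + ‖w‖) ^ 3) := by ring
            _ ≤ (C * Real.exp (-c * ‖p - w‖ ^ 2)) * (1 + ‖p - w‖) ^ 3 * Cg := by
                gcongr
                exact hg.bound w
            _ = _ := by ring
      _ = _ := by
          rw [integral_const_mul,
            integral_sub_left_eq_self (fun z : Plane =>
              Real.exp (-c * ‖z‖ ^ 2) * (1 + ‖z‖) ^ 3) volume p]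

/-- Splitting the product into a sum of squares makes the integral over `p` bounded uniformly in
`w`, with `u` only square integrable. -/
lemma bound_mul (hK : GaussKernel K C c) (u : Plane → ℂ) (p w : Plane) :
    ‖starRingEnd ℂ (K p w) * u p‖
      ≤ C * (Real.exp (-(2 * c) * ‖p - w‖ ^ 2) + ‖u p‖ ^ 2) := by
  have h1 : Real.exp (-(2 * c) * ‖p - w‖ ^ 2) = Real.exp (-c * ‖p - w‖ ^ 2) ^ 2 := by
    rw [← Real.exp_nat_mul]; congr 1; push_cast; ring
  rw [norm_mul, RCLike.norm_conj, h1]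
  calc ‖K p w‖ * ‖u p‖ ≤ C * Real.exp (-c * ‖p - w‖ ^ 2) * ‖u p‖ := by
        gcongr; exact hK.bound p w
    _ = C * (Real.exp (-c * ‖p - w‖ ^ 2) * ‖u p‖) := by ring
    _ ≤ _ := by
        gcongr
        · exact hK.nonneg
        · nlinarith [sq_nonneg (Real.exp (-c * ‖p - w‖ ^ 2) - ‖u p‖),
            sq_nonneg (Real.exp (-c * ‖p - w‖ ^ 2)), sq_nonneg ‖u p‖]

lemma integrable_conj_mul_left (hK : GaussKernel K C c) {u : Plane → ℂ} (hu : MemLp u 2 volume)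
    (w : Plane) : Integrable fun p => starRingEnd ℂ (K p w) * u p := by
  have h2c : 0 < 2 * c := by linarith [hK.pos]
  refine ((((integrable_exp_neg h2c).comp_sub_right w).add (integrable_norm_sq_of_memLp hu)).const_mul
    C).mono' ((Complex.continuous_conj.comp (hK.continuous_left w)).aestronglyMeasurable.mul
      hu.aestronglyMeasurable) (Eventually.of_forall fun p => hK.bound_mul u p w)

lemma integral_norm_conj_mul_le (hK : GaussKernel K C c) {u : Plane → ℂ} (hu : MemLp u 2 volume)
    (w : Plane) : ∫ p, ‖starRingEnd ℂ (K p w) * u p‖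
      ≤ C * ((∫ z : Plane, Real.exp (-(2 * c) * ‖z‖ ^ 2)) + ∫ p, ‖u p‖ ^ 2) := by
  have h2c : 0 < 2 * c := by linarith [hK.pos]
  have h1 := (integrable_exp_neg h2c).comp_sub_right w
  refine (integral_mono (hK.integrable_conj_mul_left hu w).norm
    ((h1.add (integrable_norm_sq_of_memLp hu)).const_mul C) fun p => hK.bound_mul u p w).trans_eq ?_
  simp only [Pi.add_apply]
  rw [integral_const_mul, integral_add h1 (integrable_norm_sq_of_memLp hu),
    integral_sub_right_eq_self (fun z : Plane => Real.exp (-(2 * c) * ‖z‖ ^ 2))]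

/-- The adjoint of an integral operator, applied to a square integrable function. -/
lemma integral_conj_intOp_mul (hK : GaussKernel K C c) {g u : Plane → ℂ} {Cg : ℝ}
    (hg : PlaneDecay g Cg) (hu : MemLp u 2 volume) :
    ∫ p, starRingEnd ℂ (intOp K g p) * u p
      = ∫ w, starRingEnd ℂ (g w) * ∫ p, starRingEnd ℂ (K p w) * u p := by
  have hmeas : AEStronglyMeasurable (Function.uncurry fun p w : Plane =>
      starRingEnd ℂ (g w) * (starRingEnd ℂ (K p w) * u p)) (volume.prod volume) := by
    refine ((Complex.continuous_conj.comp (hg.continuous.comp continuous_snd)).aestronglyMeasurable).mul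
      (((Complex.continuous_conj.comp hK.continuous).aestronglyMeasurable).mul ?_)
    exact hu.aestronglyMeasurable.comp_fst
  have hint : Integrable (Function.uncurry fun p w : Plane =>
      starRingEnd ℂ (g w) * (starRingEnd ℂ (K p w) * u p)) (volume.prod volume) := by
    rw [integrable_prod_iff' hmeas]
    refine ⟨Eventually.of_forall fun w =>
      (hK.integrable_conj_mul_left hu w).const_mul (starRingEnd ℂ (g w)), ?_⟩
    refine (hg.integrable.norm.mul_const (C * ((∫ z : Plane, Real.exp (-(2 * c) * ‖z‖ ^ 2))
      + ∫ p, ‖u p‖ ^ 2))).mono' hmeas.norm.prod_swap.integral_prod_right'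
      (Eventually.of_forall fun w => ?_)
    simp only [Function.uncurry]
    simp_rw [norm_mul (starRingEnd ℂ (g w))]
    rw [integral_const_mul, RCLike.norm_conj, Real.norm_of_nonneg (by positivity)]
    gcongr
    exact hK.integral_norm_conj_mul_le hu w
  rw [show (fun p => starRingEnd ℂ (intOp K g p) * u p) = fun p => ∫ w,
      starRingEnd ℂ (g w) * (starRingEnd ℂ (K p w) * u p) from ?_, integral_integral_swap hint]
  · simp_rw [integral_const_mul]
  · funext p
    rw [intOp, ← integral_conj, ← integral_mul_const]
    congr 1
    funext w
    rw [map_mul]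
    ring

end GaussKernel

lemma continuous_pker (k : ℕ) (lam : ℝ) : Continuous (Function.uncurry (pker k lam)) := by
  have h1 := continuous_lagF k
  unfold pker twist Function.uncurry
  fun_prop

lemma gaussKernel_pker (k : ℕ) {lam ρ : ℝ} (hlam : 0 < lam) (hρ : 0 < ρ) (hρ1 : ρ < 1) :
    GaussKernel (pker k lam) (lam / (2 * Real.pi) * (1 - ρ)⁻¹ / ρ ^ k)
      (lam / 4 * ((1 - ρ) / (1 + ρ))) where
  continuous := continuous_pker k lam
  pos := by
    have : 0 < 1 - ρ := by linarith
    positivity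
  bound p w := by
    have h := abs_lagF_le k (x := lam / 2 * ‖p - w‖ ^ 2) (by positivity) hρ hρ1
    have hpi := Real.pi_pos
    have hn : ‖pker k lam p w‖ = lam / (2 * Real.pi) * |lagF k (lam / 2 * ‖p - w‖ ^ 2)| := by
      rw [pker, norm_mul, norm_mul, mul_comm Complex.I, Complex.norm_exp_ofReal_mul_I,
        Complex.norm_real, Complex.norm_real, one_mul, Real.norm_of_nonneg (by positivity),
        Real.norm_eq_abs]
    rw [hn]
    calc lam / (2 * Real.pi) * |lagF k (lam / 2 * ‖p - w‖ ^ 2)| ≤ _ :=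
          mul_le_mul_of_nonneg_left h (by positivity)
      _ = _ := by
          rw [show -(lam / 2 * ‖p - w‖ ^ 2 / 2) * ((1 - ρ) / (1 + ρ))
            = -(lam / 4 * ((1 - ρ) / (1 + ρ))) * ‖p - w‖ ^ 2 by ring]
          ring

/-- The Mehler kernel `∑ r ^ k pker k`. -/
def mehler (lam r : ℝ) (p w : Plane) : ℂ :=
  ((lam / (2 * Real.pi) : ℝ) : ℂ) * (Complex.exp (Complex.I * ((lam / 2 * twist p w : ℝ) : ℂ))
    * (((1 - r)⁻¹ * Real.exp (-(lam / 4 * ((1 + r) / (1 - r))) * ‖p - w‖ ^ 2) : ℝ) : ℂ))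

lemma gaussKernel_mehler {lam r : ℝ} (hlam : 0 < lam) (hr : 0 < r) (hr1 : r < 1) :
    GaussKernel (mehler lam r) (lam / (2 * Real.pi) * (1 - r)⁻¹)
      (lam / 4 * ((1 + r) / (1 - r))) where
  continuous := by
    unfold mehler twist Function.uncurry
    fun_prop
  pos := by
    have : 0 < 1 - r := by linarith
    positivity
  bound p w := by
    have : 0 < 1 - r := by linarith
    have hpi := Real.pi_pos
    rw [mehler, norm_mul, norm_mul, mul_comm Complex.I, Complex.norm_exp_ofReal_mul_I,
      Complex.norm_real, Complex.norm_real, one_mul, Real.norm_of_nonneg (by positivity),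
      Real.norm_of_nonneg (by positivity), mul_assoc]

lemma hasSum_pker {lam r : ℝ} (hr : 0 < r) (hr1 : r < 1) (p w : Plane) :
    HasSum (fun k : ℕ => (r : ℂ) ^ k * pker k lam p w) (mehler lam r p w) := by
  have hz : ‖(r : ℂ)‖ < 1 := by simpa [abs_of_pos hr] using hr1
  have h := (hasSum_lagF (lam / 2 * ‖p - w‖ ^ 2) hz).mul_left
    (((lam / (2 * Real.pi) : ℝ) : ℂ) * Complex.exp (Complex.I * ((lam / 2 * twist p w : ℝ) : ℂ)))
  convert! h using 1
  · funext k
    simp only [pker]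
    ring
  · simp only [mehler]
    push_cast
    rw [mul_assoc]
    congr 4
    ring

end FreeTwoStep
end

noncomputable section
namespace FreeTwoStep
open scoped LineDeriv ContDiff
open Filter Topology

/-! ### Abel summation and the spectral projections of the twisted Laplacian -/

/-- The Abel parameter `r = (1 - R²) / (1 + R²)`. -/
def abelParam (R : ℝ) : ℝ := (1 - R ^ 2) / (1 + R ^ 2)

lemma abelParam_pos {R : ℝ} (hR : 0 < R) (hR1 : R < 1) : 0 < abelParam R := by
  have : R ^ 2 < 1 := by nlinarith
  exact div_pos (by linarith) (by positivity)

lemma abelParam_lt_one {R : ℝ} (hR : 0 < R) : abelParam R < 1 := by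
  rw [abelParam, div_lt_one (by positivity)]
  nlinarith

lemma one_sub_abelParam_inv {R : ℝ} (hR : 0 < R) :
    (1 - abelParam R)⁻¹ = (1 + R ^ 2) / (2 * R ^ 2) := by
  rw [abelParam]
  field_simp
  ring_nf

/-- The reason for this parametrization: the Gaussian of the Mehler kernel becomes
`exp(-λ|p-w|²/(4R²))`, a dilation by `R`. -/
lemma abelParam_div {R : ℝ} (hR : 0 < R) :
    (1 + abelParam R) / (1 - abelParam R) = (R ^ 2)⁻¹ := by
  rw [div_eq_mul_inv, one_sub_abelParam_inv hR, abelParam]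
  field_simp
  ring

lemma integral_comp_smul_plane {F : Type*} [NormedAddCommGroup F] [NormedSpace ℝ F]
    (f : Plane → F) {R : ℝ} (hR : 0 < R) : ∫ y, f y = R ^ 2 • ∫ y, f (R • y) := by
  rw [Measure.integral_comp_smul, finrank_plane, smul_smul, abs_of_pos (by positivity),
    mul_inv_cancel₀ (by positivity), one_smul]

/-- The substitution `w = p - R y` fixes the Gaussian and puts all dependence on `R` into the phase,
the argument of `g` and a bounded factor. The limit `R → 0` is then a matter of dominated
convergence. -/
lemma intOp_mehler_eq (lam : ℝ) {R : ℝ} (hR : 0 < R) (g : Plane → ℂ) (p : Plane) :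
    intOp (mehler lam (abelParam R)) g p = ((lam / (2 * Real.pi) * ((1 + R ^ 2) / 2) : ℝ) : ℂ) *
      ∫ y : Plane, Complex.exp (Complex.I * ((lam / 2 * (-R * twist p y) : ℝ) : ℂ))
        * ((Real.exp (-(lam / 4) * ‖y‖ ^ 2) : ℝ) : ℂ) * g (p - R • y) := by
  rw [intOp, ← integral_sub_left_eq_self _ volume p, integral_comp_smul_plane _ hR,
    ← integral_const_mul, ← integral_smul]
  congr 1
  funext y
  simp only [mehler]
  have e1 : twist p (p - R • y) = -R * twist p y := by simp [twist]; ring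
  have e2 : -(lam / 4 * ((1 + abelParam R) / (1 - abelParam R))) * ‖p - (p - R • y)‖ ^ 2
      = -(lam / 4) * ‖y‖ ^ 2 := by
    rw [abelParam_div hR, sub_sub_cancel, norm_smul, Real.norm_of_nonneg hR.le]
    field_simp
  rw [e1, e2, one_sub_abelParam_inv hR, Complex.real_smul]
  push_cast
  have : (R : ℂ) ≠ 0 := by exact_mod_cast hR.ne'
  have hpi : (Real.pi : ℂ) ≠ 0 := by exact_mod_cast Real.pi_ne_zero
  field_simp

lemma integral_exp_neg_plane {c : ℝ} (hc : 0 < c) :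
    ∫ y : Plane, Real.exp (-c * ‖y‖ ^ 2) = Real.pi / c := by
  rw [GaussianFourier.integral_rexp_neg_mul_sq_norm hc, finrank_plane]
  norm_num

lemma tendsto_intOp_mehler {lam : ℝ} (hlam : 0 < lam) {g : Plane → ℂ} {Cg : ℝ}
    (hg : PlaneDecay g Cg) (p : Plane) :
    Tendsto (fun R : ℝ => intOp (mehler lam (abelParam R)) g p) (𝓝[>] 0) (𝓝 (g p)) := by
  have h4 : 0 < lam / 4 := by positivity
  have h1 : Tendsto (fun R : ℝ => ((lam / (2 * Real.pi) * ((1 + R ^ 2) / 2) : ℝ) : ℂ) *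
      ∫ y : Plane, Complex.exp (Complex.I * ((lam / 2 * (-R * twist p y) : ℝ) : ℂ))
        * ((Real.exp (-(lam / 4) * ‖y‖ ^ 2) : ℝ) : ℂ) * g (p - R • y)) (𝓝[>] 0)
      (𝓝 (((lam / (2 * Real.pi) * ((1 + 0 ^ 2) / 2) : ℝ) : ℂ) *
        ∫ y : Plane, ((Real.exp (-(lam / 4) * ‖y‖ ^ 2) : ℝ) : ℂ) * g p)) := by
    refine Tendsto.mul ?_ ?_
    · refine Tendsto.mono_left ?_ nhdsWithin_le_nhds
      exact Continuous.tendsto (by fun_prop) 0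
    · refine tendsto_integral_filter_of_dominated_convergence
        (fun y => Real.exp (-(lam / 4) * ‖y‖ ^ 2) * Cg) (Eventually.of_forall fun R => ?_)
        (Eventually.of_forall fun R => Eventually.of_forall fun y => ?_)
        ((integrable_exp_neg h4).mul_const _) (Eventually.of_forall fun y => ?_)
      · have := hg.continuous
        unfold twist
        exact Continuous.aestronglyMeasurable (by fun_prop)
      · rw [norm_mul, norm_mul, mul_comm Complex.I, Complex.norm_exp_ofReal_mul_I,
          Complex.norm_real, one_mul, Real.norm_of_nonneg (Real.exp_pos _).le]
        gcongr
        exact hg.norm_le_const _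
      · refine Tendsto.mono_left ?_ nhdsWithin_le_nhds
        have hc : Continuous fun R : ℝ =>
            Complex.exp (Complex.I * ((lam / 2 * (-R * twist p y) : ℝ) : ℂ))
            * ((Real.exp (-(lam / 4) * ‖y‖ ^ 2) : ℝ) : ℂ) * g (p - R • y) := by
          have := hg.continuous
          fun_prop
        simpa using hc.tendsto 0
  -- Normalization of the approximate identity: `λ/(2π) · 1/2 · π/(λ/4) = 1`.
  have h2 : ((lam / (2 * Real.pi) * ((1 + 0 ^ 2) / 2) : ℝ) : ℂ) *
        ∫ y : Plane, ((Real.exp (-(lam / 4) * ‖y‖ ^ 2) : ℝ) : ℂ) * g p = g p := by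
    rw [integral_mul_const, integral_complex_ofReal, integral_exp_neg_plane h4]
    have : (lam : ℂ) ≠ 0 := by exact_mod_cast hlam.ne'
    have hpi : (Real.pi : ℂ) ≠ 0 := by exact_mod_cast Real.pi_ne_zero
    push_cast
    field_simp
    norm_num
  rw [h2] at h1
  refine h1.congr' ?_
  filter_upwards [self_mem_nhdsWithin] with R hR
  rw [intOp_mehler_eq lam hR]

/-- The constant is independent of `R`: this is the majorant for the limit `R → 0` under an integral
over the plane. -/
lemma planeDecay_intOp_mehler {lam R : ℝ} (hlam : 0 < lam) (hR : 0 < R) (hR1 : R < 1)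
    {g : Plane → ℂ} {Cg : ℝ} (hg : PlaneDecay g Cg) :
    PlaneDecay (intOp (mehler lam (abelParam R)) g) (lam / (2 * Real.pi) * Cg *
      ∫ z : Plane, Real.exp (-(lam / 4) * ‖z‖ ^ 2) * (1 + ‖z‖) ^ 3) := by
  have h := (gaussKernel_mehler hlam (abelParam_pos hR hR1)
    (abelParam_lt_one hR)).planeDecay_intOp hg
  refine ⟨h.continuous, fun p => (h.bound p).trans ?_⟩
  have hpi := Real.pi_pos
  have hCg := hg.nonneg
  have h4 : 0 < lam / 4 := by positivity
  rw [integral_comp_smul_plane _ hR, one_sub_abelParam_inv hR, abelParam_div hR, smul_eq_mul]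
  have h1 : ∫ y : Plane, Real.exp (-(lam / 4 * (R ^ 2)⁻¹) * ‖R • y‖ ^ 2) * (1 + ‖R • y‖) ^ 3
      ≤ ∫ z : Plane, Real.exp (-(lam / 4) * ‖z‖ ^ 2) * (1 + ‖z‖) ^ 3 := by
    refine integral_mono_of_nonneg (Eventually.of_forall fun y => by positivity)
      (integrable_exp_neg_mul_weight h4 3) (Eventually.of_forall fun y => ?_)
    simp only
    rw [norm_smul, Real.norm_of_nonneg hR.le,
      show -(lam / 4 * (R ^ 2)⁻¹) * (R * ‖y‖) ^ 2 = -(lam / 4) * ‖y‖ ^ 2 by field_simp]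
    gcongr
    exact mul_le_of_le_one_left (norm_nonneg y) hR1.le
  have h2 : 0 ≤ ∫ z : Plane, Real.exp (-(lam / 4) * ‖z‖ ^ 2) * (1 + ‖z‖) ^ 3 :=
    integral_nonneg fun z => by positivity
  calc _ ≤ lam / (2 * Real.pi) * ((1 + R ^ 2) / (2 * R ^ 2)) * Cg * (R ^ 2 *
        ∫ z : Plane, Real.exp (-(lam / 4) * ‖z‖ ^ 2) * (1 + ‖z‖) ^ 3) := by gcongr
    _ = ((1 + R ^ 2) / 2) * (lam / (2 * Real.pi) * Cg *
        ∫ z : Plane, Real.exp (-(lam / 4) * ‖z‖ ^ 2) * (1 + ‖z‖) ^ 3) := by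
        field_simp
    _ ≤ 1 * _ := by
        gcongr
        rw [div_le_one (by norm_num)]
        nlinarith
    _ = _ := one_mul _

/-- Termwise integration of `∑ r^j pker j`: orthogonality to the `k`-th eigenspace leaves only the
term `j = k`. -/
lemma integral_conj_mehler_mul {k : ℕ} {lam r : ℝ} (hlam : 0 < lam) (hr : 0 < r) (hr1 : r < 1)
    (w : Plane) {u : Lp ℂ 2 (volume : Measure Plane)} (hu : u ∈ eigenspace k lam) :
    ∫ p, starRingEnd ℂ (mehler lam r p w) * u p
      = (r : ℂ) ^ k * ∫ p, starRingEnd ℂ (pker k lam p w) * u p := by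
  have hmu : MemLp u 2 volume := Lp.memLp u
  -- The bounds for `pker j` grow like `ρ^{-j}`, so any `ρ` strictly between `r` and `1` gives a
  -- geometric majorant of ratio `r/ρ`.
  set ρ := (1 + r) / 2 with hρ
  have hρ0 : 0 < ρ := by positivity
  have hρ1 : ρ < 1 := by rw [hρ]; linarith
  have hrρ : r < ρ := by rw [hρ]; linarith
  have hK := fun j => gaussKernel_pker j hlam hρ0 hρ1
  have h := hasSum_integral_of_summable_integral_norm (μ := (volume : Measure Plane))
    (F := fun j p => (r : ℂ) ^ j * (starRingEnd ℂ (pker j lam p w) * u p))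
    (fun j => ((hK j).integrable_conj_mul_left hmu w).const_mul _) ?_
  · have h1 : ∀ p, ∑' j : ℕ, (r : ℂ) ^ j * (starRingEnd ℂ (pker j lam p w) * u p)
        = starRingEnd ℂ (mehler lam r p w) * u p := by
      intro p
      have h2 := ((hasSum_pker (lam := lam) hr hr1 p w).star).mul_right (u p)
      rw [← starRingEnd_apply] at h2
      rw [← h2.tsum_eq]
      congr 1
      funext j
      simp [mul_assoc]
    simp_rw [h1] at h
    rw [← h.tsum_eq, tsum_eq_single k, integral_const_mul]
    intro j hj
    rw [integral_const_mul, integral_conj_pker_mul_eq_zero hj lam hlam w hu, mul_zero]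
  · set B := (∫ z : Plane, Real.exp (-(2 * (lam / 4 * ((1 - ρ) / (1 + ρ)))) * ‖z‖ ^ 2))
      + ∫ p, ‖u p‖ ^ 2
    refine Summable.of_nonneg_of_le (fun j => integral_nonneg fun p => norm_nonneg _) (fun j => ?_)
      ((summable_geometric_of_lt_one (r := r / ρ) (by positivity)
        (by rw [div_lt_one hρ0]; exact hrρ)).mul_left (lam / (2 * Real.pi) * (1 - ρ)⁻¹ * B))
    simp_rw [norm_mul ((r : ℂ) ^ j)]
    rw [integral_const_mul, norm_pow, Complex.norm_real, Real.norm_of_nonneg hr.le]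
    calc _ ≤ r ^ j * (lam / (2 * Real.pi) * (1 - ρ)⁻¹ / ρ ^ j * B) := by
          gcongr
          exact (hK j).integral_norm_conj_mul_le hmu w
      _ = _ := by
          clear_value ρ
          rw [div_pow]; ring

/-- The integral operator onto the `k`-th eigenspace. -/
def proj (k : ℕ) (lam : ℝ) (g : Plane → ℂ) : Plane → ℂ := intOp (pker k lam) g

lemma exists_planeDecay_proj (k : ℕ) {lam : ℝ} (hlam : 0 < lam) {g : Plane → ℂ} {Cg : ℝ}
    (hg : PlaneDecay g Cg) : ∃ C, PlaneDecay (proj k lam g) C :=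
  ⟨_, (gaussKernel_pker k hlam (ρ := 1 / 2) (by norm_num) (by norm_num)).planeDecay_intOp hg⟩

/-- Pairing `u` with the Mehler operator applied to `g` gives `r^k ⟨proj k g, u⟩`. As `r → 1` the
left side tends to `⟨g, u⟩` and the factor `r^k` to `1`. No basis of the eigenspace is needed. -/
lemma integral_conj_mul_eq_of_mem_eigenspace {k : ℕ} {lam : ℝ} (hlam : 0 < lam) {g : Plane → ℂ}
    {Cg : ℝ} (hg : PlaneDecay g Cg) {u : Lp ℂ 2 (volume : Measure Plane)}
    (hu : u ∈ eigenspace k lam) :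
    ∫ p, starRingEnd ℂ (g p) * u p = ∫ p, starRingEnd ℂ (proj k lam g p) * u p := by
  have hmu : MemLp u 2 volume := Lp.memLp u
  have hK := gaussKernel_pker k hlam (ρ := 1 / 2) (by norm_num) (by norm_num)
  have hIoo : Ioo (0 : ℝ) 1 ∈ 𝓝[>] (0 : ℝ) := Ioo_mem_nhdsGT one_pos
  have h1 : ∀ R ∈ Ioo (0 : ℝ) 1,
      ∫ p, starRingEnd ℂ (intOp (mehler lam (abelParam R)) g p) * u p
        = (abelParam R : ℂ) ^ k * ∫ p, starRingEnd ℂ (proj k lam g p) * u p := by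
    intro R hR
    rw [(gaussKernel_mehler hlam (abelParam_pos hR.1 hR.2)
      (abelParam_lt_one hR.1)).integral_conj_intOp_mul hg hmu, proj,
      hK.integral_conj_intOp_mul hg hmu, ← integral_const_mul]
    congr 1
    funext w
    rw [integral_conj_mehler_mul hlam (abelParam_pos hR.1 hR.2) (abelParam_lt_one hR.1) w hu]
    ring
  have h2 : Tendsto (fun R : ℝ => ∫ p, starRingEnd ℂ (intOp (mehler lam (abelParam R)) g p) * u p)
      (𝓝[>] 0) (𝓝 (∫ p, starRingEnd ℂ (g p) * u p)) := by
    set C := lam / (2 * Real.pi) * Cg *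
      ∫ z : Plane, Real.exp (-(lam / 4) * ‖z‖ ^ 2) * (1 + ‖z‖) ^ 3
    have hint : Integrable (fun p : Plane => (C * ((1 + ‖p‖) ^ 3)⁻¹) * ‖u p‖) := by
      have hw : MemLp (fun p : Plane => C * ((1 + ‖p‖) ^ 3)⁻¹) 2 volume := by
        have h0 : PlaneDecay (fun p : Plane => ((((1 + ‖p‖) ^ 3)⁻¹ : ℝ) : ℂ)) 1 := by
          refine ⟨Complex.continuous_ofReal.comp
            (Continuous.inv₀ (by fun_prop) fun p => by positivity), fun p => ?_⟩
          rw [Complex.norm_real, Real.norm_of_nonneg (by positivity),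
            inv_mul_cancel₀ (by positivity)]
        have h3 := h0.memLp.norm.const_mul C
        refine h3.congr_norm h3.aestronglyMeasurable ?_ |>.ae_eq ?_
        · exact Eventually.of_forall fun p => rfl
        · refine Eventually.of_forall fun p => ?_
          simp only
          rw [Complex.norm_real, Real.norm_of_nonneg (by positivity)]
      exact hw.integrable_mul hmu.norm
    refine tendsto_integral_filter_of_dominated_convergence _ ?_ ?_ hint ?_
    · filter_upwards [hIoo] with R hR
      exact (Complex.continuous_conj.comp (planeDecay_intOp_mehler hlam hR.1 hR.2
        hg).continuous).aestronglyMeasurable.mul hmu.aestronglyMeasurable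
    · filter_upwards [hIoo] with R hR
      refine Eventually.of_forall fun p => ?_
      rw [norm_mul, RCLike.norm_conj]
      gcongr
      exact (planeDecay_intOp_mehler hlam hR.1 hR.2 hg).norm_le p
    · refine Eventually.of_forall fun p => ?_
      exact ((Complex.continuous_conj.tendsto _).comp (tendsto_intOp_mehler hlam hg p)).mul_const _
  have h3 : Tendsto (fun R : ℝ => (abelParam R : ℂ) ^ k
      * ∫ p, starRingEnd ℂ (proj k lam g p) * u p) (𝓝[>] 0)
      (𝓝 (∫ p, starRingEnd ℂ (proj k lam g p) * u p)) := by
    refine Tendsto.mono_left ?_ nhdsWithin_le_nhds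
    have hc : ContinuousAt (fun R : ℝ => (abelParam R : ℂ) ^ k
      * ∫ p, starRingEnd ℂ (proj k lam g p) * u p) 0 := by
      have : ContinuousAt abelParam 0 := by
        unfold abelParam
        exact ContinuousAt.div (by fun_prop) (by fun_prop) (by norm_num)
      fun_prop
    have h4 := hc.tendsto
    simpa [abelParam] using h4
  refine tendsto_nhds_unique h2 (h3.congr' ?_)
  filter_upwards [hIoo] with R hR
  rw [h1 R hR]

/-- By Fubini, a superposition of the columns of the kernel inherits their weak eigenvalue equation.
-/
lemma proj_mem_eigenspace {k : ℕ} {lam : ℝ} (hlam : 0 < lam) {g : Plane → ℂ} {Cg C : ℝ}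
    (hg : PlaneDecay g Cg) (hC : PlaneDecay (proj k lam g) C) :
    hC.memLp.toLp _ ∈ eigenspace k lam := by
  have hK := gaussKernel_pker k hlam (ρ := 1 / 2) (by norm_num) (by norm_num)
  rw [mem_eigenspace_iff]
  intro φ
  have h1 : ∫ p, starRingEnd ℂ (eigenDefect k lam φ p) * hC.memLp.toLp _ p
      = starRingEnd ℂ (∫ p, starRingEnd ℂ (proj k lam g p) * eigenDefect k lam φ p) := by
    rw [← integral_conj]
    refine integral_congr_ae ?_
    filter_upwards [hC.memLp.coeFn_toLp] with p hp
    rw [hp, map_mul, Complex.conj_conj, mul_comm]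
  rw [h1, proj, hK.integral_conj_intOp_mul hg ((eigenDefect k lam φ).memLp 2)]
  have h2 : ∀ w, ∫ p, starRingEnd ℂ (pker k lam p w) * eigenDefect k lam φ p = 0 := by
    intro w
    rw [← map_eq_zero (starRingEnd ℂ), ← integral_conj, ← integral_conj_eigenDefect_mul_pker k lam hlam w φ]
    congr 1
    funext p
    rw [map_mul, Complex.conj_conj, mul_comm]
  simp [h2]

lemma starProjection_eq_proj {k : ℕ} {lam : ℝ} (hlam : 0 < lam) {g : Plane → ℂ} {Cg C : ℝ}
    (hg : PlaneDecay g Cg) (hC : PlaneDecay (proj k lam g) C) :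
    (eigenspace k lam).starProjection (hg.memLp.toLp g) = hC.memLp.toLp _ := by
  refine Submodule.eq_starProjection_of_mem_of_inner_eq_zero (proj_mem_eigenspace hlam hg hC)
    fun u hu => ?_
  rw [inner_sub_left, sub_eq_zero, L2_inner_eq, L2_inner_eq]
  have h := integral_conj_mul_eq_of_mem_eigenspace hlam hg hu
  refine (integral_congr_ae ?_).trans (h.trans (integral_congr_ae ?_))
  · filter_upwards [hg.memLp.coeFn_toLp] with p hp
    rw [hp]
  · filter_upwards [hC.memLp.coeFn_toLp] with p hp
    rw [hp]

lemma continuousRep_eq {u : Lp ℂ 2 (volume : Measure Plane)} {g : Plane → ℂ} (hg : Continuous g)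
    (h : u =ᵐ[volume] g) : continuousRep u = g := by
  have hex : ∃ g : Plane → ℂ, Continuous g ∧ u =ᵐ[volume] g := ⟨g, hg, h⟩
  rw [continuousRep, dif_pos hex]
  exact (hex.choose_spec.1.ae_eq_iff_eq volume hg).1 (hex.choose_spec.2.symm.trans h)

lemma Lam_eq_proj (k : ℕ) {lam : ℝ} (hlam : 0 < lam) {g : Plane → ℂ} {Cg : ℝ}
    (hg : PlaneDecay g Cg) : Lam k lam g = proj k lam g := by
  obtain ⟨C, hC⟩ := exists_planeDecay_proj k hlam hg
  rw [Lam, dif_pos hg.memLp, starProjection_eq_proj hlam hg hC]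
  exact continuousRep_eq hC.continuous hC.memLp.coeFn_toLp

end FreeTwoStep
end

noncomputable section
namespace FreeTwoStep
open scoped LineDeriv ContDiff
open Filter Topology

/-! ### Consequences: bounds, completeness, unimodular multipliers -/

lemma exists_planeDecay_schwartz (φ : 𝓢(Plane, ℂ)) : ∃ C, PlaneDecay φ C := by
  refine ⟨2 ^ 3 * ((Finset.Iic (3, 0)).sup fun m => SchwartzMap.seminorm ℝ m.1 m.2) φ,
    φ.continuous, fun p => ?_⟩
  have := SchwartzMap.one_add_le_sup_seminorm_apply (𝕜 := ℝ) (m := (3, 0)) (k := 3) (n := 0)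
    le_rfl le_rfl φ p
  rw [norm_iteratedFDeriv_zero] at this
  rw [mul_comm]
  exact this

/-- The column `pker k lam · w` lies in the eigenspace, so the projection fixes it; continuity
upgrades equality almost everywhere to equality. -/
lemma pker_reproducing (k : ℕ) {lam : ℝ} (hlam : 0 < lam) (z w : Plane) :
    ∫ y, pker k lam z y * pker k lam y w = pker k lam z w := by
  obtain ⟨C, hC⟩ := exists_planeDecay_schwartz (pkerS k lam hlam w)
  obtain ⟨C', hC'⟩ := exists_planeDecay_proj k hlam hC
  have hmem : hC.memLp.toLp _ ∈ eigenspace k lam := by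
    rw [mem_eigenspace_iff]
    intro φ
    rw [← integral_conj_eigenDefect_mul_pker k lam hlam w φ]
    refine integral_congr_ae ?_
    filter_upwards [hC.memLp.coeFn_toLp] with p hp
    rw [hp, pkerS_apply]
  have h1 := starProjection_eq_proj hlam hC hC'
  rw [Submodule.starProjection_eq_self_iff.2 hmem] at h1
  have h2 : ⇑(pkerS k lam hlam w) =ᵐ[volume] proj k lam (pkerS k lam hlam w) := by
    rw [← MemLp.toLp_eq_toLp_iff hC.memLp hC'.memLp]
    exact h1
  have h3 := congrFun ((hC.continuous.ae_eq_iff_eq volume hC'.continuous).1 h2) z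
  rw [pkerS_apply] at h3
  rw [h3, proj, intOp]
  simp_rw [pkerS_apply]

lemma pker_self (k : ℕ) (lam : ℝ) (w : Plane) :
    pker k lam w w = ((lam / (2 * Real.pi) : ℝ) : ℂ) := by
  simp only [pker, sub_self, norm_zero, twist]
  rw [show lam / 2 * (0 : ℝ) ^ 2 = 0 by ring, lagF_zero,
    show lam / 2 * (w 0 * w 1 - w 1 * w 0) = 0 by ring]
  simp

lemma norm_pker_comm (k : ℕ) (lam : ℝ) (p w : Plane) : ‖pker k lam p w‖ = ‖pker k lam w p‖ := by
  rw [← pker_conj, RCLike.norm_conj]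

lemma integral_norm_pker_sq (k : ℕ) {lam : ℝ} (hlam : 0 < lam) (w : Plane) :
    ∫ y, ‖pker k lam y w‖ ^ 2 = lam / (2 * Real.pi) := by
  have h := pker_reproducing k hlam w w
  rw [pker_self] at h
  have h1 : ∀ y, pker k lam w y * pker k lam y w = ((‖pker k lam y w‖ ^ 2 : ℝ) : ℂ) := by
    intro y
    rw [← pker_conj k lam y w, mul_comm, Complex.mul_conj, Complex.normSq_eq_norm_sq]
  simp_rw [h1] at h
  rw [integral_complex_ofReal] at h
  exact_mod_cast h

/-- Insert the reproducing formula and use `ab ≤ (a² + b²)/2`: each column has squared norm equal to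
the diagonal value `λ/(2π)`. In contrast to the Cauchy bound this is uniform in `k`. -/
lemma norm_pker_le (k : ℕ) {lam : ℝ} (hlam : 0 < lam) (z w : Plane) :
    ‖pker k lam z w‖ ≤ lam / (2 * Real.pi) := by
  have hi : ∀ w, Integrable fun y => ‖pker k lam y w‖ ^ 2 := by
    intro w
    have := (pkerS k lam hlam w).memLp 2
    rw [pkerS_coe] at this
    exact integrable_norm_sq_of_memLp this
  have hi2 : Integrable fun y => (‖pker k lam y z‖ ^ 2 + ‖pker k lam y w‖ ^ 2) / 2 :=
    ((hi z).add (hi w)).div_const 2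
  rw [← pker_reproducing k hlam z w]
  calc _ ≤ ∫ y, ‖pker k lam z y * pker k lam y w‖ := norm_integral_le_integral_norm _
    _ ≤ ∫ y, (‖pker k lam y z‖ ^ 2 + ‖pker k lam y w‖ ^ 2) / 2 := by
        refine integral_mono_of_nonneg (Eventually.of_forall fun y => norm_nonneg _) hi2
          (Eventually.of_forall fun y => ?_)
        simp only
        rw [norm_mul, norm_pker_comm k lam z y]
        nlinarith [sq_nonneg (‖pker k lam y z‖ - ‖pker k lam y w‖)]
    _ = _ := by
        rw [integral_div, integral_add (hi z) (hi w), integral_norm_pker_sq k hlam,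
          integral_norm_pker_sq k hlam]
        ring

/-- The Laguerre functions are bounded by `1` on the half line. -/
lemma abs_lagF_le_one (k : ℕ) {x : ℝ} (hx : 0 ≤ x) : |lagF k x| ≤ 1 := by
  -- With `λ = 2`, `w = 0` and `|p|² = x` the argument of the Laguerre function is `x`.
  have h := norm_pker_le k (lam := 2) two_pos (EuclideanSpace.single 0 √x) 0
  have hpi := Real.pi_pos
  rw [pker, norm_mul, norm_mul, mul_comm Complex.I, Complex.norm_exp_ofReal_mul_I,
    Complex.norm_real, Complex.norm_real, one_mul, Real.norm_of_nonneg (by positivity),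
    Real.norm_eq_abs, sub_zero] at h
  have h2 : ‖(EuclideanSpace.single 0 √x : Plane)‖ ^ 2 = x := by
    rw [norm_sq_plane]; simp [Real.sq_sqrt hx]
  rw [h2, div_self two_ne_zero, one_mul] at h
  exact le_of_mul_le_mul_left (by simpa using h) (by positivity : 0 < 2 / (2 * Real.pi))

lemma hasSum_proj_mehler {lam r : ℝ} (hlam : 0 < lam) (hr : 0 < r) (hr1 : r < 1) {g : Plane → ℂ}
    (hg : Integrable g) (p : Plane) :
    HasSum (fun k : ℕ => (r : ℂ) ^ k * proj k lam g p) (intOp (mehler lam r) g p) := by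
  have h := hasSum_integral_of_summable_integral_norm (μ := (volume : Measure Plane))
    (F := fun k w => (r : ℂ) ^ k * (pker k lam p w * g w))
    (fun k => ((gaussKernel_pker k hlam (ρ := 1 / 2) (by norm_num)
      (by norm_num)).integrable_mul hg p).const_mul _) ?_
  · simp_rw [integral_const_mul] at h
    convert! h using 1
    rw [intOp]
    congr 1
    funext w
    rw [← ((hasSum_pker hr hr1 p w).mul_right (g w)).tsum_eq]
    congr 1
    funext k
    ring
  · refine Summable.of_nonneg_of_le (fun j => integral_nonneg fun p => norm_nonneg _) (fun k => ?_)
      ((summable_geometric_of_lt_one hr.le hr1).mul_right (lam / (2 * Real.pi) * ∫ w, ‖g w‖))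
    rw [← integral_const_mul, ← integral_const_mul]
    refine integral_mono_of_nonneg (Eventually.of_forall fun y => norm_nonneg _)
      ((hg.norm.const_mul _).const_mul _) (Eventually.of_forall fun w => ?_)
    simp only
    rw [norm_mul, norm_mul, norm_pow, Complex.norm_real, Real.norm_of_nonneg hr.le]
    gcongr
    exact norm_pker_le k hlam p w

/-- Pointwise completeness of the eigenfunction expansion. -/
lemma tsum_proj {lam : ℝ} (hlam : 0 < lam) {g : Plane → ℂ} {Cg : ℝ} (hg : PlaneDecay g Cg)
    (p : Plane) (hs : Summable fun k => ‖proj k lam g p‖) : ∑' k, proj k lam g p = g p := by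
  have hIoo : Ioo (0 : ℝ) 1 ∈ 𝓝[>] (0 : ℝ) := Ioo_mem_nhdsGT one_pos
  refine tendsto_nhds_unique ?_ (tendsto_intOp_mehler hlam hg p)
  have h := tendsto_tsum_of_dominated_convergence (𝓕 := 𝓝[>] (0 : ℝ))
    (f := fun R k => (abelParam R : ℂ) ^ k * proj k lam g p) (g := fun k => proj k lam g p) hs
    (fun k => ?_) ?_
  · refine h.congr' ?_
    filter_upwards [hIoo] with R hR
    exact (hasSum_proj_mehler hlam (abelParam_pos hR.1 hR.2) (abelParam_lt_one hR.1)
      hg.integrable p).tsum_eq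
  · refine Tendsto.mono_left ?_ nhdsWithin_le_nhds
    have hc : ContinuousAt (fun R : ℝ => (abelParam R : ℂ) ^ k * proj k lam g p) 0 := by
      have : ContinuousAt abelParam 0 := by
        unfold abelParam
        exact ContinuousAt.div (by fun_prop) (by fun_prop) (by norm_num)
      fun_prop
    simpa [abelParam] using hc.tendsto
  · filter_upwards [hIoo] with R hR k
    rw [norm_mul, norm_pow, Complex.norm_real,
      Real.norm_of_nonneg (abelParam_pos hR.1 hR.2).le]
    exact mul_le_of_le_one_left (norm_nonneg _)
      (pow_le_one₀ (abelParam_pos hR.1 hR.2).le (abelParam_lt_one hR.1).le)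

lemma inner_eq_zero_of_mem_eigenspace {j k : ℕ} (hjk : j ≠ k) {lam : ℝ} (hlam : 0 < lam)
    {g : Plane → ℂ} {Cg C : ℝ} (hg : PlaneDecay g Cg) (hC : PlaneDecay (proj j lam g) C)
    {u : Lp ℂ 2 (volume : Measure Plane)} (hu : u ∈ eigenspace k lam) :
    inner ℂ (hC.memLp.toLp _) u = 0 := by
  have hK := gaussKernel_pker j hlam (ρ := 1 / 2) (by norm_num) (by norm_num)
  rw [L2_inner_eq]
  have h := hK.integral_conj_intOp_mul hg (Lp.memLp u)
  simp_rw [integral_conj_pker_mul_eq_zero hjk lam hlam _ hu, mul_zero, integral_zero] at h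
  rw [← h]
  refine integral_congr_ae ?_
  filter_upwards [hC.memLp.coeFn_toLp] with p hp
  rw [hp, proj]

/-! ### Orthogonal series with unimodular coefficients -/

lemma norm_sum_sq_of_orthogonal {H : Type*} [NormedAddCommGroup H] [InnerProductSpace ℂ H]
    {v : ℕ → H} (hv : ∀ j k, j ≠ k → inner ℂ (v j) (v k) = 0) (s : Finset ℕ) :
    ‖∑ k ∈ s, v k‖ ^ 2 = ∑ k ∈ s, ‖v k‖ ^ 2 := by
  classical
  induction s using Finset.induction_on with
  | empty => simp
  | insert a s ha ih =>
    rw [Finset.sum_insert ha, Finset.sum_insert ha, ← ih, @norm_add_sq ℂ, inner_sum,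
      Finset.sum_eq_zero fun i hi => hv a i fun h => ha (h ▸ hi)]
    simp

/-- For an orthogonal sequence of components of `G`, unimodular multipliers give convergent series
whose sums all have the same norm. -/
lemma exists_hasSum_of_orthogonal {H : Type*} [NormedAddCommGroup H] [InnerProductSpace ℂ H]
    [CompleteSpace H] {v : ℕ → H} (hv : ∀ j k, j ≠ k → inner ℂ (v j) (v k) = 0) {G : H}
    (hG : ∀ k, inner ℂ (v k) G = inner ℂ (v k) (v k)) :
    ∃ Q : ℝ, ∀ m : ℕ → ℂ, (∀ k, ‖m k‖ = 1) →
      ∃ V : H, HasSum (fun k => m k • v k) V ∧ ‖V‖ ^ 2 = Q := by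
  -- Bessel's inequality, from `0 ≤ ‖G - ∑ v k‖²`.
  have hbessel : ∀ s : Finset ℕ, ∑ k ∈ s, ‖v k‖ ^ 2 ≤ ‖G‖ ^ 2 := by
    intro s
    have h0 : RCLike.re (inner ℂ G (∑ k ∈ s, v k)) = ∑ k ∈ s, ‖v k‖ ^ 2 := by
      rw [← inner_conj_symm, RCLike.conj_re, sum_inner, map_sum]
      refine Finset.sum_congr rfl fun k _ => ?_
      rw [hG, inner_self_eq_norm_sq]
    have h1 := @norm_sub_sq ℂ _ _ _ _ G (∑ k ∈ s, v k)
    rw [h0, norm_sum_sq_of_orthogonal hv] at h1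
    nlinarith [sq_nonneg ‖G - ∑ k ∈ s, v k‖]
  have hsum : Summable fun k => ‖v k‖ ^ 2 :=
    summable_of_sum_le (fun k => by positivity) hbessel
  refine ⟨∑' k, ‖v k‖ ^ 2, fun m hm => ?_⟩
  have hmv : ∀ j k, j ≠ k → inner ℂ (m j • v j) (m k • v k) = 0 := by
    intro j k hjk
    rw [inner_smul_left, inner_smul_right, hv j k hjk, mul_zero, mul_zero]
  have hnorm : ∀ k, ‖m k • v k‖ ^ 2 = ‖v k‖ ^ 2 := by
    intro k
    rw [norm_smul, hm, one_mul]
  have hsumm : Summable fun k => m k • v k := by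
    rw [summable_iff_vanishing_norm]
    intro ε hε
    obtain ⟨s, hs⟩ := summable_iff_vanishing_norm.1 hsum (ε ^ 2) (by positivity)
    refine ⟨s, fun t ht => ?_⟩
    have h1 := hs t ht
    rw [Real.norm_of_nonneg (Finset.sum_nonneg fun i _ => by positivity)] at h1
    have h2 := norm_sum_sq_of_orthogonal hmv t
    simp_rw [hnorm] at h2
    rw [← h2] at h1
    exact lt_of_pow_lt_pow_left₀ 2 hε.le h1
  refine ⟨_, hsumm.hasSum, ?_⟩
  refine tendsto_nhds_unique ((hsumm.hasSum.norm).pow 2) ?_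
  refine hsum.hasSum.congr fun s => ?_
  rw [norm_sum_sq_of_orthogonal hmv]
  exact (Finset.sum_congr rfl fun k _ => hnorm k).symm

lemma lintegral_enorm_sq_eq {α : Type*} [MeasurableSpace α] {μ : Measure α} (V : Lp ℂ 2 μ) :
    ∫⁻ x, ‖V x‖ₑ ^ 2 ∂μ = ENNReal.ofReal (‖V‖ ^ 2) := by
  have h1 : ‖V‖ₑ = eLpNorm V 2 μ := by
    rw [Lp.enorm_def]
  rw [← ofReal_norm, eLpNorm_eq_lintegral_rpow_enorm_toReal two_ne_zero ENNReal.ofNat_ne_top] at h1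
  rw [ENNReal.ofReal_pow (norm_nonneg _), h1, ← ENNReal.rpow_natCast, ← ENNReal.rpow_mul]
  simp

/-- Unimodular multipliers of the eigenfunction expansion are isometric. -/
lemma lintegral_tsum_mul_proj {lam : ℝ} (hlam : 0 < lam) {g : Plane → ℂ} {Cg : ℝ}
    (hg : PlaneDecay g Cg) (hs : ∀ p, Summable fun k => ‖proj k lam g p‖) {m : ℕ → ℂ}
    (hm : ∀ k, ‖m k‖ = 1) :
    ∫⁻ p, ‖∑' k, m k * proj k lam g p‖ₑ ^ 2 = ∫⁻ p, ‖g p‖ₑ ^ 2 := by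
  choose C hC using fun k => exists_planeDecay_proj k hlam hg
  set v : ℕ → Lp ℂ 2 (volume : Measure Plane) := fun k => (hC k).memLp.toLp _ with hvdef
  have hvmem : ∀ k, v k ∈ eigenspace k lam := fun k => proj_mem_eigenspace hlam hg (hC k)
  -- `Q` is the same for all unimodular `m`; comparison with `m = 1`, where completeness returns
  -- `g`, evaluates it.
  obtain ⟨Q, hQ⟩ := exists_hasSum_of_orthogonal (v := v) (G := hg.memLp.toLp _)
    (fun j k hjk => inner_eq_zero_of_mem_eigenspace hjk hlam hg (hC j) (hvmem k)) fun k => by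
      rw [hvdef]
      simp only
      rw [← starProjection_eq_proj hlam hg (hC k), Submodule.inner_starProjection_left_eq_right,
        Submodule.inner_starProjection_left_eq_right,
        Submodule.starProjection_eq_self_iff.2
          (Submodule.starProjection_apply_mem (eigenspace k lam) _)]
  have key : ∀ m : ℕ → ℂ, (∀ k, ‖m k‖ = 1) →
      ∫⁻ p, ‖∑' k, m k * proj k lam g p‖ₑ ^ 2 = ENNReal.ofReal Q := by
    intro m hm
    obtain ⟨V, hV, hVQ⟩ := hQ m hm
    rw [← hVQ, ← lintegral_enorm_sq_eq]
    refine lintegral_congr_ae ?_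
    -- Convergence in `L²` gives pointwise convergence only along a subsequence, which is enough
    -- because the pointwise series is already known to converge.
    obtain ⟨ns, hns, hae⟩ :=
      (tendstoInMeasure_of_tendsto_Lp hV.tendsto_sum_nat).exists_seq_tendsto_ae
    have hcoe : ∀ᵐ p : Plane, ∀ n : ℕ, (∑ k ∈ Finset.range n, m k • v k : Lp ℂ 2 _) p
        = ∑ k ∈ Finset.range n, m k * proj k lam g p := by
      rw [ae_all_iff]
      intro n
      have h1 : ∀ᵐ p : Plane, ∀ k, (m k • v k : Lp ℂ 2 _) p = m k * proj k lam g p := by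
        rw [ae_all_iff]
        intro k
        filter_upwards [Lp.coeFn_smul (m k) (v k), (hC k).memLp.coeFn_toLp] with p h1 h2
        rw [h1, Pi.smul_apply, h2, smul_eq_mul]
      filter_upwards [Lp.coeFn_finsetSum (Finset.range n) (fun k => m k • v k), h1] with p h2 h3
      rw [h2, Finset.sum_apply]
      exact Finset.sum_congr rfl fun k _ => h3 k
    filter_upwards [hae, hcoe] with p hp hcp
    simp_rw [hcp] at hp
    have hsp : Summable fun k => m k * proj k lam g p := by
      refine Summable.of_norm ((hs p).congr fun k => ?_)
      rw [norm_mul, hm, one_mul]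
    rw [tendsto_nhds_unique hp (hsp.hasSum.tendsto_sum_nat.comp hns.tendsto_atTop)]
  rw [key m hm, ← key (fun _ => 1) (fun _ => by simp)]
  refine lintegral_congr fun p => ?_
  simp_rw [one_mul]
  rw [tsum_proj hlam hg p (hs p)]

end FreeTwoStep
end

noncomputable section
namespace FreeTwoStep
open scoped LineDeriv ContDiff
open Filter Topology

/-! ### The group: translations and left invariant vector fields -/

lemma inner_V (x y : V) : ⟪x, y⟫ = x 0 * y 0 + x 1 * y 1 + x 2 * y 2 := by
  simp only [PiLp.inner_apply, Fin.sum_univ_three, RCLike.inner_apply, conj_trivial]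
  ring

lemma norm_sq_V (x : V) : ‖x‖ ^ 2 = x 0 ^ 2 + x 1 ^ 2 + x 2 ^ 2 := by
  simp [EuclideanSpace.norm_sq_eq, Fin.sum_univ_three]

lemma bracket_zero (X Y : V) : bracket X Y 0 = X 1 * Y 2 - X 2 * Y 1 := rfl
lemma bracket_one (X Y : V) : bracket X Y 1 = X 2 * Y 0 - X 0 * Y 2 := rfl
lemma bracket_two (X Y : V) : bracket X Y 2 = X 0 * Y 1 - X 1 * Y 0 := rfl

lemma V_ext {x y : V} (h0 : x 0 = y 0) (h1 : x 1 = y 1) (h2 : x 2 = y 2) : x = y := by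
  ext i
  fin_cases i
  · exact h0
  · exact h1
  · exact h2

lemma bracket_add_left (X X' Y : V) : bracket (X + X') Y = bracket X Y + bracket X' Y := by
  apply V_ext <;> simp only [PiLp.add_apply, bracket_zero, bracket_one, bracket_two] <;> ring

lemma bracket_smul_left (c : ℝ) (X Y : V) : bracket (c • X) Y = c • bracket X Y := by
  apply V_ext <;> simp only [PiLp.smul_apply, smul_eq_mul, bracket_zero, bracket_one,
    bracket_two] <;> ring

lemma bracket_skew (X Y : V) : bracket X Y = -bracket Y X := by
  apply V_ext <;> simp only [PiLp.neg_apply, bracket_zero, bracket_one, bracket_two] <;> ring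

lemma bracket_self (X : V) : bracket X X = 0 := by
  apply V_ext <;> simp only [PiLp.zero_apply, bracket_zero, bracket_one, bracket_two] <;> ring

lemma bracket_add_right (X Y Y' : V) : bracket X (Y + Y') = bracket X Y + bracket X Y' := by
  rw [bracket_skew, bracket_add_left, bracket_skew Y, bracket_skew Y']; abel

lemma bracket_smul_right (c : ℝ) (X Y : V) : bracket X (c • Y) = c • bracket X Y := by
  rw [bracket_skew, bracket_smul_left, bracket_skew Y, smul_neg, neg_neg]

/-- The bracket as a continuous bilinear map. -/
def bracketL : V →L[ℝ] V →L[ℝ] V :=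
  LinearMap.toContinuousBilinearMap
    (LinearMap.mk₂ ℝ bracket bracket_add_left bracket_smul_left bracket_add_right
      bracket_smul_right)

lemma bracketL_apply (X Y : V) : bracketL X Y = bracket X Y := rfl

@[fun_prop]
lemma continuous_bracket {α : Type*} [TopologicalSpace α] {f g : α → V} (hf : Continuous f)
    (hg : Continuous g) : Continuous fun x => bracket (f x) (g x) := by
  simp_rw [← bracketL_apply]
  fun_prop

lemma bracket_neg_right (X Y : V) : bracket X (-Y) = -bracket X Y := by
  simp [← bracketL_apply]

lemma bracket_neg_left (X Y : V) : bracket (-X) Y = -bracket X Y := by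
  simp [← bracketL_apply]

lemma bracket_zero_right (X : V) : bracket X 0 = 0 := by
  simp [← bracketL_apply]

lemma bracket_zero_left (Y : V) : bracket 0 Y = 0 := by
  simp [← bracketL_apply]

lemma measurePreserving_const_sub (a : V) :
    MeasurePreserving (fun x : V => a - x) volume volume := by
  simp_rw [sub_eq_add_neg]
  exact (measurePreserving_add_left volume a).comp (Measure.measurePreserving_neg volume)

@[fun_prop]
lemma continuous_gmul {α : Type*} [TopologicalSpace α] {f g : α → G} (hf : Continuous f)
    (hg : Continuous g) : Continuous fun x => gmul (f x) (g x) := by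
  unfold gmul
  fun_prop

lemma gmul_assoc (p q r : G) : gmul (gmul p q) r = gmul p (gmul q r) := by
  simp only [gmul, bracket_add_left, bracket_add_right, smul_add]
  ext1 <;> simp only <;> abel

/-- In exponential coordinates the inverse of `q` is `-q`. -/
lemma gmul_neg_cancel (p q : G) : gmul (gmul p (-q)) q = p := by
  rw [gmul_assoc]
  simp [gmul, bracket_neg_left, bracket_zero_right, bracket_self]

lemma neg_gmul (p q : G) : -gmul p q = gmul (-q) (-p) := by
  simp only [gmul, Prod.neg_mk, Prod.fst_neg, Prod.snd_neg]
  ext1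
  · simp only; abel
  · simp only [← bracketL_apply, map_neg, neg_apply, neg_neg]
    rw [bracketL_apply, bracketL_apply, bracket_skew q.1, smul_neg]
    abel

lemma gmul_neg_gmul (p q : G) : gmul p (-gmul (-q) p) = q := by
  rw [neg_gmul, neg_neg, ← gmul_assoc]
  simp [gmul, bracket_neg_right, bracket_zero_left, bracket_self]

/-- The homeomorphism `q ↦ p q⁻¹` of the group. -/
def divHomeo (p : G) : G ≃ₜ G where
  toFun q := gmul p (-q)
  invFun r := gmul (-r) p
  left_inv q := by
    change gmul (-gmul p (-q)) p = q
    rw [neg_gmul, neg_neg, gmul_neg_cancel]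
  right_inv r := gmul_neg_gmul p r
  continuous_toFun := by fun_prop
  continuous_invFun := by fun_prop

lemma measurePreserving_shear_sub (a : V) {b : V → V} (hb : Measurable b) :
    MeasurePreserving (fun q : G => ((a - q.1, b q.1 - q.2) : G)) volume volume := by
  refine MeasurePreserving.skew_product (μa := (volume : Measure V)) (μb := (volume : Measure V))
    (μc := (volume : Measure V)) (μd := (volume : Measure V)) (f := fun X => a - X)
    (g := fun X Z => b X - Z) ?_ ?_ ?_
  · exact measurePreserving_const_sub a
  · unfold Function.uncurry
    fun_prop
  · exact Eventually.of_forall fun X => (measurePreserving_const_sub (b X)).map_eq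

lemma measurePreserving_shear_add {b : V → V} (hb : Measurable b) :
    MeasurePreserving (fun q : G => ((q.1, q.2 + b q.1) : G)) volume volume := by
  refine MeasurePreserving.skew_product (μa := (volume : Measure V)) (μb := (volume : Measure V))
    (μc := (volume : Measure V)) (μd := (volume : Measure V)) (f := fun X => X)
    (g := fun X Z => Z + b X) (MeasurePreserving.id _) ?_ ?_
  · unfold Function.uncurry
    fun_prop
  · exact Eventually.of_forall fun X => map_add_right_eq_self volume (b X)

/-- The map is a reflection in `X` and, for fixed `X`, a reflected translation in `Z`; this is where
unimodularity enters. -/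
lemma measurePreserving_divHomeo (p : G) : MeasurePreserving (divHomeo p) volume volume := by
  have h := measurePreserving_shear_sub p.1 (b := fun X => p.2 - (2⁻¹ : ℝ) • bracket p.1 X)
    (by fun_prop : Continuous fun X => p.2 - (2⁻¹ : ℝ) • bracket p.1 X).measurable
  convert! h using 1
  funext q
  change gmul p (-q) = _
  simp only [gmul, Prod.fst_neg, Prod.snd_neg]
  ext1
  · simp only; abel
  · simp only [← bracketL_apply, map_neg, smul_neg]; abel

lemma integral_comp_div {F : Type*} [NormedAddCommGroup F] [NormedSpace ℝ F] (p : G) (f : G → F) :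
    ∫ q, f (gmul p (-q)) = ∫ q, f q :=
  (measurePreserving_divHomeo p).integral_comp (divHomeo p).measurableEmbedding f

/-- The direction of the left invariant vector field `X_a` at a point. -/
def leftDir (a : Fin 3) (p : G) : G :=
  (EuclideanSpace.single a 1, (2⁻¹ : ℝ) • bracket p.1 (EuclideanSpace.single a 1))

lemma gmul_single (a : Fin 3) (p : G) (t : ℝ) :
    gmul p (t • EuclideanSpace.single a (1 : ℝ), 0) = p + t • leftDir a p := by
  simp only [gmul, leftDir, bracket_smul_right]
  ext1
  · simp
  · simp [smul_comm t]

lemma leftField_apply (a : Fin 3) (F : G → ℂ) (p : G) :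
    leftField a F p = deriv (fun t : ℝ => F (p + t • leftDir a p)) 0 := by
  simp only [leftField, gmul_single]

lemma leftField_eq_fderiv (a : Fin 3) {F : G → ℂ} {p : G} (hF : DifferentiableAt ℝ F p) :
    leftField a F p = fderiv ℝ F p (leftDir a p) := by
  rw [leftField_apply]
  exact hF.lineDeriv_eq_fderiv

/-- The curve `t ↦ p exp(t X_a)` is an integral curve of the field, since `[X_a, X_a] = 0`. Hence
`X_a²` is an ordinary second derivative along it. -/
lemma leftField_flow (a : Fin 3) (F : G → ℂ) (p : G) (s : ℝ) :
    leftField a F (gmul p (s • EuclideanSpace.single a (1 : ℝ), 0))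
      = deriv (fun t : ℝ => F (gmul p (t • EuclideanSpace.single a (1 : ℝ), 0))) s := by
  rw [leftField]
  have := deriv_comp_const_add
    (f := fun t : ℝ => F (gmul p (t • EuclideanSpace.single a (1 : ℝ), 0))) s 0
  rw [add_zero] at this
  rw [← this]
  congr 1
  funext t
  rw [gmul_assoc]
  congr 2
  simp only [gmul, bracket_smul_left, bracket_smul_right, bracket_self, ← add_smul]
  simp

lemma leftField_leftField (a : Fin 3) (F : G → ℂ) (p : G) :
    leftField a (leftField a F) p = deriv (deriv fun t : ℝ =>
      F (gmul p (t • EuclideanSpace.single a (1 : ℝ), 0))) 0 := by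
  rw [leftField]
  simp_rw [leftField_flow]

lemma leftField_comp_gmul (a : Fin 3) (F : G → ℂ) (p : G) :
    leftField a (fun q => F (gmul p q)) = fun q => leftField a F (gmul p q) := by
  funext q
  simp only [leftField, gmul_assoc]

lemma subLaplacian_comp_gmul (F : G → ℂ) (p : G) :
    subLaplacian (fun q => F (gmul p q)) = fun q => subLaplacian F (gmul p q) := by
  funext q
  simp only [subLaplacian, leftField_comp_gmul]

lemma hasTemperateGrowth_leftDir (a : Fin 3) : Function.HasTemperateGrowth (leftDir a) := by
  have h := ((ContinuousLinearMap.inr ℝ V V).comp ((2⁻¹ : ℝ) •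
    ((bracketL.flip (EuclideanSpace.single a 1)).comp
      (ContinuousLinearMap.fst ℝ V V)))).hasTemperateGrowth
  convert! (Function.HasTemperateGrowth.const ((EuclideanSpace.single a 1, 0) : G)).add h using 1
  funext p
  ext1 <;> simp [leftDir, bracketL_apply]

/-- The left invariant vector field `X_a` on Schwartz functions. -/
def leftFieldS (a : Fin 3) (h : 𝓢(G, ℂ)) : 𝓢(G, ℂ) :=
  SchwartzMap.bilinLeftCLM (ContinuousLinearMap.id ℝ (G →L[ℝ] ℂ)) (hasTemperateGrowth_leftDir a)
    (SchwartzMap.fderivCLM ℝ G ℂ h)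

lemma leftFieldS_apply (a : Fin 3) (h : 𝓢(G, ℂ)) (p : G) :
    leftFieldS a h p = fderiv ℝ h p (leftDir a p) := rfl

lemma leftField_coe (a : Fin 3) (h : 𝓢(G, ℂ)) : leftField a h = leftFieldS a h := by
  funext p
  rw [leftField_eq_fderiv a h.differentiableAt, leftFieldS_apply]

/-- The subLaplacian on Schwartz functions. -/
def subLaplacianS (h : 𝓢(G, ℂ)) : 𝓢(G, ℂ) := -∑ a : Fin 3, leftFieldS a (leftFieldS a h)

lemma subLaplacian_coe (h : 𝓢(G, ℂ)) : subLaplacian h = subLaplacianS h := by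
  funext p
  simp only [subLaplacian, leftField_coe, subLaplacianS, neg_apply, Fin.sum_univ_three, add_apply]

/-- The measure preserving shear `ψ` straightens the field: it carries the constant direction `(e,
0)` to `X_a`. Euclidean integration by parts against the constant `1` then applies. -/
lemma integral_leftFieldS (a : Fin 3) (w : 𝓢(G, ℂ)) : ∫ p, leftFieldS a w p = 0 := by
  set e : V := EuclideanSpace.single a 1 with he
  set ψ : G → G := fun q => (q.1, q.2 + (2⁻¹ * q.1 a) • bracket q.1 e) with hψ
  have hc : Continuous fun X : V => (2⁻¹ * X a) • bracket X e := by fun_prop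
  have hmp : MeasurePreserving ψ volume volume := measurePreserving_shear_add hc.measurable
  have hψc : Continuous ψ := by
    rw [hψ]
    fun_prop
  have hint : ∀ h : 𝓢(G, ℂ), Integrable (fun q => h (ψ q)) volume := fun h =>
    hmp.integrable_comp_of_integrable h.integrable
  have h := integral_bilinear_hasLineDerivAt_right_eq_neg_left_of_integrable
    (μ := (volume : Measure G)) (f := fun _ => (1 : ℂ)) (f' := fun _ => 0)
    (g := fun q => w (ψ q)) (g' := fun q => leftFieldS a w (ψ q)) (v := ((e, 0) : G))
    (B := ContinuousLinearMap.mul ℝ ℂ) (by simp) (by simpa using hint _) (by simpa using hint _)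
    (fun q _ => by
      simp only [HasLineDerivAt]
      exact hasDerivAt_const _ _) ?_
  · simp only [ContinuousLinearMap.mul_apply', one_mul, zero_mul, integral_zero, neg_zero] at h
    rw [← h]
    have h1 := integral_map (μ := (volume : Measure G)) (φ := ψ) hψc.aemeasurable
      (f := leftFieldS a w) (leftFieldS a w).continuous.aestronglyMeasurable
    rw [hmp.map_eq] at h1
    exact h1
  · intro q _
    have h0 : HasDerivAt (fun t : ℝ => ψ q + t • leftDir a (ψ q)) (leftDir a (ψ q)) 0 := by
      simpa using ((hasDerivAt_id (0 : ℝ)).smul_const (leftDir a (ψ q))).const_add (ψ q)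
    have h1 : HasFDerivAt w (fderiv ℝ w (ψ q)) (ψ q + (0 : ℝ) • leftDir a (ψ q)) := by
      rw [zero_smul, add_zero]
      exact w.hasFDerivAt _
    have h2 := h1.comp_hasDerivAt 0 h0
    simp only [HasLineDerivAt]
    convert! h2 using 1
    funext t
    simp only [Function.comp_apply]
    congr 1
    simp only [hψ, leftDir, ← he]
    ext1
    · simp
    · simp only [Prod.fst_add, Prod.smul_fst, Prod.snd_add, Prod.smul_snd, smul_zero, add_zero,
        bracket_add_left, bracket_smul_left, bracket_self, PiLp.add_apply, PiLp.smul_apply]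
      rw [he]
      simp only [PiLp.single_apply, if_true]
      rw [smul_smul, add_assoc, ← add_smul]
      congr 2
      simp
      ring

lemma hasTemperateGrowth_fderiv {E F : Type*} [NormedAddCommGroup E] [NormedSpace ℝ E]
    [NormedAddCommGroup F] [NormedSpace ℝ F] {f : E → F} (hf : f.HasTemperateGrowth) :
    Function.HasTemperateGrowth (fderiv ℝ f) := by
  refine ⟨hf.1.fderiv_right (by simp), fun n => ?_⟩
  obtain ⟨k, C, h⟩ := hf.2 (n + 1)
  exact ⟨k, C, fun x => by rw [norm_iteratedFDeriv_fderiv]; exact h x⟩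

lemma hasTemperateGrowth_leftField (a : Fin 3) {Ψ : G → ℂ} (hΨ : Ψ.HasTemperateGrowth) :
    (leftField a Ψ).HasTemperateGrowth := by
  have h1 : leftField a Ψ = fun p => fderiv ℝ Ψ p (leftDir a p) := by
    funext p
    exact leftField_eq_fderiv a (hΨ.1.differentiable (by simp) p)
  rw [h1]
  exact (ContinuousLinearMap.id ℝ (G →L[ℝ] ℂ)).bilinear_hasTemperateGrowth
    (hasTemperateGrowth_fderiv hΨ) (hasTemperateGrowth_leftDir a)

lemma integrable_schwartz_mul {h : 𝓢(G, ℂ)} {Ψ : G → ℂ} (hΨ : Ψ.HasTemperateGrowth) :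
    Integrable fun p => h p * Ψ p := by
  have := (SchwartzMap.smulLeftCLM ℂ Ψ h).integrable (μ := volume)
  refine this.congr (Eventually.of_forall fun p => ?_)
  simp [SchwartzMap.smulLeftCLM_apply_apply hΨ, mul_comm]

/-- Integration by parts for a left invariant vector field. -/
lemma integral_leftFieldS_mul (a : Fin 3) (h : 𝓢(G, ℂ)) {Ψ : G → ℂ} (hΨ : Ψ.HasTemperateGrowth) :
    ∫ p, leftFieldS a h p * Ψ p = -∫ p, h p * leftField a Ψ p := by
  have h1 := integral_leftFieldS a (SchwartzMap.smulLeftCLM ℂ Ψ h)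
  have h2 : ∀ p, leftFieldS a (SchwartzMap.smulLeftCLM ℂ Ψ h) p
      = leftFieldS a h p * Ψ p + h p * leftField a Ψ p := by
    intro p
    have hd := hΨ.1.differentiable (by simp) p
    have e : ⇑(SchwartzMap.smulLeftCLM ℂ Ψ h) = fun q => Ψ q * h q := by
      funext q
      simp [SchwartzMap.smulLeftCLM_apply_apply hΨ]
    rw [leftFieldS_apply, e, fderiv_fun_mul hd h.differentiableAt, leftField_eq_fderiv a hd,
      leftFieldS_apply]
    simp
    ring
  simp_rw [h2] at h1
  rw [integral_add (integrable_schwartz_mul hΨ)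
    (integrable_schwartz_mul (hasTemperateGrowth_leftField a hΨ))] at h1
  linear_combination h1

/-- Symmetry of `L` against functions of temperate growth, because the waves do not decay in the
central directions. -/
lemma integral_subLaplacianS_mul (h : 𝓢(G, ℂ)) {Ψ : G → ℂ} (hΨ : Ψ.HasTemperateGrowth) :
    ∫ p, subLaplacianS h p * Ψ p = ∫ p, h p * subLaplacian Ψ p := by
  have h1 : ∀ a, ∫ p, leftFieldS a (leftFieldS a h) p * Ψ p
      = ∫ p, h p * leftField a (leftField a Ψ) p := by
    intro a
    rw [integral_leftFieldS_mul a _ hΨ,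
      integral_leftFieldS_mul a h (hasTemperateGrowth_leftField a hΨ), neg_neg]
  simp only [subLaplacianS, subLaplacian, neg_apply, Fin.sum_univ_three, add_apply, neg_mul,
    add_mul, mul_neg, mul_add]
  rw [integral_neg, integral_neg, integral_add, integral_add, integral_add, integral_add, h1, h1,
    h1]
  all_goals
    first
    | exact integrable_schwartz_mul hΨ
    | exact integrable_schwartz_mul
        (hasTemperateGrowth_leftField _ (hasTemperateGrowth_leftField _ hΨ))
    | exact (integrable_schwartz_mul hΨ).add (integrable_schwartz_mul hΨ)
    | exact (integrable_schwartz_mul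
        (hasTemperateGrowth_leftField _ (hasTemperateGrowth_leftField _ hΨ))).add
        (integrable_schwartz_mul
        (hasTemperateGrowth_leftField _ (hasTemperateGrowth_leftField _ hΨ)))

end FreeTwoStep
end

noncomputable section
namespace FreeTwoStep
open Filter Topology

/-! ### Joint eigenfunctions of the subLaplacian -/

/-- The squared length of the component of `X` orthogonal to the unit vector `ω`. -/
def perpSq (ω X : V) : ℝ := ‖X‖ ^ 2 - ⟪ω, X⟫ ^ 2

lemma perpSq_nonneg {ω : V} (hω : ‖ω‖ = 1) (X : V) : 0 ≤ perpSq ω X := by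
  have h := abs_real_inner_le_norm ω X
  rw [hω, one_mul] at h
  have := sq_le_sq' (neg_le_of_abs_le h) (le_of_abs_le h)
  exact sub_nonneg.2 this

/-- The bounded eigenfunction of the subLaplacian with parameters `ω`, `lam`, `k`, `ξ`. -/
def wave (ω : V) (lam : ℝ) (k : ℕ) (ξ : ℝ) (q : G) : ℂ :=
  Complex.exp (Complex.I * ((lam * ⟪ω, q.2⟫ + ξ * ⟪ω, q.1⟫ : ℝ) : ℂ))
    * (lagF k (lam / 2 * perpSq ω q.1) : ℂ)

lemma norm_wave_le {ω : V} (hω : ‖ω‖ = 1) {lam : ℝ} (hlam : 0 ≤ lam) (k : ℕ) (ξ : ℝ) (q : G) :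
    ‖wave ω lam k ξ q‖ ≤ 1 := by
  have := perpSq_nonneg hω q.1
  rw [wave, norm_mul, mul_comm Complex.I, Complex.norm_exp_ofReal_mul_I, one_mul,
    Complex.norm_real]
  exact abs_lagF_le_one k (by positivity)

lemma wave_neg (ω : V) (lam : ℝ) (k : ℕ) (ξ : ℝ) (q : G) :
    wave ω lam k ξ (-q) = wave (-ω) lam k ξ q := by
  simp [wave, perpSq, inner_neg_left, inner_neg_right]

lemma continuous_wave {α : Type*} [TopologicalSpace α] {ω : α → V} {lam ξ : α → ℝ} {q : α → G}
    (hω : Continuous ω) (hlam : Continuous lam) (k : ℕ) (hξ : Continuous ξ) (hq : Continuous q) :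
    Continuous fun x => wave (ω x) (lam x) k (ξ x) (q x) := by
  have := continuous_lagF k
  unfold wave perpSq
  fun_prop

lemma hasTemperateGrowth_wave {ω : V} (hω : ‖ω‖ = 1) {lam : ℝ} (hlam : 0 ≤ lam) (k : ℕ) (ξ : ℝ) :
    (wave ω lam k ξ).HasTemperateGrowth := by
  have h1 : Function.HasTemperateGrowth (fun q : G => ⟪ω, q.1⟫) :=
    ((innerSL ℝ ω).comp (ContinuousLinearMap.fst ℝ V V)).hasTemperateGrowth
  have h2 : Function.HasTemperateGrowth (fun q : G => ⟪ω, q.2⟫) :=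
    ((innerSL ℝ ω).comp (ContinuousLinearMap.snd ℝ V V)).hasTemperateGrowth
  have h3 : Function.HasTemperateGrowth (fun q : G => perpSq ω q.1) := by
    have := ((Function.hasTemperateGrowth_norm_sq V).comp
      (ContinuousLinearMap.fst ℝ V V).hasTemperateGrowth).sub (h1.mul h1)
    convert! this using 1
    funext q
    simp [perpSq, pow_two]
  have h4 : wave ω lam k ξ = fun q : G =>
      Complex.exp (Complex.I * ((lam * ⟪ω, q.2⟫ + ξ * ⟪ω, q.1⟫ : ℝ) : ℂ))
      * (((Real.exp (-(lam / 2 * perpSq ω q.1) / 2) : ℝ) : ℂ)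
        * (((laguerre k).eval (lam / 2 * perpSq ω q.1) : ℝ) : ℂ)) := by
    funext q
    simp only [wave, lagF]
    push_cast
    ring
  have h5 : Function.HasTemperateGrowth (fun q : G => lam / 2 * perpSq ω q.1) :=
    (Function.HasTemperateGrowth.const _).mul h3
  rw [h4]
  refine (hasTemperateGrowth_cexp_I_mul (((Function.HasTemperateGrowth.const _).mul h2).add
    ((Function.HasTemperateGrowth.const _).mul h1))).mul
    ((hasTemperateGrowth_ofReal (hasTemperateGrowth_exp_of_nonpos ?_ fun q => ?_)).mul
      (hasTemperateGrowth_ofReal (hasTemperateGrowth_poly _ h5)))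
  · have := (Function.HasTemperateGrowth.const (-(1 / 2) : ℝ)).mul h5
    convert! this using 1
    funext q
    simp only [Pi.mul_apply]
    ring
  · have := perpSq_nonneg hω q.1
    have : 0 ≤ lam / 2 * perpSq ω q.1 := by positivity
    linarith

lemma deriv_deriv_wave (k : ℕ) (b α A B C : ℝ) :
    deriv (deriv fun t : ℝ => Complex.exp (Complex.I * ((b + α * t : ℝ) : ℂ))
        * (lagF k (A + B * t + C * t ^ 2) : ℂ)) 0
      = Complex.exp (Complex.I * b) *
        (-α ^ 2 * lagF k A + 2 * Complex.I * α * B * lagF' k A + 2 * C * lagF' k A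
          + B ^ 2 * lagF'' k A) := by
  rw [show deriv (fun t : ℝ => Complex.exp (Complex.I * ((b + α * t : ℝ) : ℂ))
      * (lagF k (A + B * t + C * t ^ 2) : ℂ)) = _ from
    funext fun t => (hasDerivAt_wave k b α A B C t).deriv, (hasDerivAt_wave' k b α A B C 0).deriv]
  simp

lemma wave_line (ω : V) (lam : ℝ) (k : ℕ) (ξ : ℝ) (p : G) (a : Fin 3) (t : ℝ) :
    wave ω lam k ξ (gmul p (t • EuclideanSpace.single a (1 : ℝ), 0))
      = Complex.exp (Complex.I * (((lam * ⟪ω, p.2⟫ + ξ * ⟪ω, p.1⟫)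
          + (lam / 2 * ⟪ω, bracket p.1 (EuclideanSpace.single a 1)⟫ + ξ * ω a) * t : ℝ) : ℂ))
        * (lagF k (lam / 2 * perpSq ω p.1 + lam * (p.1 a - ⟪ω, p.1⟫ * ω a) * t
          + lam / 2 * (1 - ω a ^ 2) * t ^ 2) : ℂ) := by
  have e1 : ⟪ω, (EuclideanSpace.single a (1 : ℝ) : V)⟫ = ω a := by
    simp [EuclideanSpace.inner_single_right]
  have e2 : ⟪p.1, (EuclideanSpace.single a (1 : ℝ) : V)⟫ = p.1 a := by
    simp [EuclideanSpace.inner_single_right]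
  have e3 : ‖(EuclideanSpace.single a (1 : ℝ) : V)‖ = 1 := by simp
  simp only [wave, gmul, perpSq, inner_add_right, inner_smul_right, bracket_smul_right, e1,
    add_zero]
  congr 3
  · push_cast
    ring
  · rw [norm_add_sq_real, inner_smul_right, e2, norm_smul, mul_pow, e3, Real.norm_eq_abs, sq_abs]
    ring

/-- Along `X_a`, `α` and `B` are the first derivatives of the phase and of the Laguerre argument
`A`, and `2C` is the second derivative of the latter. For `|ω| = 1` one has `∑α² = λA/2 + ξ²`, `∑αB
= 0`, `∑C = λ` and `∑B² = 2λA`, so the sum reduces to `2λ` times the Laguerre expression `A ℓ'' +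
ℓ'`. -/
lemma subLaplacian_wave {ω : V} (hω : ‖ω‖ = 1) (lam : ℝ) (k : ℕ) (ξ : ℝ) (p : G) :
    subLaplacian (wave ω lam k ξ) p
      = ((lam * (2 * k + 1) + ξ ^ 2 : ℝ) : ℂ) * wave ω lam k ξ p := by
  have hn : ω 0 ^ 2 + ω 1 ^ 2 + ω 2 ^ 2 = 1 := by rw [← norm_sq_V, hω, one_pow]
  simp only [subLaplacian, leftField_leftField, wave_line, deriv_deriv_wave, Fin.sum_univ_three]
  set A : ℝ := lam / 2 * perpSq ω p.1 with hA
  have hode := congrArg (fun x : ℝ => (x : ℂ)) (lagF_ode k A)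
  set α : Fin 3 → ℝ := fun a =>
    lam / 2 * ⟪ω, bracket p.1 (EuclideanSpace.single a 1)⟫ + ξ * ω a with hα
  set B : Fin 3 → ℝ := fun a => lam * (p.1 a - ⟪ω, p.1⟫ * ω a) with hB
  set C : Fin 3 → ℝ := fun a => lam / 2 * (1 - ω a ^ 2) with hC
  have hp : perpSq ω p.1 = p.1 0 ^ 2 + p.1 1 ^ 2 + p.1 2 ^ 2
      - (ω 0 * p.1 0 + ω 1 * p.1 1 + ω 2 * p.1 2) ^ 2 := by
    rw [perpSq, norm_sq_V, inner_V]
  have h1 : α 0 ^ 2 + α 1 ^ 2 + α 2 ^ 2 = lam / 2 * A + ξ ^ 2 := by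
    rw [hA, hp]
    simp only [hα, inner_V, bracket_zero, bracket_one, bracket_two]
    simp
    linear_combination (lam ^ 2 / 4 * (p.1 0 ^ 2 + p.1 1 ^ 2 + p.1 2 ^ 2) + ξ ^ 2) * hn
  have h2 : α 0 * B 0 + α 1 * B 1 + α 2 * B 2 = 0 := by
    simp only [hα, hB, inner_V, bracket_zero, bracket_one, bracket_two]
    simp
    linear_combination (-lam * ξ * (ω 0 * p.1 0 + ω 1 * p.1 1 + ω 2 * p.1 2)) * hn
  have h3 : C 0 + C 1 + C 2 = lam := by
    simp only [hC]
    linear_combination (-lam / 2) * hn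
  have h4 : B 0 ^ 2 + B 1 ^ 2 + B 2 ^ 2 = 2 * lam * A := by
    rw [hA, hp]
    simp only [hB, inner_V]
    linear_combination (lam ^ 2 * (ω 0 * p.1 0 + ω 1 * p.1 1 + ω 2 * p.1 2) ^ 2) * hn
  have h1' := congrArg (fun x : ℝ => (x : ℂ)) h1
  have h2' := congrArg (fun x : ℝ => (x : ℂ)) h2
  have h3' := congrArg (fun x : ℝ => (x : ℂ)) h3
  have h4' := congrArg (fun x : ℝ => (x : ℂ)) h4
  simp only [wave, ← hA]
  set e := Complex.exp (Complex.I * ((lam * ⟪ω, p.2⟫ + ξ * ⟪ω, p.1⟫ : ℝ) : ℂ))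
  change -(e * (-(α 0 : ℂ) ^ 2 * lagF k A + 2 * Complex.I * α 0 * B 0 * lagF' k A
      + 2 * C 0 * lagF' k A + (B 0 : ℂ) ^ 2 * lagF'' k A)
    + e * (-(α 1 : ℂ) ^ 2 * lagF k A + 2 * Complex.I * α 1 * B 1 * lagF' k A
      + 2 * C 1 * lagF' k A + (B 1 : ℂ) ^ 2 * lagF'' k A)
    + e * (-(α 2 : ℂ) ^ 2 * lagF k A + 2 * Complex.I * α 2 * B 2 * lagF' k A
      + 2 * C 2 * lagF' k A + (B 2 : ℂ) ^ 2 * lagF'' k A)) = _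
  push_cast at h1' h2' h3' h4' hode ⊢
  linear_combination (-2 * lam * e) * hode + e * lagF k A * h1'
    - 2 * Complex.I * e * lagF' k A * h2' - 2 * e * lagF' k A * h3' - e * lagF'' k A * h4'

/-! ### Coefficients of Schwartz functions -/

/-- The convolution of `f` with the eigenfunction `wave ω lam k ξ`. -/
def coeff (f : G → ℂ) (ω : V) (lam : ℝ) (k : ℕ) (ξ : ℝ) (p : G) : ℂ :=
  ((lam / (2 * Real.pi) : ℝ) : ℂ) * ∫ q, f (gmul p (-q)) * wave ω lam k ξ q

lemma coeff_eq (f : G → ℂ) (ω : V) (lam : ℝ) (k : ℕ) (ξ : ℝ) (p : G) :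
    coeff f ω lam k ξ p
      = ((lam / (2 * Real.pi) : ℝ) : ℂ) * ∫ q, f q * wave ω lam k ξ (gmul (-q) p) := by
  rw [coeff, ← integral_comp_div p fun q => f q * wave ω lam k ξ (gmul (-q) p)]
  simp_rw [neg_gmul, neg_neg, gmul_neg_cancel]

lemma norm_coeff_le (f : 𝓢(G, ℂ)) {ω : V} (hω : ‖ω‖ = 1) {lam : ℝ} (hlam : 0 ≤ lam) (k : ℕ)
    (ξ : ℝ) (p : G) : ‖coeff f ω lam k ξ p‖ ≤ lam * ((2 * Real.pi)⁻¹ * ∫ q, ‖f q‖) := by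
  rw [coeff_eq, norm_mul, Complex.norm_real, Real.norm_of_nonneg (by positivity), div_eq_mul_inv,
    mul_assoc]
  gcongr
  refine norm_integral_le_of_norm_le f.integrable.norm (Eventually.of_forall fun q => ?_)
  rw [norm_mul]
  exact mul_le_of_le_one_right (norm_nonneg _) (norm_wave_le hω hlam k ξ _)

lemma hasTemperateGrowth_gmul (p : G) : Function.HasTemperateGrowth (gmul p) := by
  have h := ((ContinuousLinearMap.inr ℝ V V).comp ((2⁻¹ : ℝ) •
    ((bracketL p.1).comp (ContinuousLinearMap.fst ℝ V V)))
      + ContinuousLinearMap.id ℝ G).hasTemperateGrowth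
  convert! (Function.HasTemperateGrowth.const p).add h using 1
  funext q
  ext1 <;> simp [gmul, bracketL_apply]
  abel

/-- As a function of `q`, `wave` at `q⁻¹p` is a left translate of the wave with `-ω`. The left
invariant `L` acts on it by the same eigenvalue, and symmetry moves `L` from `f` to it. -/
lemma coeff_subLaplacianS (f : 𝓢(G, ℂ)) {ω : V} (hω : ‖ω‖ = 1) {lam : ℝ} (hlam : 0 ≤ lam) (k : ℕ)
    (ξ : ℝ) (p : G) : coeff (subLaplacianS f) ω lam k ξ p
      = ((lam * (2 * k + 1) + ξ ^ 2 : ℝ) : ℂ) * coeff f ω lam k ξ p := by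
  have hω' : ‖-ω‖ = 1 := by rwa [norm_neg]
  have h1 : ∀ q, wave ω lam k ξ (gmul (-q) p) = wave (-ω) lam k ξ (gmul (-p) q) := by
    intro q
    rw [← wave_neg, neg_gmul, neg_neg]
  simp only [coeff_eq, h1]
  have h2 := integral_subLaplacianS_mul f
    ((hasTemperateGrowth_wave hω' hlam k ξ).comp (hasTemperateGrowth_gmul (-p)))
  simp only [Function.comp_def, subLaplacian_comp_gmul, subLaplacian_wave hω'] at h2
  rw [h2]
  simp_rw [mul_left_comm (f _)]
  rw [integral_const_mul]
  ring

lemma coeff_add (f g : 𝓢(G, ℂ)) {ω : V} (hω : ‖ω‖ = 1) {lam : ℝ} (hlam : 0 ≤ lam) (k : ℕ)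
    (ξ : ℝ) (p : G) : coeff (f + g) ω lam k ξ p = coeff f ω lam k ξ p + coeff g ω lam k ξ p := by
  have h : ∀ f : 𝓢(G, ℂ), Integrable fun q => f q * wave ω lam k ξ (gmul (-q) p) := by
    intro f
    refine f.integrable.mul_bdd (c := 1) (continuous_wave continuous_const continuous_const k
      continuous_const (by fun_prop)).aestronglyMeasurable
      (Eventually.of_forall fun q => norm_wave_le hω hlam k ξ _)
  simp only [coeff_eq, Pi.add_apply, add_mul]
  rw [integral_add (h f) (h g), mul_add]

/-- Rapid decay of the coefficients of a Schwartz function in the eigenvalue. -/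
lemma exists_norm_coeff_le (f : 𝓢(G, ℂ)) (N : ℕ) : ∃ C : ℝ, 0 ≤ C ∧
    ∀ (ω : V) (_ : ‖ω‖ = 1) (lam : ℝ) (_ : 0 ≤ lam) (k : ℕ) (ξ : ℝ) (p : G),
      (1 + (lam * (2 * k + 1) + ξ ^ 2)) ^ N * ‖coeff f ω lam k ξ p‖ ≤ C * lam := by
  induction N generalizing f with
  | zero =>
    refine ⟨(2 * Real.pi)⁻¹ * ∫ q, ‖f q‖, by positivity, fun ω hω lam hlam k ξ p => ?_⟩
    rw [pow_zero, one_mul, mul_comm]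
    exact norm_coeff_le f hω hlam k ξ p
  | succ N ih =>
    -- Passing from `f` to `(1 + L) f` multiplies the coefficient by `1 + λ(2k+1) + ξ²`, which gains
    -- one power.
    obtain ⟨C, hC, h⟩ := ih (f + subLaplacianS f)
    refine ⟨C, hC, fun ω hω lam hlam k ξ p => ?_⟩
    refine le_trans (le_of_eq ?_) (h ω hω lam hlam k ξ p)
    have h0 : 0 ≤ 1 + (lam * (2 * k + 1) + ξ ^ 2) := by positivity
    have e : coeff (⇑(f + subLaplacianS f)) ω lam k ξ p
        = ((1 + (lam * (2 * k + 1) + ξ ^ 2) : ℝ) : ℂ) * coeff f ω lam k ξ p := by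
      have := coeff_add f (subLaplacianS f) hω hlam k ξ p
      rw [coeff_subLaplacianS f hω hlam] at this
      rw [show ⇑(f + subLaplacianS f) = ⇑f + ⇑(subLaplacianS f) from rfl, this]
      push_cast
      ring
    rw [e, norm_mul, Complex.norm_real, Real.norm_of_nonneg h0, pow_succ, mul_assoc]

lemma continuous_coeff {α : Type*} [TopologicalSpace α] [FirstCountableTopology α] (f : 𝓢(G, ℂ))
    {ω : α → V} {lam ξ : α → ℝ} {p : α → G} (hω : Continuous ω) (hω1 : ∀ x, ‖ω x‖ = 1)
    (hlam : Continuous lam) (hlam0 : ∀ x, 0 ≤ lam x) (k : ℕ) (hξ : Continuous ξ)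
    (hp : Continuous p) : Continuous fun x => coeff f (ω x) (lam x) k (ξ x) (p x) := by
  simp only [coeff_eq]
  refine Continuous.mul (by fun_prop) (continuous_of_dominated (bound := fun q => ‖f q‖)
    (fun x => ?_) (fun x => Eventually.of_forall fun q => ?_) f.integrable.norm
    (Eventually.of_forall fun q => ?_))
  · exact (f.continuous.mul (continuous_wave continuous_const continuous_const k
      continuous_const (by fun_prop))).aestronglyMeasurable
  · rw [norm_mul]
    exact mul_le_of_le_one_right (norm_nonneg _) (norm_wave_le (hω1 x) (hlam0 x) k _ _)
  · exact continuous_const.mul (continuous_wave hω hlam k hξ (by fun_prop))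

/-- Joint measurability of the coefficients in all parameters. -/
lemma measurable_coeff {α : Type*} [MeasurableSpace α] (f : 𝓢(G, ℂ))
    {ω : α → S} {lam ξ : α → ℝ} {k : α → ℕ} {p : α → G} (hω : Measurable ω)
    (hlam : Measurable lam) (hk : Measurable k) (hξ : Measurable ξ)
    (hp : Measurable p) : Measurable fun x => coeff f (ω x) |lam x| (k x) (ξ x) (p x) := by
  -- The absolute value keeps the parameter in the range where the waves are bounded by `1`, so
  -- continuity holds for all real `lam`.
  have h : Measurable fun x : (S × ℝ × ℝ × G) × ℕ =>
      coeff f x.1.1 |x.1.2.1| x.2 x.1.2.2.1 x.1.2.2.2 := by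
    refine measurable_from_prod_countable_left fun k => ?_
    refine Continuous.measurable (α := S × ℝ × ℝ × G) ?_
    exact continuous_coeff f (ω := fun x : S × ℝ × ℝ × G => (x.1 : V))
      (continuous_subtype_val.comp continuous_fst) (fun x => norm_eq_of_mem_sphere x.1)
      (continuous_abs.comp (continuous_fst.comp continuous_snd)) (fun x => abs_nonneg _) k
      (by fun_prop) (by fun_prop)
  exact h.comp ((hω.prodMk (hlam.prodMk (hξ.prodMk hp))).prodMk hk)

end FreeTwoStep
end

noncomputable section
namespace FreeTwoStep
open Filter Topology

/-! ### Adapted rotations -/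

namespace IsAdaptedRotation
variable {ω : V} {R : V ≃ₗᵢ[ℝ] V}

lemma inner_single_V (x : V) (i : Fin 3) : ⟪(EuclideanSpace.single i (1 : ℝ) : V), x⟫ = x i := by
  simp [EuclideanSpace.inner_single_left]

lemma symm_apply_eq (R : V ≃ₗᵢ[ℝ] V) (Y : V) :
    R.symm Y = Y 0 • R.symm (EuclideanSpace.single 0 1) + Y 1 • R.symm (EuclideanSpace.single 1 1)
      + Y 2 • R.symm (EuclideanSpace.single 2 1) := by
  rw [← map_smul, ← map_smul, ← map_smul, ← map_add, ← map_add]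
  congr 1
  apply V_ext <;> simp

/-- In adapted coordinates `ω([·,·])` is the standard symplectic form of the plane: the radical
direction drops out and the normalization is `ω([X_ω, Y_ω]) = 1`. -/
lemma inner_bracket (hR : IsAdaptedRotation ω R) (X X' : V) :
    ⟪ω, bracket X X'⟫ = R X 0 * R X' 1 - R X 1 * R X' 0 := by
  have h1 := hR.bracket_eq_one
  have h2 := hR.radical_mem
  simp only [radical, mem_ofPred_eq] at h2
  have h3 : ∀ Y, ⟪ω, bracket Y (R.symm (EuclideanSpace.single 2 1))⟫ = 0 := by
    intro Y
    rw [bracket_skew, inner_neg_right, h2, neg_zero]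
  have h4 : ⟪ω, bracket (R.symm (EuclideanSpace.single 1 1))
      (R.symm (EuclideanSpace.single 0 1))⟫ = -1 := by
    rw [bracket_skew, inner_neg_right, h1]
  have e1 : X = R.symm (R X) := (R.symm_apply_apply X).symm
  have e2 : X' = R.symm (R X') := (R.symm_apply_apply X').symm
  rw [symm_apply_eq] at e1 e2
  conv_lhs => rw [e1, e2]
  simp only [bracket_add_left, bracket_add_right, bracket_smul_left, bracket_smul_right,
    bracket_self, inner_add_right, inner_smul_right, h1, h2, h3, h4, inner_zero_right]
  ring

/-- The bracket is the cross product, so this triple product is the determinant of `R⁻¹`. -/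
lemma inner_bracket_self_det (hR : IsAdaptedRotation ω R) :
    ⟪bracket (R.symm (EuclideanSpace.single 0 1)) (R.symm (EuclideanSpace.single 1 1)),
      R.symm (EuclideanSpace.single 2 1)⟫ = 1 := by
  have h1 : LinearMap.det (R.symm.toLinearEquiv : V →ₗ[ℝ] V) = 1 := by
    have h : (R.toLinearEquiv : V →ₗ[ℝ] V) ∘ₗ (R.symm.toLinearEquiv : V →ₗ[ℝ] V)
        = LinearMap.id := by
      ext x : 1
      simp
    have h' := congrArg LinearMap.det h
    rwa [LinearMap.det_comp, hR.det_eq_one, one_mul, LinearMap.det_id] at h'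
  rw [← LinearMap.det_toMatrix (EuclideanSpace.basisFun (Fin 3) ℝ).toBasis,
    Matrix.det_fin_three] at h1
  simp only [LinearMap.toMatrix_apply, OrthonormalBasis.coe_toBasis, EuclideanSpace.basisFun_apply,
    OrthonormalBasis.coe_toBasis_repr_apply, EuclideanSpace.basisFun_repr] at h1
  rw [inner_V, bracket_zero, bracket_one, bracket_two]
  simp only [LinearEquiv.coe_coe, LinearIsometryEquiv.coe_toLinearEquiv] at h1
  linarith

/-- The unit vector `[X_ω, Y_ω]` has inner product `1` with both unit vectors `V_ω` and `ω`, and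
equality in Cauchy–Schwarz identifies all three. This is what justifies writing `ω(X)` for `v_ω`. -/
lemma symm_single_two (hω : ‖ω‖ = 1) (hR : IsAdaptedRotation ω R) :
    R.symm (EuclideanSpace.single 2 1) = ω := by
  set x := R.symm (EuclideanSpace.single 0 1) with hx
  set y := R.symm (EuclideanSpace.single 1 1) with hy
  have hnx : ‖x‖ = 1 := by rw [hx, R.symm.norm_map]; simp
  have hny : ‖y‖ = 1 := by rw [hy, R.symm.norm_map]; simp
  have hxy : ⟪x, y⟫ = 0 := by
    rw [hx, hy, R.symm.inner_map_map, inner_single_V]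
    simp
  have hb : ‖bracket x y‖ = 1 := by
    have h1 : ‖bracket x y‖ ^ 2 = ‖x‖ ^ 2 * ‖y‖ ^ 2 - ⟪x, y⟫ ^ 2 := by
      rw [norm_sq_V, norm_sq_V, norm_sq_V, inner_V, bracket_zero, bracket_one, bracket_two]
      ring
    rw [hnx, hny, hxy] at h1
    nlinarith [norm_nonneg (bracket x y)]
  have h2 : ‖R.symm (EuclideanSpace.single 2 1)‖ = 1 := by rw [R.symm.norm_map]; simp
  rw [← (inner_eq_one_iff_of_norm_eq_one hb h2).1 hR.inner_bracket_self_det]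
  exact ((inner_eq_one_iff_of_norm_eq_one hω hb).1 hR.bracket_eq_one).symm

lemma inner_eq (hω : ‖ω‖ = 1) (hR : IsAdaptedRotation ω R) (X : V) : ⟪ω, X⟫ = R X 2 := by
  rw [← hR.symm_single_two hω, ← R.inner_map_map, R.apply_symm_apply, inner_single_V]

lemma perpSq_eq (hω : ‖ω‖ = 1) (hR : IsAdaptedRotation ω R) (X : V) :
    perpSq ω X = R X 0 ^ 2 + R X 1 ^ 2 := by
  rw [perpSq, hR.inner_eq hω, ← R.norm_map X, norm_sq_V]
  ring

end IsAdaptedRotation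

/-! ### Coordinates `ℝ² × ℝ` on `𝔳` -/

/-- The vector with coordinates `(u, v)`. -/
def join (x : Plane × ℝ) : V := !₂[x.1 0, x.1 1, x.2]

lemma join_zero (x : Plane × ℝ) : join x 0 = x.1 0 := rfl
lemma join_one (x : Plane × ℝ) : join x 1 = x.1 1 := rfl
lemma join_two (x : Plane × ℝ) : join x 2 = x.2 := rfl

lemma norm_sq_join (x : Plane × ℝ) : ‖join x‖ ^ 2 = ‖x.1‖ ^ 2 + x.2 ^ 2 := by
  rw [norm_sq_V, norm_sq_plane, join_zero, join_one, join_two]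

lemma norm_fst_le_join (x : Plane × ℝ) : ‖x.1‖ ≤ ‖join x‖ :=
  le_of_sq_le_sq (by rw [norm_sq_join]; nlinarith [sq_nonneg x.2]) (norm_nonneg _)

lemma abs_snd_le_join (x : Plane × ℝ) : |x.2| ≤ ‖join x‖ :=
  le_of_sq_le_sq (by rw [norm_sq_join, sq_abs]; nlinarith [sq_nonneg ‖x.1‖]) (norm_nonneg _)

/-- `ℝ² × ℝ` and `𝔳` as measurable spaces. -/
def joinEquiv : Plane × ℝ ≃ᵐ V :=
  (((MeasurableEquiv.toLp 2 (Fin 2 → ℝ)).symm.prodCongr (MeasurableEquiv.refl ℝ)).trans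
    (MeasurableEquiv.prodComm.trans
      (MeasurableEquiv.piFinSuccAbove (fun _ : Fin 3 => ℝ) 2).symm)).trans
    (MeasurableEquiv.toLp 2 (Fin 3 → ℝ))

lemma joinEquiv_apply (x : Plane × ℝ) : joinEquiv x = join x := by
  apply V_ext <;> rfl

lemma measurePreserving_joinEquiv : MeasurePreserving joinEquiv volume volume := by
  refine (PiLp.volume_preserving_toLp (Fin 3)).comp
    (((volume_preserving_piFinSuccAbove (fun _ : Fin 3 => ℝ) 2).symm _).comp
      (Measure.measurePreserving_swap.comp ?_))
  exact (PiLp.volume_preserving_ofLp (Fin 2)).prod (MeasurePreserving.id _)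

lemma measurePreserving_join_symm (R : V ≃ₗᵢ[ℝ] V) :
    MeasurePreserving (joinEquiv.trans R.symm.toHomeomorph.toMeasurableEquiv) volume volume :=
  R.symm.measurePreserving.comp measurePreserving_joinEquiv

lemma continuous_join : Continuous join := by
  unfold join
  fun_prop

lemma integral_eq_integral_join (R : V ≃ₗᵢ[ℝ] V) {h : V → ℂ} (hh : Integrable h) :
    ∫ X, h X = ∫ u : Plane, ∫ v : ℝ, h (R.symm (join (u, v))) := by
  have e : ∀ x, joinEquiv.trans R.symm.toHomeomorph.toMeasurableEquiv x = R.symm (join x) := by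
    intro x
    rw [← joinEquiv_apply]
    rfl
  have h1 := (measurePreserving_join_symm R).integral_comp' h
  have h2 := ((measurePreserving_join_symm R).integrable_comp_emb
    (MeasurableEquiv.measurableEmbedding _)).2 hh
  simp only [Function.comp_def, e] at h1 h2
  rw [← h1]
  exact integral_prod _ h2

lemma lintegral_eq_lintegral_join (R : V ≃ₗᵢ[ℝ] V) {h : V → ENNReal} (hh : Measurable h) :
    ∫⁻ X, h X = ∫⁻ u : Plane, ∫⁻ v : ℝ, h (R.symm (join (u, v))) := by
  have e : ∀ x, joinEquiv.trans R.symm.toHomeomorph.toMeasurableEquiv x = R.symm (join x) := by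
    intro x
    rw [← joinEquiv_apply]
    rfl
  have h1 := (measurePreserving_join_symm R).lintegral_comp hh
  simp only [e] at h1
  rw [← h1]
  exact lintegral_prod _ (hh.comp (R.symm.continuous.comp continuous_join).measurable).aemeasurable

/-! ### Fibers of Schwartz functions -/

lemma exists_norm_schwartz_le (f : 𝓢(G, ℂ)) (a b : ℕ) : ∃ C : ℝ, 0 ≤ C ∧ ∀ X Z : V,
    ‖f (X, Z)‖ ≤ C * ((1 + ‖X‖) ^ a)⁻¹ * ((1 + ‖Z‖) ^ b)⁻¹ := by
  refine ⟨2 ^ (a + b) * ((Finset.Iic (a + b, 0)).sup fun m => SchwartzMap.seminorm ℝ m.1 m.2) f,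
    by positivity, fun X Z => ?_⟩
  have := SchwartzMap.one_add_le_sup_seminorm_apply (𝕜 := ℝ) (m := (a + b, 0)) (k := a + b) (n := 0)
    le_rfl le_rfl f (X, Z)
  rw [norm_iteratedFDeriv_zero] at this
  rw [mul_assoc, ← mul_inv, ← div_eq_mul_inv, le_div_iff₀ (by positivity)]
  refine le_trans ?_ this
  rw [mul_comm, pow_add]
  gcongr
  · exact norm_fst_le (X, Z)
  · exact norm_snd_le (X, Z)

lemma finrank_V : Module.finrank ℝ V = 3 := by simp

lemma integrable_weight_V : Integrable fun Z : V => ((1 + ‖Z‖) ^ 4)⁻¹ :=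
  integrable_inv_one_add_norm_pow volume (by rw [finrank_V]; norm_num)

lemma integrable_weight_real : Integrable fun v : ℝ => ((1 + |v|) ^ 2)⁻¹ :=
  integrable_inv_one_add_norm_pow (E := ℝ) volume (n := 2) (by simp)

lemma continuous_section (f : 𝓢(G, ℂ)) (X : V) : Continuous fun Z : V => f (X, Z) :=
  f.continuous.comp (by fun_prop : Continuous fun Z : V => (X, Z))

lemma integrable_section (f : 𝓢(G, ℂ)) (X : V) : Integrable fun Z : V => f (X, Z) := by
  obtain ⟨C, hC, h⟩ := exists_norm_schwartz_le f 0 4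
  refine (integrable_weight_V.const_mul C).mono' (continuous_section f X).aestronglyMeasurable
    (Eventually.of_forall fun Z => ?_)
  simpa using h X Z

lemma norm_phase (x : ℝ) : ‖Complex.exp (-Complex.I * (x : ℂ))‖ = 1 := by
  rw [show -Complex.I * (x : ℂ) = ((-x : ℝ) : ℂ) * Complex.I by push_cast; ring,
    Complex.norm_exp_ofReal_mul_I]

lemma exists_norm_centralFT_le (f : 𝓢(G, ℂ)) (a : ℕ) : ∃ C : ℝ, 0 ≤ C ∧ ∀ ν X : V,
    ‖centralFT f ν X‖ ≤ C * ((1 + ‖X‖) ^ a)⁻¹ := by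
  obtain ⟨C, hC, h⟩ := exists_norm_schwartz_le f a 4
  refine ⟨C * ∫ Z : V, ((1 + ‖Z‖) ^ 4)⁻¹, by positivity, fun ν X => ?_⟩
  rw [mul_right_comm, ← integral_const_mul]
  refine norm_integral_le_of_norm_le (integrable_weight_V.const_mul _)
    (Eventually.of_forall fun Z => ?_)
  rw [norm_mul, norm_phase, one_mul]
  exact h X Z

lemma continuous_centralFT (f : 𝓢(G, ℂ)) :
    Continuous fun x : V × V => centralFT f x.1 x.2 := by
  obtain ⟨C, hC, h⟩ := exists_norm_schwartz_le f 0 4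
  refine continuous_of_dominated (bound := fun Z : V => C * ((1 + ‖Z‖) ^ 4)⁻¹)
    (fun x => ?_) (fun x => Eventually.of_forall fun Z => ?_) (integrable_weight_V.const_mul C)
    (Eventually.of_forall fun Z => ?_)
  · exact (Continuous.mul (by fun_prop) (continuous_section f _)).aestronglyMeasurable
  · rw [norm_mul, norm_phase, one_mul]
    simpa using h x.2 Z
  · exact Continuous.mul (by fun_prop)
      (f.continuous.comp (by fun_prop : Continuous fun x : V × V => (x.2, Z)))

/-- The function `(u, v) ↦ f^ν (R⁻¹ (u, v))`. -/
def rotFT (f : G → ℂ) (ν : V) (R : V ≃ₗᵢ[ℝ] V) (x : Plane × ℝ) : ℂ :=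
  centralFT f ν (R.symm (join x))

lemma continuous_rotFT (f : 𝓢(G, ℂ)) (ν : V) (R : V ≃ₗᵢ[ℝ] V) : Continuous (rotFT f ν R) := by
  have h : Continuous fun x : Plane × ℝ => ((ν, R.symm (join x)) : V × V) :=
    continuous_const.prodMk (R.symm.continuous.comp continuous_join)
  have h1 := (continuous_centralFT f).comp h
  simp only [Function.comp_def] at h1
  exact h1

lemma exists_norm_rotFT_le (f : 𝓢(G, ℂ)) (ν : V) (R : V ≃ₗᵢ[ℝ] V) : ∃ C : ℝ, 0 ≤ C ∧
    ∀ (u : Plane) (v : ℝ), ‖rotFT f ν R (u, v)‖ ≤ C * ((1 + ‖u‖) ^ 3)⁻¹ * ((1 + |v|) ^ 2)⁻¹ := by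
  obtain ⟨C, hC, h⟩ := exists_norm_centralFT_le f 5
  refine ⟨C, hC, fun u v => (h ν _).trans ?_⟩
  rw [mul_assoc, ← mul_inv, R.symm.norm_map]
  gcongr
  rw [show (1 + ‖join (u, v)‖) ^ 5 = (1 + ‖join (u, v)‖) ^ 3 * (1 + ‖join (u, v)‖) ^ 2 by ring]
  have h1 := norm_fst_le_join (u, v)
  have h2 := abs_snd_le_join (u, v)
  gcongr

lemma integrable_rotFT (f : 𝓢(G, ℂ)) (ν : V) (R : V ≃ₗᵢ[ℝ] V) (u : Plane) :
    Integrable fun v : ℝ => rotFT f ν R (u, v) := by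
  obtain ⟨C, hC, h⟩ := exists_norm_rotFT_le f ν R
  exact (integrable_weight_real.const_mul _).mono' ((continuous_rotFT f ν R).comp
    (by fun_prop : Continuous fun v : ℝ => (u, v))).aestronglyMeasurable
    (Eventually.of_forall fun v => h u v)

/-- The plane function to which the projections of the twisted Laplacian are applied. -/
def fiber (f : G → ℂ) (ν : V) (R : V ≃ₗᵢ[ℝ] V) (ξ : ℝ) : Plane → ℂ :=
  radicalFT (centralFT f ν ∘ R.symm) ξ

lemma fiber_apply (f : G → ℂ) (ν : V) (R : V ≃ₗᵢ[ℝ] V) (ξ : ℝ) (u : Plane) :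
    fiber f ν R ξ u = ∫ v : ℝ, Complex.exp (-Complex.I * (v * ξ : ℝ)) * rotFT f ν R (u, v) := rfl

lemma continuous_fiber (f : 𝓢(G, ℂ)) (ν : V) (R : V ≃ₗᵢ[ℝ] V) :
    Continuous fun x : ℝ × Plane => fiber f ν R x.1 x.2 := by
  obtain ⟨C, hC, h⟩ := exists_norm_rotFT_le f ν R
  simp only [fiber_apply]
  refine continuous_of_dominated (bound := fun v : ℝ => C * ((1 + |v|) ^ 2)⁻¹)
    (fun x => ?_) (fun x => Eventually.of_forall fun v => ?_) (integrable_weight_real.const_mul C)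
    (Eventually.of_forall fun v => ?_)
  · exact (Continuous.mul (by fun_prop) ((continuous_rotFT f ν R).comp
      (by fun_prop : Continuous fun v : ℝ => (x.2, v)))).aestronglyMeasurable
  · rw [norm_mul, norm_phase, one_mul]
    refine (h x.2 v).trans ?_
    gcongr
    exact mul_le_of_le_one_right hC (inv_le_one_of_one_le₀ (one_le_pow₀ (by simp)))
  · exact Continuous.mul (by fun_prop) ((continuous_rotFT f ν R).comp
      (by fun_prop : Continuous fun x : ℝ × Plane => (x.2, v)))

lemma exists_planeDecay_fiber (f : 𝓢(G, ℂ)) (ν : V) (R : V ≃ₗᵢ[ℝ] V) (ξ : ℝ) :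
    ∃ C, PlaneDecay (fiber f ν R ξ) C := by
  obtain ⟨C, hC, h⟩ := exists_norm_rotFT_le f ν R
  refine ⟨C * ∫ v : ℝ, ((1 + |v|) ^ 2)⁻¹, (continuous_fiber f ν R).comp
    (by fun_prop : Continuous fun u : Plane => (ξ, u)), fun u => ?_⟩
  have h1 : ‖fiber f ν R ξ u‖ ≤ ∫ v : ℝ, C * ((1 + ‖u‖) ^ 3)⁻¹ * ((1 + |v|) ^ 2)⁻¹ := by
    rw [fiber_apply]
    refine norm_integral_le_of_norm_le (integrable_weight_real.const_mul _)
      (Eventually.of_forall fun v => ?_)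
    rw [norm_mul, norm_phase, one_mul]
    exact h u v
  rw [integral_const_mul, mul_right_comm, ← div_eq_mul_inv, le_div_iff₀ (by positivity)] at h1
  exact h1

/-- The first two of the rotated coordinates. -/
def planePart (Y : V) : Plane := !₂[Y 0, Y 1]

/-- The coefficients of `f` in terms of the projections of the twisted Laplacian. -/
lemma coeff_eq_proj (f : 𝓢(G, ℂ)) {ω : V} (hω : ‖ω‖ = 1) {R : V ≃ₗᵢ[ℝ] V}
    (hR : IsAdaptedRotation ω R) {lam : ℝ} (hlam : 0 ≤ lam) (k : ℕ) (ξ : ℝ) (p : G) :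
    coeff f ω lam k ξ p = Complex.exp (Complex.I * (lam * ⟪ω, p.2⟫ : ℝ))
      * Complex.exp (Complex.I * (R p.1 2 * ξ : ℝ))
      * proj k lam (fiber f (lam • ω) R ξ) (planePart (R p.1)) := by
  set e : ℂ := Complex.exp (Complex.I * (lam * ⟪ω, p.2⟫ : ℝ))
      * Complex.exp (Complex.I * (R p.1 2 * ξ : ℝ)) with he
  set w : Plane := planePart (R p.1) with hw
  -- The bracket term in the central component of `q⁻¹p` supplies the twist of `pker`. The rest of
  -- the phase separates into the factors of the two partial Fourier transforms and the phase of
  -- `p`.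
  have key : ∀ (x : Plane × ℝ) (Z : V),
      ((lam / (2 * Real.pi) : ℝ) : ℂ)
        * (f (R.symm (join x), Z) * wave ω lam k ξ (gmul (-(R.symm (join x), Z)) p))
      = e * (pker k lam w x.1 * (Complex.exp (-Complex.I * (x.2 * ξ : ℝ))
        * (Complex.exp (-Complex.I * (⟪lam • ω, Z⟫ : ℝ)) * f (R.symm (join x), Z)))) := by
    intro x Z
    have h1 : perpSq ω (gmul (-(R.symm (join x), Z)) p).1 = ‖w - x.1‖ ^ 2 := by
      rw [hR.perpSq_eq hω, norm_sq_plane]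
      simp [gmul, hw, planePart, join_zero, join_one]
      ring
    have h2 : lam * ⟪ω, (gmul (-(R.symm (join x), Z)) p).2⟫
        + ξ * ⟪ω, (gmul (-(R.symm (join x), Z)) p).1⟫
        = lam * ⟪ω, p.2⟫ + R p.1 2 * ξ + lam / 2 * twist w x.1 - x.2 * ξ - ⟪lam • ω, Z⟫ := by
      simp only [gmul, Prod.fst_neg, Prod.snd_neg, inner_add_right, inner_smul_right,
        bracket_neg_left, inner_neg_right, hR.inner_bracket, inner_smul_left,
        R.apply_symm_apply, join_zero, join_one, twist, hw, planePart]
      rw [hR.inner_eq hω p.1, hR.inner_eq hω (R.symm _), R.apply_symm_apply, join_two]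
      simp
      ring
    rw [wave, h1, h2, pker, he]
    have h3 : Complex.exp (Complex.I * ((lam * ⟪ω, p.2⟫ + R p.1 2 * ξ + lam / 2 * twist w x.1
          - x.2 * ξ - ⟪lam • ω, Z⟫ : ℝ) : ℂ))
        = Complex.exp (Complex.I * (lam * ⟪ω, p.2⟫ : ℝ))
          * Complex.exp (Complex.I * (R p.1 2 * ξ : ℝ))
          * Complex.exp (Complex.I * (lam / 2 * twist w x.1 : ℝ))
          * Complex.exp (-Complex.I * (x.2 * ξ : ℝ))
          * Complex.exp (-Complex.I * (⟪lam • ω, Z⟫ : ℝ)) := by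
      rw [← Complex.exp_add, ← Complex.exp_add, ← Complex.exp_add, ← Complex.exp_add]
      congr 1
      push_cast
      ring
    rw [h3]
    ring
  have hint : Integrable fun q : G => ((lam / (2 * Real.pi) : ℝ) : ℂ)
      * (f q * wave ω lam k ξ (gmul (-q) p)) := by
    refine (f.integrable.mul_bdd (c := 1) (continuous_wave continuous_const continuous_const k
      continuous_const (by fun_prop)).aestronglyMeasurable
      (Eventually.of_forall fun q => norm_wave_le hω hlam k ξ _)).const_mul _
  rw [coeff_eq, ← integral_const_mul]
  have h1 := integral_prod (μ := (volume : Measure V)) (ν := (volume : Measure V)) _ hint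
  rw [show (volume : Measure G) = (volume : Measure V).prod volume from rfl, h1,
    integral_eq_integral_join R (Integrable.integral_prod_left (μ := (volume : Measure V))
      (ν := (volume : Measure V)) hint)]
  simp_rw [key, integral_const_mul]
  rfl

/-- The strict inequality ensures `λ > 0`, so that the abstract projection is the kernel operator.
The right side no longer involves the rotation. -/
lemma spectralIntegrand_eq {R : S → V ≃ₗᵢ[ℝ] V}
    (hR : ∀ ω : S, IsAdaptedRotation (ω : V) (R ω)) (f : 𝓢(G, ℂ)) {μ ξ : ℝ} (h : ξ ^ 2 < μ)
    (p : G) (ω : S) (k : ℕ) :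
    spectralIntegrand R μ f p ω k ξ
      = ((((2 * k + 1 : ℝ) ^ 3)⁻¹ * (μ - ξ ^ 2) ^ 2 : ℝ) : ℂ)
        * coeff f ω ((μ - ξ ^ 2) / (2 * k + 1)) k ξ p := by
  have hω : ‖(ω : V)‖ = 1 := norm_eq_of_mem_sphere ω
  have hlam : 0 < (μ - ξ ^ 2) / (2 * k + 1) := div_pos (by linarith) (by positivity)
  obtain ⟨C, hC⟩ := exists_planeDecay_fiber f (((μ - ξ ^ 2) / (2 * k + 1)) • (ω : V)) (R ω) ξ
  rw [coeff_eq_proj f hω (hR ω) hlam.le]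
  simp only [spectralIntegrand]
  rw [← Lam_eq_proj k hlam hC]
  push_cast
  simp only [fiber, planePart]
  ring

end FreeTwoStep
end

noncomputable section
namespace FreeTwoStep
open Filter Topology

/-! ### Fourier inversion and the Plancherel formula -/

section Fourier
open FourierTransform

variable {E : Type*} [NormedAddCommGroup E] [InnerProductSpace ℝ E] [FiniteDimensional ℝ E]
  [MeasurableSpace E] [BorelSpace E]

lemma integral_phase_eq_fourier (g : E → ℂ) (ν : E) :
    ∫ Z, Complex.exp (-Complex.I * (⟪ν, Z⟫ : ℝ)) * g Z = 𝓕 g ((2 * Real.pi)⁻¹ • ν) := by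
  rw [Real.fourier_eq']
  refine integral_congr_ae (Eventually.of_forall fun Z => ?_)
  simp only [smul_eq_mul, inner_smul_right]
  rw [real_inner_comm]
  congr 2
  have : (Real.pi : ℂ) ≠ 0 := by exact_mod_cast Real.pi_ne_zero
  push_cast
  field_simp

lemma integral_phase_eq_fourier_neg (h : E → ℂ) (Z : E) :
    ∫ ν, Complex.exp (Complex.I * (⟪ν, Z⟫ : ℝ)) * h ν = 𝓕 h (-(2 * Real.pi)⁻¹ • Z) := by
  have := integral_phase_eq_fourier h (-Z)
  rw [smul_neg, ← neg_smul] at this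
  rw [← this]
  refine integral_congr_ae (Eventually.of_forall fun ν => ?_)
  simp only [inner_neg_left]
  rw [real_inner_comm]
  push_cast
  rw [neg_mul_neg]

/-- Fourier inversion with the phase `exp (-i ν(Z))`. -/
lemma fourier_inversion {g : E → ℂ} (hc : Continuous g) (hg : Integrable g)
    (hh : Integrable fun ν => ∫ Z, Complex.exp (-Complex.I * (⟪ν, Z⟫ : ℝ)) * g Z) (Z : E) :
    ∫ ν, Complex.exp (Complex.I * (⟪ν, Z⟫ : ℝ)) *
        (∫ Z, Complex.exp (-Complex.I * (⟪ν, Z⟫ : ℝ)) * g Z)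
      = (((2 * Real.pi) ^ Module.finrank ℝ E : ℝ) : ℂ) * g Z := by
  have hpi : (0 : ℝ) < 2 * Real.pi := by positivity
  simp only [integral_phase_eq_fourier] at hh ⊢
  have hF : Integrable (𝓕 g) := by
    have := hh.comp_smul hpi.ne'
    refine this.congr (Eventually.of_forall fun ν => ?_)
    simp only [smul_smul, inv_mul_cancel₀ hpi.ne', one_smul]
  have h1 := congrFun (hc.fourierInv_fourier_eq hg hF) Z
  rw [Real.fourierInv_eq'] at h1
  -- Dilation by `2π` converts between the phases `exp(iν(Z))` and `exp(2πi⟨ν, Z⟩)`; its Jacobian is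
  -- the power of `2π` in the result.
  have h2 := Measure.integral_comp_smul (volume : Measure E)
    (fun ν => Complex.exp (Complex.I * (⟪ν, Z⟫ : ℝ)) * 𝓕 g ((2 * Real.pi)⁻¹ • ν)) (2 * Real.pi)
  have h3 : ∀ ν : E, Complex.exp (Complex.I * (⟪(2 * Real.pi) • ν, Z⟫ : ℝ))
      * 𝓕 g ((2 * Real.pi)⁻¹ • (2 * Real.pi) • ν)
      = Complex.exp (((2 * Real.pi * ⟪ν, Z⟫ : ℝ) : ℂ) * Complex.I) • 𝓕 g ν := by
    intro ν
    rw [smul_smul, inv_mul_cancel₀ hpi.ne', one_smul, inner_smul_left, smul_eq_mul, mul_comm Complex.I]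
    simp
  simp only [h3] at h2
  rw [h1, abs_of_pos (by positivity)] at h2
  rw [h2, Complex.real_smul, ← mul_assoc, ← Complex.ofReal_mul, mul_inv_cancel₀ (by positivity),
    Complex.ofReal_one, one_mul]

lemma continuous_fourier {h : E → ℂ} (hi : Integrable h) : Continuous (𝓕 h) :=
  VectorFourier.fourierIntegral_continuous Real.continuous_fourierChar
    (by exact continuous_inner) hi

/-- The Fourier transform on `L²` and the integral agree when tested against smooth compactly
supported functions, since in both cases the transform can be moved to the test function. -/
lemma coeFn_fourier_toLp {h : E → ℂ} (hi : Integrable h) (h2 : MemLp h 2 volume) :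
    (𝓕 (h2.toLp h) : Lp ℂ 2 (volume : Measure E)) =ᵐ[volume] 𝓕 h := by
  have hcont : Continuous (𝓕 h) := continuous_fourier hi
  have hLp : LocallyIntegrable (𝓕 (h2.toLp h) : Lp ℂ 2 (volume : Measure E)) volume :=
    (Lp.memLp _).locallyIntegrable (by norm_num)
  refine ae_eq_of_integral_contDiff_smul_eq hLp hcont.locallyIntegrable fun g hg hgs => ?_
  have hgs' : HasCompactSupport (fun x => (g x : ℂ)) := hgs.comp_left (g := fun t : ℝ => (t : ℂ)) rfl
  set φ : 𝓢(E, ℂ) := hgs'.toSchwartzMap (Complex.ofRealCLM.contDiff.comp hg) with hφ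
  have hφa : ∀ x, φ x = (g x : ℂ) := fun x => rfl
  have e1 := congrArg (fun T => T φ) (Lp.fourier_toTemperedDistribution_eq (h2.toLp h))
  simp only [TemperedDistribution.fourier_apply, Lp.toTemperedDistribution_apply] at e1
  have e2 : ∫ x, (𝓕 φ) x • (h2.toLp h) x = ∫ x, (𝓕 φ) x • h x :=
    integral_congr_ae (h2.coeFn_toLp.mono fun x hx => by simp only [hx])
  rw [e2] at e1
  have e3 := VectorFourier.integral_fourierIntegral_smul_eq_flip (μ := (volume : Measure E))
    (ν := (volume : Measure E)) (L := innerₗ E) (f := φ) (g := h) Real.continuous_fourierChar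
    (by exact continuous_inner) φ.integrable hi
  have e4 : ∫ x, (𝓕 φ) x • h x = ∫ x, φ x • 𝓕 h x := by
    rw [SchwartzMap.fourier_coe]
    refine e3.trans ?_
    rw [flip_innerₗ]
    rfl
  rw [e4] at e1
  simp only [hφa, smul_eq_mul] at e1
  simp only [Complex.real_smul]
  exact e1.symm

lemma lintegral_fourier_sq {h : E → ℂ} (hi : Integrable h) (h2 : MemLp h 2 volume) :
    ∫⁻ x, ‖𝓕 h x‖ₑ ^ 2 = ∫⁻ x, ‖h x‖ₑ ^ 2 := by
  have h3 := lintegral_enorm_sq_eq (𝓕 (h2.toLp h) : Lp ℂ 2 (volume : Measure E))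
  have h4 := lintegral_enorm_sq_eq (h2.toLp h)
  rw [Lp.norm_fourier_eq, ← h4] at h3
  have h5 : ∫⁻ x, ‖h2.toLp h x‖ₑ ^ 2 = ∫⁻ x, ‖h x‖ₑ ^ 2 :=
    lintegral_congr_ae (h2.coeFn_toLp.mono fun x hx => by beta_reduce; rw [hx])
  have h6 : ∫⁻ x, ‖(𝓕 (h2.toLp h) : Lp ℂ 2 (volume : Measure E)) x‖ₑ ^ 2 = ∫⁻ x, ‖𝓕 h x‖ₑ ^ 2 :=
    lintegral_congr_ae ((coeFn_fourier_toLp hi h2).mono fun x hx => by beta_reduce; rw [hx])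
  rw [← h6, h3, h5]

lemma lintegral_comp_smul_eq {F : E → ENNReal} (hF : Measurable F) {r : ℝ} (hr : r ≠ 0) :
    ∫⁻ x, F (r • x) = ENNReal.ofReal |(r ^ Module.finrank ℝ E)⁻¹| * ∫⁻ x, F x := by
  rw [← lintegral_map hF (measurable_const_smul r), Measure.map_addHaar_smul _ hr,
    lintegral_smul_measure, smul_eq_mul]

/-- The Plancherel formula with the phase `exp (i ν(Z))`. -/
lemma lintegral_phase_sq {h : E → ℂ} (hi : Integrable h) (h2 : MemLp h 2 volume) :
    ∫⁻ Z, ‖∫ ν, Complex.exp (Complex.I * (⟪ν, Z⟫ : ℝ)) * h ν‖ₑ ^ 2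
      = ENNReal.ofReal ((2 * Real.pi) ^ Module.finrank ℝ E) * ∫⁻ ν, ‖h ν‖ₑ ^ 2 := by
  have hpi : (0 : ℝ) < 2 * Real.pi := by positivity
  have hcont : Continuous (𝓕 h) := continuous_fourier hi
  simp only [integral_phase_eq_fourier_neg]
  rw [lintegral_comp_smul_eq (F := fun x => ‖𝓕 h x‖ₑ ^ 2) (by fun_prop)
    (neg_ne_zero.2 (inv_ne_zero hpi.ne')), lintegral_fourier_sq hi h2]
  congr 2
  rw [abs_inv, abs_pow, abs_neg, abs_of_pos (by positivity), inv_pow, inv_inv]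

end Fourier

end FreeTwoStep
end

noncomputable section
namespace FreeTwoStep
open Filter Topology

/-! ### The spectral integral -/

/-- The summable factor in the bound for the coefficients. -/
def kfac (lam : ℝ) (k : ℕ) : ℝ := lam * ((1 + lam * (2 * k + 1)) ^ 2)⁻¹

lemma kfac_nonneg {lam : ℝ} (hlam : 0 ≤ lam) (k : ℕ) : 0 ≤ kfac lam k := by
  unfold kfac
  positivity

/-- Telescoping against `1/(1 + 2λk)`. The bound is uniform in `λ`, so nothing blows up as `λ → 0`
although the eigenvalues become dense. -/
lemma sum_kfac_le {lam : ℝ} (hlam : 0 ≤ lam) (n : ℕ) : ∑ k ∈ Finset.range n, kfac lam k ≤ 1 := by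
  have h1 : ∀ k : ℕ, kfac lam k
      ≤ (1 + lam * (2 * k))⁻¹ - (1 + lam * (2 * (k + 1 : ℕ)))⁻¹ := by
    intro k
    have ha : 0 < 1 + lam * (2 * k) := by positivity
    have hb : 0 < 1 + lam * (2 * (k + 1 : ℕ)) := by positivity
    rw [inv_sub_inv ha.ne' hb.ne', kfac, ← div_eq_mul_inv]
    push_cast at hb ⊢
    rw [div_le_div_iff₀ (by positivity) (mul_pos ha hb)]
    nlinarith [mul_nonneg hlam (sq_nonneg (1 + lam * (2 * k + 1))), mul_pos ha hb, sq_nonneg lam,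
      pow_nonneg hlam 3]
  refine (Finset.sum_le_sum fun k _ => h1 k).trans ?_
  rw [Finset.sum_range_sub' (fun k : ℕ => (1 + lam * (2 * k))⁻¹)]
  have : 0 ≤ (1 + lam * (2 * n))⁻¹ := by positivity
  simp only [Nat.cast_zero, mul_zero, add_zero, inv_one]
  linarith

lemma summable_kfac {lam : ℝ} (hlam : 0 ≤ lam) : Summable (kfac lam) :=
  summable_of_sum_range_le (kfac_nonneg hlam) (sum_kfac_le hlam)

lemma tsum_kfac_le {lam : ℝ} (hlam : 0 ≤ lam) : ∑' k, kfac lam k ≤ 1 :=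
  Real.tsum_le_of_sum_range_le (kfac_nonneg hlam) (sum_kfac_le hlam)

/-- A bound for the coefficients which is uniformly summable in `k` and integrable in `ξ`. -/
lemma exists_norm_coeff_le_kfac (f : 𝓢(G, ℂ)) : ∃ C : ℝ, 0 ≤ C ∧
    ∀ (ω : V) (_ : ‖ω‖ = 1) (lam : ℝ) (_ : 0 ≤ lam) (k : ℕ) (ξ : ℝ) (p : G),
      ‖coeff f ω lam k ξ p‖ ≤ C * ((1 + lam) ^ 4)⁻¹ * (kfac lam k * (1 + ξ ^ 2)⁻¹) := by
  -- `7 = 2 + 4 + 1`: two powers for the sum over `k`, four for integrability over `ν ∈ ℝ³`, one for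
  -- the integral over `ξ`.
  obtain ⟨C, hC, h⟩ := exists_norm_coeff_le f 7
  refine ⟨C, hC, fun ω hω lam hlam k ξ p => ?_⟩
  have h1 := h ω hω lam hlam k ξ p
  set x := lam * (2 * k + 1) with hx
  have hx0 : 0 ≤ x := by positivity
  have hx1 : lam ≤ x := le_mul_of_one_le_right hlam (by linarith [(Nat.cast_nonneg k : (0 : ℝ) ≤ k)])
  have h2 : (1 + x) ^ 2 * (1 + lam) ^ 4 * (1 + ξ ^ 2) ≤ (1 + (x + ξ ^ 2)) ^ 7 := by
    rw [show (1 + (x + ξ ^ 2)) ^ 7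
      = (1 + (x + ξ ^ 2)) ^ 2 * (1 + (x + ξ ^ 2)) ^ 4 * (1 + (x + ξ ^ 2)) by ring]
    have := sq_nonneg ξ
    gcongr <;> linarith
  have h3 : ((1 + x) ^ 2 * (1 + lam) ^ 4 * (1 + ξ ^ 2)) * ‖coeff f ω lam k ξ p‖ ≤ C * lam :=
    (mul_le_mul_of_nonneg_right h2 (norm_nonneg _)).trans h1
  rw [← le_div_iff₀' (by positivity)] at h3
  refine h3.trans (le_of_eq ?_)
  rw [kfac, ← hx]
  field_simp

/-- The integrand of the spectral integral in the variables `(ω, k, ξ)` and `lam`. -/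
def radial (f : G → ℂ) (p : G) (x : S × ℕ × ℝ) (lam : ℝ) : ℂ :=
  if 0 < lam then ((lam ^ 2 : ℝ) : ℂ) * coeff f x.1 |lam| x.2.1 x.2.2 p else 0

/-- The integrand of `𝒫_μ f (p)` in the variables `(ω, k, ξ)`. -/
def density (f : G → ℂ) (p : G) (μ : ℝ) (x : S × ℕ × ℝ) : ℂ :=
  (((2 * x.2.1 + 1 : ℝ)⁻¹ : ℝ) : ℂ) * radial f p x ((μ - x.2.2 ^ 2) / (2 * x.2.1 + 1))

lemma measurable_radial {α : Type*} [MeasurableSpace α] (f : 𝓢(G, ℂ)) {p : α → G}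
    {x : α → S × ℕ × ℝ} {lam : α → ℝ} (hp : Measurable p) (hx : Measurable x)
    (hlam : Measurable lam) : Measurable fun a => radial f (p a) (x a) (lam a) := by
  unfold radial
  refine Measurable.ite (measurableSet_lt measurable_const hlam) (Measurable.mul (by fun_prop) ?_)
    measurable_const
  exact measurable_coeff f hx.fst hlam hx.snd.fst hx.snd.snd hp

lemma measurable_density {α : Type*} [MeasurableSpace α] (f : 𝓢(G, ℂ)) {p : α → G}
    {x : α → S × ℕ × ℝ} {μ : α → ℝ} (hp : Measurable p) (hx : Measurable x)
    (hμ : Measurable μ) : Measurable fun a => density f (p a) (μ a) (x a) := by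
  have h1 : Measurable fun a => (((x a).2.1 : ℕ) : ℝ) :=
    (measurable_from_top (f := fun n : ℕ => (n : ℝ))).comp hx.snd.fst
  have h2 : Measurable fun a => (x a).2.2 := hx.snd.snd
  unfold density
  exact Measurable.mul (by fun_prop) (measurable_radial f hp hx (by fun_prop))

lemma density_eq_zero (f : G → ℂ) (p : G) {μ : ℝ} {x : S × ℕ × ℝ} (h : μ ≤ x.2.2 ^ 2) :
    density f p μ x = 0 := by
  have : ¬ 0 < (μ - x.2.2 ^ 2) / (2 * x.2.1 + 1) := by
    rw [not_lt]
    exact div_nonpos_of_nonpos_of_nonneg (by linarith) (by positivity)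
  rw [density, radial, if_neg this, mul_zero]

/-- Origin of the weight in `𝒫_μ`: the Jacobian `(2k+1)⁻¹` of `μ ↦ λ` times the polar density `λ²`
is `(2k+1)⁻³ (μ - ξ²)²`. -/
lemma density_eq (f : G → ℂ) (p : G) {μ : ℝ} {x : S × ℕ × ℝ} (h : x.2.2 ^ 2 < μ) :
    density f p μ x = ((((2 * x.2.1 + 1 : ℝ) ^ 3)⁻¹ * (μ - x.2.2 ^ 2) ^ 2 : ℝ) : ℂ)
      * coeff f x.1 ((μ - x.2.2 ^ 2) / (2 * x.2.1 + 1)) x.2.1 x.2.2 p := by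
  have h0 : (0 : ℝ) < 2 * x.2.1 + 1 := by positivity
  have : 0 < (μ - x.2.2 ^ 2) / (2 * x.2.1 + 1) := div_pos (by linarith) h0
  rw [density, radial, if_pos this, abs_of_pos this, ← mul_assoc, ← Complex.ofReal_mul]
  congr 2
  field_simp

/-- The measure `dω ⊗ (counting measure) ⊗ dξ`. -/
def paramMeasure : Measure (S × ℕ × ℝ) :=
  (volume : Measure V).toSphere.prod (Measure.count.prod volume)

instance : SigmaFinite paramMeasure := by
  unfold paramMeasure
  infer_instance

lemma summable_odd_pow (n : ℕ) (hn : 1 < n) : Summable fun k : ℕ => ((2 * k + 1 : ℝ) ^ n)⁻¹ := by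
  have h1 : Summable fun k : ℕ => (((k + 1 : ℕ) : ℝ) ^ n)⁻¹ := by
    have := (summable_nat_add_iff (f := fun k : ℕ => 1 / (k : ℝ) ^ n) 1).2
      (Real.summable_one_div_nat_pow.2 hn)
    simpa [one_div] using this
  refine Summable.of_nonneg_of_le (fun k => by positivity) (fun k => ?_) h1
  push_cast
  gcongr
  linarith [(Nat.cast_nonneg k : (0 : ℝ) ≤ k)]

lemma integrable_odd_pow (n : ℕ) (hn : 1 < n) :
    Integrable (fun k : ℕ => ((2 * k + 1 : ℝ) ^ n)⁻¹) Measure.count := by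
  rw [integrable_count_iff]
  refine (summable_odd_pow n hn).congr fun k => ?_
  rw [Real.norm_of_nonneg (by positivity)]

/-- The integrable majorant in the variables `(ω, k, ξ)`. -/
def majorant (x : S × ℕ × ℝ) : ℝ := ((2 * x.2.1 + 1 : ℝ) ^ 2)⁻¹ * (1 + x.2.2 ^ 2)⁻¹

lemma majorant_nonneg (x : S × ℕ × ℝ) : 0 ≤ majorant x := by
  unfold majorant
  positivity

lemma integrable_majorant : Integrable majorant paramMeasure := by
  have h1 := (integrable_odd_pow 2 (by norm_num)).mul_prod integrable_inv_one_add_sq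
  have h2 := (integrable_const (1 : ℝ)).mul_prod h1 (μ := (volume : Measure V).toSphere)
  refine h2.congr (Eventually.of_forall fun x => ?_)
  simp only [majorant, one_mul]

lemma exists_norm_density_le (f : 𝓢(G, ℂ)) : ∃ C : ℝ, 0 ≤ C ∧ ∀ (p : G) (μ : ℝ) (x : S × ℕ × ℝ),
    ‖density f p μ x‖ ≤ C * ((1 + |μ|) ^ 2)⁻¹ * majorant x := by
  -- `6 = 3 + 2 + 1`: three powers absorb `(μ - ξ²)³`, two give the decay in `μ`, and one gives `(1
  -- + ξ²)⁻¹` because `ξ² < μ`.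
  obtain ⟨C, hC, h⟩ := exists_norm_coeff_le f 6
  refine ⟨C, hC, fun p μ x => ?_⟩
  have hm := majorant_nonneg x
  rcases le_or_gt μ (x.2.2 ^ 2) with h1 | h1
  · rw [density_eq_zero _ _ h1, norm_zero]
    positivity
  · have hk : (0 : ℝ) ≤ x.2.1 := Nat.cast_nonneg _
    have h0 : (0 : ℝ) < 2 * x.2.1 + 1 := by positivity
    have hμ : 0 < μ := lt_of_le_of_lt (sq_nonneg _) h1
    set d := μ - x.2.2 ^ 2 with hd
    have hd0 : 0 < d := by linarith
    have hdμ : d ≤ μ := by linarith [sq_nonneg x.2.2]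
    have h2 := h x.1 (norm_eq_of_mem_sphere x.1) (d / (2 * x.2.1 + 1)) (by positivity) x.2.1 x.2.2 p
    rw [div_mul_cancel₀ _ h0.ne', hd, sub_add_cancel, ← hd] at h2
    rw [density_eq _ _ h1, norm_mul, Complex.norm_real, Real.norm_of_nonneg (by positivity),
      abs_of_pos hμ, ← hd, majorant]
    have h3 : ‖coeff f x.1 (d / (2 * x.2.1 + 1)) x.2.1 x.2.2 p‖
        ≤ C * (d / (2 * x.2.1 + 1)) / (1 + μ) ^ 6 := by
      rw [le_div_iff₀' (by positivity)]
      exact h2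
    calc _ ≤ (((2 * x.2.1 + 1 : ℝ) ^ 3)⁻¹ * d ^ 2) * (C * (d / (2 * x.2.1 + 1)) / (1 + μ) ^ 6) := by
          gcongr
      _ = C * (d ^ 3 / (1 + μ) ^ 6) * ((2 * x.2.1 + 1 : ℝ) ^ 4)⁻¹ := by field_simp
      _ ≤ C * (((1 + μ) ^ 2)⁻¹ * (1 + x.2.2 ^ 2)⁻¹) * ((2 * x.2.1 + 1 : ℝ) ^ 2)⁻¹ := by
          gcongr ?_ * ?_ * ?_
          · rw [← mul_inv, div_le_iff₀ (by positivity), ← div_eq_inv_mul,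
              le_div_iff₀ (by positivity)]
            calc d ^ 3 * ((1 + μ) ^ 2 * (1 + x.2.2 ^ 2))
                ≤ (1 + μ) ^ 3 * ((1 + μ) ^ 2 * (1 + μ)) := by
                  gcongr
                  linarith
              _ = (1 + μ) ^ 6 := by ring
          · exact inv_anti₀ (by positivity) (pow_le_pow_right₀ (by linarith) (by norm_num))
      _ = _ := by ring

lemma integrable_density (f : 𝓢(G, ℂ)) (p : G) (μ : ℝ) :
    Integrable (density f p μ) paramMeasure := by
  obtain ⟨C, hC, h⟩ := exists_norm_density_le f
  exact (integrable_majorant.const_mul _).mono'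
    (measurable_density f measurable_const measurable_id measurable_const).aestronglyMeasurable
    (Eventually.of_forall (h p μ))

lemma paramMeasure_restrict (I : Set ℝ) :
    paramMeasure.restrict (univ ×ˢ (univ ×ˢ I)) = (volume : Measure V).toSphere.prod
      (Measure.count.prod (volume.restrict I)) := by
  rw [paramMeasure, ← Measure.prod_restrict, ← Measure.prod_restrict, Measure.restrict_univ,
    Measure.restrict_univ]

lemma sq_lt_of_mem_Ioo {μ ξ : ℝ} (h : ξ ∈ Ioo (-√μ) (√μ)) : ξ ^ 2 < μ :=
  Real.sq_lt.2 h

lemma density_ae_eq_spectralIntegrand {R : S → V ≃ₗᵢ[ℝ] V}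
    (hR : ∀ ω : S, IsAdaptedRotation (ω : V) (R ω)) (f : 𝓢(G, ℂ)) (μ : ℝ) (p : G) :
    density f p μ =ᵐ[(volume : Measure V).toSphere.prod
      (Measure.count.prod (volume.restrict (Ioc (-√μ) (√μ))))]
      fun q => spectralIntegrand R μ f p q.1 q.2.1 q.2.2 := by
  -- The endpoint `ξ = √μ`, where `λ = 0`, is a null set and is discarded.
  have h1 : ∀ᵐ ξ : ℝ ∂volume.restrict (Ioc (-√μ) (√μ)), ξ ^ 2 < μ := by
    rw [← restrict_Ioo_eq_restrict_Ioc]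
    exact (ae_restrict_mem measurableSet_Ioo).mono fun ξ hξ => sq_lt_of_mem_Ioo hξ
  have h2 := Measure.quasiMeasurePreserving_snd (μ := (volume : Measure V).toSphere).ae
    (Measure.quasiMeasurePreserving_snd (μ := (Measure.count : Measure ℕ)).ae h1)
  filter_upwards [h2] with q hq
  rw [density_eq _ _ hq, spectralIntegrand_eq hR f hq]

/-- Absolute convergence of the formula for `𝒫_μ f`. -/
lemma integrable_spectralIntegrand {R : S → V ≃ₗᵢ[ℝ] V}
    (hR : ∀ ω : S, IsAdaptedRotation (ω : V) (R ω)) (f : 𝓢(G, ℂ)) (μ : ℝ) (p : G) :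
    Integrable (fun q : S × ℕ × ℝ => spectralIntegrand R μ f p q.1 q.2.1 q.2.2)
      ((volume : Measure V).toSphere.prod
        (Measure.count.prod (volume.restrict (Ioc (-√μ) (√μ))))) := by
  refine Integrable.congr ?_ (density_ae_eq_spectralIntegrand hR f μ p)
  rw [← paramMeasure_restrict]
  exact (integrable_density f p μ).restrict

lemma integral_count_prod {F : ℕ × ℝ → ℂ} {m : Measure ℝ} [SFinite m]
    (hF : Integrable F (Measure.count.prod m)) :
    ∫ y, F y ∂(Measure.count.prod m) = ∑' k, ∫ ξ, F (k, ξ) ∂m := by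
  rw [integral_prod _ hF, integral_countable hF.integral_prod_left]
  simp [Measure.real]

/-- The constant `(2π)⁻⁴`. -/
def cst : ℂ := ((((2 * Real.pi) ^ 4)⁻¹ : ℝ) : ℂ)

/-- As `density` vanishes unless `ξ² < μ`, the iterated integral is a single integral over a
parameter space independent of `μ`, ready for Fubini. -/
lemma P_eq {R : S → V ≃ₗᵢ[ℝ] V}
    (hR : ∀ ω : S, IsAdaptedRotation (ω : V) (R ω)) (f : 𝓢(G, ℂ)) (μ : ℝ) (p : G) :
    P R μ f p = cst * ∫ x, density f p μ x ∂paramMeasure := by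
  have h1 : ∫ x, density f p μ x ∂paramMeasure
      = ∫ x in univ ×ˢ (univ ×ˢ Ioc (-√μ) (√μ)), density f p μ x ∂paramMeasure := by
    refine (setIntegral_eq_integral_of_forall_compl_eq_zero fun x hx => ?_).symm
    refine density_eq_zero _ _ ?_
    by_contra hlt
    rw [not_le, Real.sq_lt] at hlt
    exact hx ⟨mem_univ _, mem_univ _, hlt.1, hlt.2.le⟩
  have hint := integrable_spectralIntegrand hR f μ p
  rw [h1, paramMeasure_restrict, integral_congr_ae (density_ae_eq_spectralIntegrand hR f μ p),
    integral_prod _ hint, P, cst]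
  congr 1
  refine integral_congr_ae (hint.prod_right_ae.mono fun ω hω => ?_)
  beta_reduce
  rw [integral_count_prod hω]
  simp_rw [intervalIntegral.integral_of_le (neg_le_self (Real.sqrt_nonneg μ))]

end FreeTwoStep
end

noncomputable section
namespace FreeTwoStep
open Filter Topology

/-! ### Integration of the spectral density against a bounded function -/

/-- Integration in polar coordinates. -/
lemma integral_polar {Ψ : V → ℂ} (hΨ : Integrable Ψ) :
    ∫ ν, Ψ ν = ∫ ω : S, (∫ lam in Ioi (0 : ℝ), ((lam ^ 2 : ℝ) : ℂ) * Ψ (lam • (ω : V)))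
      ∂(volume : Measure V).toSphere := by
  have hmp := (volume : Measure V).measurePreserving_homeomorphUnitSphereProd
  have hemb := (homeomorphUnitSphereProd V).measurableEmbedding
  set Φ : S × Ioi (0 : ℝ) → ℂ := fun x => Ψ ((x.2 : ℝ) • (x.1 : V)) with hΦ
  have hcomp : ∀ x : ({0}ᶜ : Set V), Φ (homeomorphUnitSphereProd V x) = Ψ x := by
    intro x
    rw [hΦ]
    beta_reduce
    congr 1
    exact congrArg Subtype.val ((homeomorphUnitSphereProd V).symm_apply_apply x)
  have h1 : ∫ ν, Ψ ν = ∫ x : ({0}ᶜ : Set V), Ψ x ∂((volume : Measure V).comap (↑)) := by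
    rw [integral_subtype_comap (measurableSet_singleton _).compl Ψ, restrict_compl_singleton]
  have h2 := hmp.integral_comp hemb Φ
  have h3 : Integrable Φ ((volume : Measure V).toSphere.prod
      (Measure.volumeIoiPow (Module.finrank ℝ V - 1))) := by
    rw [← hmp.integrable_comp_emb hemb]
    have : Integrable (fun x : ({0}ᶜ : Set V) => Ψ x) ((volume : Measure V).comap (↑)) :=
      (integrableOn_iff_comap_subtypeVal (measurableSet_singleton (0 : V)).compl).1
        hΨ.integrableOn
    exact this.congr (Eventually.of_forall fun x => (hcomp x).symm)
  simp only [hcomp] at h2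
  rw [h1, h2, integral_prod _ h3]
  refine integral_congr_ae (Eventually.of_forall fun ω => ?_)
  simp only [Measure.volumeIoiPow, ENNReal.ofReal, hΦ]
  rw [integral_withDensity_eq_integral_smul,
    integral_subtype_comap measurableSet_Ioi fun a : ℝ =>
      Real.toNNReal (a ^ (Module.finrank ℝ V - 1)) • Ψ (a • (ω : V))]
  · refine setIntegral_congr_fun measurableSet_Ioi fun x hx => ?_
    beta_reduce
    rw [NNReal.smul_def, Real.coe_toNNReal _ (pow_nonneg (le_of_lt hx) _), finrank_V,
      Complex.real_smul]
  · exact (measurable_subtype_coe.pow_const _).real_toNNReal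

/-- The direction of a nonzero vector, as a point of the unit sphere. -/
def dir (ν : V) : S :=
  -- The value at `ν = 0` is an arbitrary unit vector; the uniform bounds thus hold at every `ν`.
  ⟨if ν = 0 then EuclideanSpace.single 0 1 else ‖ν‖⁻¹ • ν, by
    rw [mem_sphere_zero_iff_norm]
    split_ifs with h
    · simp
    · rw [norm_smul, norm_inv, norm_norm, inv_mul_cancel₀ (norm_ne_zero_iff.2 h)]⟩

lemma measurable_dir : Measurable dir := by
  refine Measurable.subtype_mk (Measurable.ite (measurableSet_singleton 0) measurable_const ?_)
  fun_prop

lemma norm_smul_dir (ν : V) : ‖ν‖ • (dir ν : V) = ν := by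
  rcases eq_or_ne ν 0 with h | h
  · simp [h]
  · simp [dir, h]

lemma dir_smul (ω : S) {lam : ℝ} (hlam : 0 < lam) : dir (lam • (ω : V)) = ω := by
  have h0 : ‖(ω : V)‖ = 1 := norm_eq_of_mem_sphere ω
  have h1 : lam • (ω : V) ≠ 0 := by
    rw [← norm_ne_zero_iff, norm_smul, h0]
    simpa using hlam.ne'
  apply Subtype.ext
  simp only [dir, if_neg h1]
  rw [norm_smul, h0, Real.norm_of_nonneg hlam.le, mul_one, smul_smul, inv_mul_cancel₀ hlam.ne',
    one_smul]

lemma norm_dir (ν : V) : ‖(dir ν : V)‖ = 1 := norm_eq_of_mem_sphere _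

/-- The measure `(counting measure) ⊗ dξ`. -/
def spinMeasure : Measure (ℕ × ℝ) := Measure.count.prod volume

instance : SigmaFinite spinMeasure := by
  unfold spinMeasure
  infer_instance

lemma paramMeasure_eq : paramMeasure = (volume : Measure V).toSphere.prod spinMeasure := rfl

/-- The eigenvalue with parameters `(k, ξ)` over the central character `ν`. -/
def eig (ν : V) (y : ℕ × ℝ) : ℝ := ‖ν‖ * (2 * y.1 + 1) + y.2 ^ 2

/-- The integrand of `slice`. -/
def sliceFun (m : ℝ → ℂ) (f : G → ℂ) (ν : V) (p : G) (y : ℕ × ℝ) : ℂ :=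
  m (eig ν y) * coeff f (dir ν) ‖ν‖ y.1 y.2 p

/-- The contribution of the central character `ν` to the operator `m(L)`. -/
def slice (m : ℝ → ℂ) (f : G → ℂ) (ν : V) (p : G) : ℂ := ∫ y, sliceFun m f ν p y ∂spinMeasure

lemma measurable_natCast_real : Measurable fun n : ℕ => (n : ℝ) := measurable_from_top

lemma measurable_sliceFun {α : Type*} [MeasurableSpace α] {m : ℝ → ℂ} (hm : Measurable m)
    (f : 𝓢(G, ℂ)) {ν : α → V} {p : α → G} {y : α → ℕ × ℝ} (hν : Measurable ν) (hp : Measurable p)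
    (hy : Measurable y) : Measurable fun a => sliceFun m f (ν a) (p a) (y a) := by
  have h1 : Measurable fun a => ((y a).1 : ℝ) := measurable_natCast_real.comp hy.fst
  have h2 : Measurable fun a => (y a).2 := hy.snd
  have h3 := measurable_coeff f (measurable_dir.comp hν) hν.norm hy.fst hy.snd hp
  simp only [abs_norm] at h3
  unfold sliceFun eig
  exact (hm.comp (by fun_prop)).mul h3

lemma measurable_slice {α : Type*} [MeasurableSpace α] {m : ℝ → ℂ} (hm : Measurable m)
    (f : 𝓢(G, ℂ)) {ν : α → V} {p : α → G} (hν : Measurable ν) (hp : Measurable p) :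
    Measurable fun a => slice m f (ν a) (p a) := by
  have h : Measurable (Function.uncurry fun (a : α) (y : ℕ × ℝ) => sliceFun m f (ν a) (p a) y) :=
    measurable_sliceFun hm f (hν.comp measurable_fst) (hp.comp measurable_fst) measurable_snd
  exact (h.stronglyMeasurable.integral_prod_right (ν := spinMeasure)).measurable

lemma integrable_kfac_mul {lam : ℝ} (hlam : 0 ≤ lam) :
    Integrable (fun y : ℕ × ℝ => kfac lam y.1 * (1 + y.2 ^ 2)⁻¹) spinMeasure := by
  refine Integrable.mul_prod (f := kfac lam) (g := fun ξ : ℝ => (1 + ξ ^ 2)⁻¹) ?_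
    integrable_inv_one_add_sq
  rw [integrable_count_iff]
  exact (summable_kfac hlam).congr fun k => (Real.norm_of_nonneg (kfac_nonneg hlam k)).symm

lemma integral_kfac_mul_le {lam : ℝ} (hlam : 0 ≤ lam) :
    ∫ y : ℕ × ℝ, kfac lam y.1 * (1 + y.2 ^ 2)⁻¹ ∂spinMeasure ≤ Real.pi := by
  have hs : Integrable (kfac lam) (Measure.count : Measure ℕ) := by
    rw [integrable_count_iff]
    exact (summable_kfac hlam).congr fun k => (Real.norm_of_nonneg (kfac_nonneg hlam k)).symm
  rw [spinMeasure, integral_prod_mul (kfac lam) fun ξ : ℝ => (1 + ξ ^ 2)⁻¹,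
    integral_univ_inv_one_add_sq, integral_countable hs]
  simp only [Measure.real, Measure.count_singleton, ENNReal.toReal_one, one_smul]
  exact mul_le_of_le_one_left Real.pi_pos.le (tsum_kfac_le hlam)

lemma norm_sliceFun_le {m : ℝ → ℂ} (hm1 : ∀ t, ‖m t‖ ≤ 1) (f : 𝓢(G, ℂ)) (ν : V) (p : G)
    (y : ℕ × ℝ) : ‖sliceFun m f ν p y‖ ≤ ‖coeff f (dir ν) ‖ν‖ y.1 y.2 p‖ := by
  rw [sliceFun, norm_mul]
  exact mul_le_of_le_one_left (norm_nonneg _) (hm1 _)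

lemma integrable_sliceFun {m : ℝ → ℂ} (hm : Measurable m) (hm1 : ∀ t, ‖m t‖ ≤ 1)
    (f : 𝓢(G, ℂ)) (ν : V) (p : G) : Integrable (sliceFun m f ν p) spinMeasure := by
  obtain ⟨C, hC, h⟩ := exists_norm_coeff_le_kfac f
  exact ((integrable_kfac_mul (norm_nonneg ν)).const_mul _).mono'
    (measurable_sliceFun hm f measurable_const measurable_const measurable_id).aestronglyMeasurable
    (Eventually.of_forall fun y => (norm_sliceFun_le hm1 f ν p y).trans
      (h _ (norm_dir ν) _ (norm_nonneg ν) y.1 y.2 p))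

lemma exists_norm_slice_le (f : 𝓢(G, ℂ)) : ∃ C : ℝ, 0 ≤ C ∧ ∀ (m : ℝ → ℂ) (_ : ∀ t, ‖m t‖ ≤ 1)
    (ν : V) (p : G), ‖slice m f ν p‖ ≤ C * ((1 + ‖ν‖) ^ 4)⁻¹ := by
  obtain ⟨C, hC, h⟩ := exists_norm_coeff_le_kfac f
  refine ⟨C * Real.pi, by positivity, fun m hm1 ν p => ?_⟩
  refine (norm_integral_le_of_norm_le ((integrable_kfac_mul (norm_nonneg ν)).const_mul
    (C * ((1 + ‖ν‖) ^ 4)⁻¹)) (Eventually.of_forall fun y => (norm_sliceFun_le hm1 f ν p y).trans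
      (h _ (norm_dir ν) _ (norm_nonneg ν) y.1 y.2 p))).trans ?_
  rw [integral_const_mul, mul_right_comm]
  gcongr
  exact integral_kfac_mul_le (norm_nonneg ν)

lemma integrable_slice {m : ℝ → ℂ} (hm : Measurable m) (hm1 : ∀ t, ‖m t‖ ≤ 1) (f : 𝓢(G, ℂ))
    (p : G) : Integrable fun ν => slice m f ν p := by
  obtain ⟨C, hC, h⟩ := exists_norm_slice_le f
  exact (integrable_weight_V.const_mul C).mono'
    (measurable_slice hm f measurable_id measurable_const).aestronglyMeasurable
    (Eventually.of_forall fun ν => h m hm1 ν p)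

lemma exists_norm_radial_le (f : 𝓢(G, ℂ)) : ∃ C : ℝ, 0 ≤ C ∧ ∀ (p : G) (x : S × ℕ × ℝ) (lam : ℝ),
    ‖radial f p x lam‖ ≤ C * majorant x * ((1 + |lam|) ^ 2)⁻¹ := by
  obtain ⟨C, hC, h⟩ := exists_norm_coeff_le_kfac f
  refine ⟨C, hC, fun p x lam => ?_⟩
  have hm := majorant_nonneg x
  rw [radial]
  split_ifs with hlam
  · rw [norm_mul, Complex.norm_real, Real.norm_of_nonneg (by positivity), abs_of_pos hlam, majorant]
    have h1 := h x.1 (norm_eq_of_mem_sphere x.1) lam hlam.le x.2.1 x.2.2 p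
    have hk : (0 : ℝ) ≤ x.2.1 := Nat.cast_nonneg _
    have h2 : lam ^ 2 * kfac lam x.2.1 ≤ (1 + lam) * ((2 * x.2.1 + 1 : ℝ) ^ 2)⁻¹ := by
      rw [kfac, ← div_eq_mul_inv, ← div_eq_mul_inv, ← mul_div_assoc,
        div_le_div_iff₀ (by positivity) (by positivity)]
      calc lam ^ 2 * lam * (2 * x.2.1 + 1) ^ 2 = lam * (lam * (2 * x.2.1 + 1)) ^ 2 := by ring
        _ ≤ (1 + lam) * (1 + lam * (2 * x.2.1 + 1)) ^ 2 := by gcongr <;> linarith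
    have h3 : (1 + lam) * ((1 + lam) ^ 4)⁻¹ ≤ ((1 + lam) ^ 2)⁻¹ := by
      rw [← div_eq_mul_inv, ← one_div, div_le_div_iff₀ (by positivity) (by positivity), one_mul]
      calc (1 + lam) * (1 + lam) ^ 2 = (1 + lam) ^ 3 := by ring
        _ ≤ (1 + lam) ^ 4 := pow_le_pow_right₀ (by linarith) (by norm_num)
    calc _ ≤ lam ^ 2 * (C * ((1 + lam) ^ 4)⁻¹ * (kfac lam x.2.1 * (1 + x.2.2 ^ 2)⁻¹)) := by gcongr
      _ = C * ((1 + lam) ^ 4)⁻¹ * (lam ^ 2 * kfac lam x.2.1) * (1 + x.2.2 ^ 2)⁻¹ := by ring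
      _ ≤ C * ((1 + lam) ^ 4)⁻¹ * ((1 + lam) * ((2 * x.2.1 + 1 : ℝ) ^ 2)⁻¹)
          * (1 + x.2.2 ^ 2)⁻¹ := by gcongr
      _ = C * ((1 + lam) * ((1 + lam) ^ 4)⁻¹) * (((2 * x.2.1 + 1 : ℝ) ^ 2)⁻¹
          * (1 + x.2.2 ^ 2)⁻¹) := by ring
      _ ≤ C * ((1 + lam) ^ 2)⁻¹ * (((2 * x.2.1 + 1 : ℝ) ^ 2)⁻¹ * (1 + x.2.2 ^ 2)⁻¹) := by gcongr
      _ = _ := by ring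
  · rw [norm_zero]
    positivity

/-- The spectral integrand in the variables `(ω, k, ξ), lam` weighted by `m`. -/
def weighted (m : ℝ → ℂ) (f : G → ℂ) (p : G) (z : (S × ℕ × ℝ) × ℝ) : ℂ :=
  m (z.2 * (2 * z.1.2.1 + 1) + z.1.2.2 ^ 2) * radial f p z.1 z.2

lemma measurable_weighted {m : ℝ → ℂ} (hm : Measurable m) (f : 𝓢(G, ℂ)) (p : G) :
    Measurable (weighted m f p) := by
  have h1 : Measurable fun z : (S × ℕ × ℝ) × ℝ => (z.1.2.1 : ℝ) :=
    measurable_natCast_real.comp measurable_fst.snd.fst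
  unfold weighted
  exact (hm.comp (by fun_prop)).mul
    (measurable_radial f measurable_const measurable_fst measurable_snd)

lemma integrable_weighted {m : ℝ → ℂ} (hm : Measurable m) (hm1 : ∀ t, ‖m t‖ ≤ 1) (f : 𝓢(G, ℂ))
    (p : G) : Integrable (weighted m f p) (paramMeasure.prod volume) := by
  obtain ⟨C, hC, h⟩ := exists_norm_radial_le f
  refine ((integrable_majorant.const_mul C).mul_prod integrable_weight_real).mono'
    (measurable_weighted hm f p).aestronglyMeasurable (Eventually.of_forall fun z => ?_)
  rw [weighted, norm_mul]
  exact (mul_le_of_le_one_left (norm_nonneg _) (hm1 _)).trans (h p z.1 z.2)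

/-- The substitution `μ = λ(2k+1) + ξ²` for fixed `(ω, k, ξ)`, whose Jacobian cancels the factor
`(2k+1)⁻¹` in `density`. -/
lemma integral_mul_density (m : ℝ → ℂ) (f : G → ℂ) (p : G) (x : S × ℕ × ℝ) :
    ∫ μ, m μ * density f p μ x = ∫ lam, weighted m f p (x, lam) := by
  have h0 : (0 : ℝ) < 2 * x.2.1 + 1 := by positivity
  have h1 : ∀ μ, m μ * density f p μ x = (((2 * x.2.1 + 1 : ℝ)⁻¹ : ℝ) : ℂ)
      * weighted m f p (x, (μ - x.2.2 ^ 2) / (2 * x.2.1 + 1)) := by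
    intro μ
    simp only [weighted, density]
    rw [div_mul_cancel₀ _ h0.ne', sub_add_cancel]
    ring
  simp_rw [h1]
  rw [integral_const_mul, integral_sub_right_eq_self
    (fun μ => weighted m f p (x, μ / (2 * x.2.1 + 1))), Measure.integral_comp_div
    (fun lam => weighted m f p (x, lam)), abs_of_pos h0, Complex.real_smul, ← mul_assoc,
    ← Complex.ofReal_mul, inv_mul_cancel₀ h0.ne', Complex.ofReal_one, one_mul]

lemma integrable_mul_density {m : ℝ → ℂ} (hm : Measurable m) (hm1 : ∀ t, ‖m t‖ ≤ 1)
    (f : 𝓢(G, ℂ)) (p : G) :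
    Integrable (fun z : ℝ × (S × ℕ × ℝ) => m z.1 * density f p z.1 z.2)
      ((volume : Measure ℝ).prod paramMeasure) := by
  obtain ⟨C, hC, h⟩ := exists_norm_density_le f
  refine ((integrable_weight_real.const_mul C).mul_prod integrable_majorant).mono'
    ((hm.comp measurable_fst).mul (measurable_density f measurable_const measurable_snd
      measurable_fst)).aestronglyMeasurable (Eventually.of_forall fun z => ?_)
  rw [norm_mul]
  exact (mul_le_of_le_one_left (norm_nonneg _) (hm1 _)).trans (h p z.1 z.2)

lemma integral_weighted_spin (m : ℝ → ℂ) (f : G → ℂ) (p : G) (ω : S) (lam : ℝ) :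
    ∫ y, weighted m f p ((ω, y), lam) ∂spinMeasure
      = (Ioi (0 : ℝ)).indicator (fun lam => ((lam ^ 2 : ℝ) : ℂ) * slice m f (lam • (ω : V)) p)
        lam := by
  have h0 : ‖(ω : V)‖ = 1 := norm_eq_of_mem_sphere ω
  by_cases hlam : 0 < lam
  · rw [indicator_of_mem (mem_Ioi.2 hlam), slice, ← integral_const_mul]
    refine integral_congr_ae (Eventually.of_forall fun y => ?_)
    simp only [weighted, radial, if_pos hlam, sliceFun, eig, dir_smul ω hlam, norm_smul, h0,
      Real.norm_eq_abs, abs_of_pos hlam, mul_one]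
    ring
  · rw [indicator_of_notMem (by simpa using hlam)]
    simp [weighted, radial, if_neg hlam]

lemma integrable_weighted_section {m : ℝ → ℂ} (hm : Measurable m) (hm1 : ∀ t, ‖m t‖ ≤ 1)
    (f : 𝓢(G, ℂ)) (p : G) (ω : S) :
    Integrable (fun z : (ℕ × ℝ) × ℝ => weighted m f p ((ω, z.1), z.2))
      (spinMeasure.prod volume) := by
  obtain ⟨C, hC, h⟩ := exists_norm_radial_le f
  have h1 := ((integrable_odd_pow 2 (by norm_num)).mul_prod integrable_inv_one_add_sq).const_mul C
  refine (Integrable.mul_prod (μ := spinMeasure) h1 integrable_weight_real).mono'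
    ((measurable_weighted hm f p).comp (by fun_prop)).aestronglyMeasurable
    (Eventually.of_forall fun z => ?_)
  rw [weighted, norm_mul]
  exact (mul_le_of_le_one_left (norm_nonneg _) (hm1 _)).trans (h p (ω, z.1) z.2)

variable {R : S → V ≃ₗᵢ[ℝ] V}

lemma indicator_mul_P (hR : ∀ ω : S, IsAdaptedRotation (ω : V) (R ω)) (m : ℝ → ℂ) (f : 𝓢(G, ℂ))
    (p : G) (μ : ℝ) :
    (Ioi (0 : ℝ)).indicator (fun μ => m μ * P R μ f p) μ
      = cst * ∫ x, m μ * density f p μ x ∂paramMeasure := by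
  by_cases hμ : 0 < μ
  · rw [indicator_of_mem (mem_Ioi.2 hμ), P_eq hR, integral_const_mul]
    ring
  · rw [indicator_of_notMem (by simpa using hμ)]
    have : ∀ x, density f p μ x = 0 := fun x =>
      density_eq_zero _ _ ((not_lt.1 hμ).trans (sq_nonneg _))
    simp [this]

lemma integrableOn_mul_P (hR : ∀ ω : S, IsAdaptedRotation (ω : V) (R ω)) {m : ℝ → ℂ}
    (hm : Measurable m) (hm1 : ∀ t, ‖m t‖ ≤ 1) (f : 𝓢(G, ℂ)) (p : G) :
    IntegrableOn (fun μ => m μ * P R μ f p) (Ioi 0) := by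
  rw [← integrable_indicator_iff measurableSet_Ioi]
  refine ((integrable_mul_density hm hm1 f p).integral_prod_left.const_mul cst).congr
    (Eventually.of_forall fun μ => (indicator_mul_P hR m f p μ).symm)

/-- The operator `m(L)` in terms of the central characters. -/
lemma integral_mul_P (hR : ∀ ω : S, IsAdaptedRotation (ω : V) (R ω)) {m : ℝ → ℂ}
    (hm : Measurable m) (hm1 : ∀ t, ‖m t‖ ≤ 1) (f : 𝓢(G, ℂ)) (p : G) :
    ∫ μ in Ioi (0 : ℝ), m μ * P R μ f p = cst * ∫ ν, slice m f ν p := by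
  rw [← integral_indicator measurableSet_Ioi]
  simp_rw [indicator_mul_P hR m f p]
  -- With `μ` innermost it can be traded for `λ`; then `(k, ξ)` is integrated first, and `(ω, λ)`
  -- are polar coordinates of `ν`.
  rw [integral_const_mul, integral_integral_swap (integrable_mul_density hm hm1 f p)]
  congr 1
  simp_rw [integral_mul_density]
  have h1 := (integrable_weighted hm hm1 f p).integral_prod_left
  rw [paramMeasure_eq] at h1 ⊢
  rw [integral_prod _ h1, integral_polar (integrable_slice hm hm1 f p)]
  refine integral_congr_ae (Eventually.of_forall fun ω => ?_)
  beta_reduce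
  rw [integral_integral_swap (integrable_weighted_section hm hm1 f p ω)]
  simp_rw [integral_weighted_spin]
  rw [integral_indicator measurableSet_Ioi]

end FreeTwoStep
end

noncomputable section
namespace FreeTwoStep
open Filter Topology

/-! ### Reconstruction and the Plancherel identity -/

lemma join_planePart (Y : V) : join (planePart Y, Y 2) = Y := by
  apply V_ext <;> rfl

lemma planePart_join (u : Plane) (v : ℝ) : planePart (join (u, v)) = u := by
  ext i
  fin_cases i <;> rfl

lemma memLp_two_of_bounded {α : Type*} [MeasurableSpace α] {μ : Measure α} {h : α → ℂ}
    (hi : Integrable h μ) {C : ℝ} (hC : ∀ x, ‖h x‖ ≤ C) : MemLp h 2 μ := by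
  rw [memLp_two_iff_integrable_sq_norm hi.aestronglyMeasurable]
  refine (hi.norm.const_mul C).mono' (hi.aestronglyMeasurable.norm.pow 2)
    (Eventually.of_forall fun x => ?_)
  rw [Real.norm_of_nonneg (by positivity), pow_two]
  exact mul_le_mul_of_nonneg_right (hC x) (norm_nonneg _)

lemma continuous_centralFT_left (f : 𝓢(G, ℂ)) (X : V) : Continuous fun ν => centralFT f ν X := by
  have h := (continuous_centralFT f).comp (by fun_prop : Continuous fun ν : V => (ν, X))
  simp only [Function.comp_def] at h
  exact h

lemma continuous_rotFT_right (f : 𝓢(G, ℂ)) (ν : V) (R₀ : V ≃ₗᵢ[ℝ] V) (u : Plane) :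
    Continuous fun v : ℝ => rotFT f ν R₀ (u, v) :=
  (continuous_rotFT f ν R₀).comp (by fun_prop : Continuous fun v : ℝ => (u, v))

lemma fiber_apply_inner (f : G → ℂ) (ν : V) (R : V ≃ₗᵢ[ℝ] V) (ξ : ℝ) (u : Plane) :
    fiber f ν R ξ u
      = ∫ v : ℝ, Complex.exp (-Complex.I * (⟪ξ, v⟫ : ℝ)) * rotFT f ν R (u, v) := rfl

lemma rotFT_planePart (f : G → ℂ) (ν : V) (R : V ≃ₗᵢ[ℝ] V) (X : V) :
    rotFT f ν R (planePart (R X), R X 2) = centralFT f ν X := by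
  rw [rotFT, join_planePart, R.symm_apply_apply]

section Layer
variable (R₀ : V ≃ₗᵢ[ℝ] V)

/-- A point of the group lying over the plane point `u`. -/
def lift (u : Plane) : G := (R₀.symm (join (u, 0)), 0)

lemma continuous_lift : Continuous (lift R₀) := by
  have := continuous_join
  unfold lift
  fun_prop

/-- The `m`-weighted sum of the projections of the twisted Laplacian. -/
def layer (m : ℝ → ℂ) (f : G → ℂ) (ν : V) (ξ : ℝ) (u : Plane) : ℂ :=
  ∫ k, sliceFun m f ν (lift R₀ u) (k, ξ) ∂Measure.count

variable {R₀}

lemma measurable_layer {m : ℝ → ℂ} (hm : Measurable m) (f : 𝓢(G, ℂ)) (ν : V) :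
    Measurable fun x : ℝ × Plane => layer R₀ m f ν x.1 x.2 := by
  have h : Measurable (Function.uncurry fun (x : ℝ × Plane) (k : ℕ) =>
      sliceFun m f ν (lift R₀ x.2) (k, x.1)) :=
    measurable_sliceFun hm f measurable_const
      ((continuous_lift R₀).measurable.comp measurable_fst.snd)
      (measurable_snd.prodMk measurable_fst.fst)
  exact (h.stronglyMeasurable.integral_prod_right (ν := (Measure.count : Measure ℕ))).measurable

/-- The central variable and the radical coordinate enter only through pure phases, so a slice is a
Fourier integral in `ξ` whose density depends on the plane coordinates alone. -/
lemma sliceFun_eq_lift {ν : V} (hR : IsAdaptedRotation (dir ν : V) R₀) (m : ℝ → ℂ)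
    (f : 𝓢(G, ℂ)) (p : G) (y : ℕ × ℝ) :
    sliceFun m f ν p y = Complex.exp (Complex.I * (⟪ν, p.2⟫ : ℝ))
      * (Complex.exp (Complex.I * (⟪y.2, R₀ p.1 2⟫ : ℝ))
        * sliceFun m f ν (lift R₀ (planePart (R₀ p.1))) y) := by
  have h1 : ∀ Z : V, ‖ν‖ * ⟪(dir ν : V), Z⟫ = ⟪ν, Z⟫ := by
    intro Z
    rw [← real_inner_smul_left, norm_smul_dir]
  have h2 : ⟪y.2, R₀ p.1 2⟫ = R₀ p.1 2 * y.2 := rfl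
  simp only [sliceFun]
  rw [coeff_eq_proj f (norm_dir ν) hR (norm_nonneg ν),
    coeff_eq_proj f (norm_dir ν) hR (norm_nonneg ν), h1, h1, h2]
  simp only [lift, R₀.apply_symm_apply, planePart_join, join_two, inner_zero_right, zero_mul,
    Complex.ofReal_zero, mul_zero, Complex.exp_zero, one_mul]
  ring

lemma summable_norm_coeff (f : 𝓢(G, ℂ)) {ω : V} (hω : ‖ω‖ = 1) {lam : ℝ} (hlam : 0 ≤ lam) (ξ : ℝ)
    (p : G) : Summable fun k => ‖coeff f ω lam k ξ p‖ := by
  obtain ⟨C, hC, h⟩ := exists_norm_coeff_le_kfac f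
  exact Summable.of_nonneg_of_le (fun k => norm_nonneg _) (fun k => h ω hω lam hlam k ξ p)
    (((summable_kfac hlam).mul_right _).mul_left _)

lemma coeff_lift {ν : V} (hR : IsAdaptedRotation (dir ν : V) R₀) (f : 𝓢(G, ℂ)) (k : ℕ) (ξ : ℝ)
    (u : Plane) : coeff f (dir ν) ‖ν‖ k ξ (lift R₀ u) = proj k ‖ν‖ (fiber f ν R₀ ξ) u := by
  rw [coeff_eq_proj f (norm_dir ν) hR (norm_nonneg ν), norm_smul_dir]
  simp [lift, planePart_join, join_two]

lemma layer_eq_tsum {ν : V} (hR : IsAdaptedRotation (dir ν : V) R₀) {m : ℝ → ℂ}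
    (hm1 : ∀ t, ‖m t‖ ≤ 1) (f : 𝓢(G, ℂ)) (ξ : ℝ) (u : Plane) :
    layer R₀ m f ν ξ u = ∑' k : ℕ, m (eig ν (k, ξ)) * proj k ‖ν‖ (fiber f ν R₀ ξ) u := by
  have h : Integrable (fun k => sliceFun m f ν (lift R₀ u) (k, ξ)) Measure.count := by
    rw [integrable_count_iff]
    exact Summable.of_nonneg_of_le (fun k => norm_nonneg _)
      (fun k => norm_sliceFun_le hm1 f ν _ (k, ξ))
      (summable_norm_coeff f (norm_dir ν) (norm_nonneg ν) ξ (lift R₀ u))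
  rw [layer, integral_countable h]
  simp [Measure.real, sliceFun, coeff_lift hR]

lemma exists_norm_layer_le (f : 𝓢(G, ℂ)) (ν : V) : ∃ C : ℝ, 0 ≤ C ∧ ∀ (m : ℝ → ℂ)
    (_ : ∀ t, ‖m t‖ ≤ 1) (ξ : ℝ) (u : Plane), ‖layer R₀ m f ν ξ u‖ ≤ C * (1 + ξ ^ 2)⁻¹ := by
  obtain ⟨C, hC, h⟩ := exists_norm_coeff_le_kfac f
  have hs : Integrable (kfac ‖ν‖) (Measure.count : Measure ℕ) := by
    rw [integrable_count_iff]
    exact (summable_kfac (norm_nonneg ν)).congr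
      fun k => (Real.norm_of_nonneg (kfac_nonneg (norm_nonneg ν) k)).symm
  refine ⟨C * ((1 + ‖ν‖) ^ 4)⁻¹ * ∫ k, kfac ‖ν‖ k ∂Measure.count,
    mul_nonneg (by positivity) (integral_nonneg (kfac_nonneg (norm_nonneg ν))),
    fun m hm1 ξ u => ?_⟩
  refine (norm_integral_le_of_norm_le ((hs.mul_const ((1 + ξ ^ 2)⁻¹)).const_mul
    (C * ((1 + ‖ν‖) ^ 4)⁻¹)) (Eventually.of_forall fun k =>
      (norm_sliceFun_le hm1 f ν _ (k, ξ)).trans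
        (h _ (norm_dir ν) _ (norm_nonneg ν) k ξ _))).trans (le_of_eq ?_)
  rw [integral_const_mul, integral_mul_const, mul_assoc, mul_assoc, mul_assoc]

lemma integrable_layer {m : ℝ → ℂ} (hm : Measurable m) (hm1 : ∀ t, ‖m t‖ ≤ 1) (f : 𝓢(G, ℂ))
    (ν : V) (u : Plane) : Integrable fun ξ => layer R₀ m f ν ξ u := by
  obtain ⟨C, hC, h⟩ := exists_norm_layer_le (R₀ := R₀) f ν
  exact (integrable_inv_one_add_sq.const_mul C).mono'
    ((measurable_layer hm f ν).comp measurable_prodMk_right).aestronglyMeasurable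
    (Eventually.of_forall fun ξ => h m hm1 ξ u)

lemma memLp_layer {m : ℝ → ℂ} (hm : Measurable m) (hm1 : ∀ t, ‖m t‖ ≤ 1) (f : 𝓢(G, ℂ))
    (ν : V) (u : Plane) : MemLp (fun ξ => layer R₀ m f ν ξ u) 2 volume := by
  obtain ⟨C, hC, h⟩ := exists_norm_layer_le (R₀ := R₀) f ν
  exact memLp_two_of_bounded (integrable_layer hm hm1 f ν u) (C := C) fun ξ =>
    (h m hm1 ξ u).trans (mul_le_of_le_one_right hC
      (inv_le_one_of_one_le₀ (by linarith [sq_nonneg ξ])))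

/-- The contribution of a central character as a Fourier integral over its stabilizer. -/
lemma slice_eq {ν : V} (hR : IsAdaptedRotation (dir ν : V) R₀) {m : ℝ → ℂ} (hm : Measurable m)
    (hm1 : ∀ t, ‖m t‖ ≤ 1) (f : 𝓢(G, ℂ)) (p : G) :
    slice m f ν p = Complex.exp (Complex.I * (⟪ν, p.2⟫ : ℝ))
      * ∫ ξ, Complex.exp (Complex.I * (⟪ξ, R₀ p.1 2⟫ : ℝ))
        * layer R₀ m f ν ξ (planePart (R₀ p.1)) := by
  have hint := integrable_sliceFun hm hm1 f ν p
  rw [slice, spinMeasure, integral_prod_symm _ hint, ← integral_const_mul]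
  refine integral_congr_ae (Eventually.of_forall fun ξ => ?_)
  beta_reduce
  rw [layer, ← integral_const_mul, ← integral_const_mul]
  refine integral_congr_ae (Eventually.of_forall fun k => ?_)
  exact sliceFun_eq_lift hR m f p (k, ξ)

lemma layer_one {ν : V} (hν : ν ≠ 0) (hR : IsAdaptedRotation (dir ν : V) R₀) (f : 𝓢(G, ℂ)) (ξ : ℝ)
    (u : Plane) : layer R₀ (fun _ => 1) f ν ξ u = fiber f ν R₀ ξ u := by
  obtain ⟨C, hC⟩ := exists_planeDecay_fiber f ν R₀ ξ
  rw [layer_eq_tsum hR (by simp) f]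
  simp only [one_mul]
  refine tsum_proj (norm_pos_iff.2 hν) hC u ?_
  simpa only [coeff_lift hR] using summable_norm_coeff f (norm_dir ν) (norm_nonneg ν) ξ (lift R₀ u)

/-- Completeness of the plane projections turns the layer into the radical Fourier transform of
`f^ν`; inversion on the line contributes the `2π`. -/
lemma slice_one {ν : V} (hν : ν ≠ 0) (hR : IsAdaptedRotation (dir ν : V) R₀) (f : 𝓢(G, ℂ)) (p : G) :
    slice (fun _ => 1) f ν p = Complex.exp (Complex.I * (⟪ν, p.2⟫ : ℝ))
      * (((2 * Real.pi : ℝ) : ℂ) * centralFT f ν p.1) := by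
  rw [slice_eq hR measurable_const (by simp) f]
  congr 1
  have hint := integrable_layer (R₀ := R₀) (m := fun _ => 1) measurable_const (by simp) f ν
    (planePart (R₀ p.1))
  simp only [layer_one hν hR, fiber_apply_inner] at hint ⊢
  rw [fourier_inversion (continuous_rotFT_right f ν R₀ _) (integrable_rotFT f ν R₀ _) hint,
    rotFT_planePart, Module.finrank_self, pow_one]

/-- Weights of modulus one do not change the `L²` norm of a layer. -/
lemma lintegral_slice_sq {ν : V} (hν : ν ≠ 0) (hR : IsAdaptedRotation (dir ν : V) R₀) {m : ℝ → ℂ}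
    (hm : Measurable m) (hm1 : ∀ t, ‖m t‖ = 1) (f : 𝓢(G, ℂ)) :
    ∫⁻ X : V, ‖slice m f ν (X, 0)‖ₑ ^ 2
      = ENNReal.ofReal (2 * Real.pi) * ∫⁻ ξ : ℝ, ∫⁻ u, ‖fiber f ν R₀ ξ u‖ₑ ^ 2 := by
  have hm1' : ∀ t, ‖m t‖ ≤ 1 := fun t => (hm1 t).le
  have hs : Measurable fun X : V => ‖slice m f ν (X, 0)‖ₑ ^ 2 :=
    ((measurable_slice hm f (ν := fun _ : V => ν) (p := fun X => (X, 0)) measurable_const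
      (by fun_prop)).enorm).pow_const 2
  rw [lintegral_eq_lintegral_join R₀ hs]
  have h1 : ∀ (u : Plane) (v : ℝ), ‖slice m f ν (R₀.symm (join (u, v)), 0)‖ₑ ^ 2
      = ‖∫ ξ, Complex.exp (Complex.I * (⟪ξ, v⟫ : ℝ)) * layer R₀ m f ν ξ u‖ₑ ^ 2 := by
    intro u v
    rw [slice_eq hR hm hm1' f]
    simp only [R₀.apply_symm_apply, planePart_join, join_two, inner_zero_right,
      Complex.ofReal_zero, mul_zero, Complex.exp_zero, one_mul]
  simp_rw [h1]
  -- Plancherel in the radical coordinate. For fixed `ξ` the weight is then a unimodular multiplier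
  -- on the plane, and it disappears from the norm.
  have h2 : ∀ u, ∫⁻ v : ℝ, ‖∫ ξ, Complex.exp (Complex.I * (⟪ξ, v⟫ : ℝ)) * layer R₀ m f ν ξ u‖ₑ ^ 2
      = ENNReal.ofReal (2 * Real.pi) * ∫⁻ ξ, ‖layer R₀ m f ν ξ u‖ₑ ^ 2 := by
    intro u
    rw [lintegral_phase_sq (integrable_layer hm hm1' f ν u) (memLp_layer hm hm1' f ν u)]
    simp
  simp_rw [h2]
  have h3' : Measurable (Function.uncurry fun (u : Plane) (ξ : ℝ) =>
      ‖layer R₀ m f ν ξ u‖ₑ ^ 2) := by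
    have h3 := ((measurable_layer (R₀ := R₀) hm f ν).comp
      (measurable_swap (α := Plane) (β := ℝ))).enorm.pow_const 2
    simp only [Function.comp_def, Prod.fst_swap, Prod.snd_swap] at h3
    exact h3
  rw [lintegral_const_mul _ h3'.lintegral_prod_right, lintegral_lintegral_swap h3'.aemeasurable]
  congr 1
  refine lintegral_congr fun ξ => ?_
  obtain ⟨C, hC⟩ := exists_planeDecay_fiber f ν R₀ ξ
  simp_rw [layer_eq_tsum hR hm1' f]
  refine lintegral_tsum_mul_proj (norm_pos_iff.2 hν) hC (fun u => ?_) fun k => hm1 _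
  simpa only [coeff_lift hR] using summable_norm_coeff f (norm_dir ν) (norm_nonneg ν) ξ (lift R₀ u)

end Layer

variable {R : S → V ≃ₗᵢ[ℝ] V}

/-- Fourier inversion on the centre gives `(2π)³`, which together with the `2π` of `slice_one`
cancels `(2π)⁻⁴`. -/
lemma integral_slice_one (hR : ∀ ω : S, IsAdaptedRotation (ω : V) (R ω)) (f : 𝓢(G, ℂ)) (p : G) :
    cst * ∫ ν, slice (fun _ => 1) f ν p = f p := by
  have hae : ∀ᵐ ν : V, ν ≠ 0 := by
    rw [ae_iff]
    simp
  have h1 : (fun ν => slice (fun _ => 1) f ν p) =ᵐ[volume] fun ν =>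
      ((2 * Real.pi : ℝ) : ℂ) * (Complex.exp (Complex.I * (⟪ν, p.2⟫ : ℝ)) * centralFT f ν p.1) := by
    filter_upwards [hae] with ν hν
    rw [slice_one hν (hR _) f]
    ring
  have hpi : ((2 * Real.pi : ℝ) : ℂ) ≠ 0 := by
    exact_mod_cast (by positivity : (2 * Real.pi : ℝ) ≠ 0)
  have hc := continuous_centralFT_left f p.1
  -- Integrability of `ν ↦ f^ν(X)` is read off from that of the slices, so no separate decay
  -- estimate for the central Fourier transform is needed.
  have h2 : Integrable fun ν => centralFT f ν p.1 := by
    have h := ((integrable_slice (m := fun _ => 1) measurable_const (by simp) f p).congr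
      h1).norm.const_mul (2 * Real.pi)⁻¹
    refine h.mono' hc.aestronglyMeasurable (Eventually.of_forall fun ν => le_of_eq ?_)
    rw [norm_mul, norm_mul, Complex.norm_real, Real.norm_of_nonneg (by positivity),
      mul_comm Complex.I, Complex.norm_exp_ofReal_mul_I, one_mul, ← mul_assoc,
      inv_mul_cancel₀ (by positivity), one_mul]
  have h3 := fourier_inversion (continuous_section f p.1) (integrable_section f p.1) h2 p.2
  rw [integral_congr_ae h1, integral_const_mul]
  unfold centralFT
  rw [h3, finrank_V, cst, ← mul_assoc, ← mul_assoc, ← Complex.ofReal_mul, ← Complex.ofReal_mul]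
  have : ((2 * Real.pi) ^ 4)⁻¹ * (2 * Real.pi) * (2 * Real.pi) ^ 3 = 1 := by
    field_simp
  rw [this, Complex.ofReal_one, one_mul]

/-- The reconstruction formula. -/
lemma integral_P (hR : ∀ ω : S, IsAdaptedRotation (ω : V) (R ω)) (f : 𝓢(G, ℂ)) (p : G) :
    ∫ μ in Ioi (0 : ℝ), P R μ f p = f p := by
  have h := integral_mul_P hR (m := fun _ => 1) measurable_const (by simp) f p
  simp only [one_mul] at h
  rw [h, integral_slice_one hR]

lemma integrableOn_P (hR : ∀ ω : S, IsAdaptedRotation (ω : V) (R ω)) (f : 𝓢(G, ℂ)) (p : G) :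
    IntegrableOn (fun μ => P R μ f p) (Ioi 0) := by
  simpa using integrableOn_mul_P hR (m := fun _ => 1) measurable_const (by simp) f p

lemma density_subLaplacianS (f : 𝓢(G, ℂ)) (p : G) (μ : ℝ) (x : S × ℕ × ℝ) :
    density (subLaplacianS f) p μ x = (μ : ℂ) * density f p μ x := by
  rcases le_or_gt μ (x.2.2 ^ 2) with h | h
  · rw [density_eq_zero _ _ h, density_eq_zero _ _ h, mul_zero]
  · have h0 : (0 : ℝ) < 2 * x.2.1 + 1 := by positivity
    rw [density_eq _ _ h, density_eq _ _ h, coeff_subLaplacianS f (norm_eq_of_mem_sphere x.1)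
      (div_nonneg (by linarith) h0.le), div_mul_cancel₀ _ h0.ne', sub_add_cancel]
    ring

lemma P_subLaplacianS (hR : ∀ ω : S, IsAdaptedRotation (ω : V) (R ω)) (f : 𝓢(G, ℂ)) (μ : ℝ)
    (p : G) : P R μ (subLaplacianS f) p = (μ : ℂ) * P R μ f p := by
  rw [P_eq hR, P_eq hR]
  simp_rw [density_subLaplacianS]
  rw [integral_const_mul]
  ring

end FreeTwoStep
end

noncomputable section
namespace FreeTwoStep
open Filter Topology

/-! ### The spectral projections -/

variable {R : S → V ≃ₗᵢ[ℝ] V}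

lemma slice_section (hR : ∀ ω : S, IsAdaptedRotation (ω : V) (R ω)) {m : ℝ → ℂ} (hm : Measurable m)
    (hm1 : ∀ t, ‖m t‖ ≤ 1) (f : 𝓢(G, ℂ)) (ν X Z : V) :
    slice m f ν (X, Z) = Complex.exp (Complex.I * (⟪ν, Z⟫ : ℝ)) * slice m f ν (X, 0) := by
  rw [slice_eq (hR (dir ν)) hm hm1 f, slice_eq (hR (dir ν)) hm hm1 f]
  simp

lemma measurable_integral_slice {m : ℝ → ℂ} (hm : Measurable m) (f : 𝓢(G, ℂ)) :
    Measurable fun p : G => ∫ ν, slice m f ν p := by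
  have h : Measurable (Function.uncurry fun (p : G) (ν : V) => slice m f ν p) :=
    measurable_slice hm f measurable_snd measurable_fst
  exact h.stronglyMeasurable.integral_prod_right.measurable

/-- Plancherel on the centre, then `lintegral_slice_sq` for almost every `ν`. What matters is that
the right side does not contain `m`. -/
lemma lintegral_integral_slice_sq (hR : ∀ ω : S, IsAdaptedRotation (ω : V) (R ω)) {m : ℝ → ℂ}
    (hm : Measurable m) (hm1 : ∀ t, ‖m t‖ = 1) (f : 𝓢(G, ℂ)) :
    ∫⁻ p : G, ‖∫ ν, slice m f ν p‖ₑ ^ 2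
      = ENNReal.ofReal ((2 * Real.pi) ^ Module.finrank ℝ V) * ∫⁻ ν : V,
        ENNReal.ofReal (2 * Real.pi) * ∫⁻ ξ : ℝ, ∫⁻ u, ‖fiber f ν (R (dir ν)) ξ u‖ₑ ^ 2 := by
  have hm1' : ∀ t, ‖m t‖ ≤ 1 := fun t => (hm1 t).le
  have h1 := lintegral_prod (μ := (volume : Measure V)) (ν := (volume : Measure V))
    (fun p : G => ‖∫ ν, slice m f ν p‖ₑ ^ 2)
    ((measurable_integral_slice hm f).enorm.pow_const 2).aemeasurable
  rw [show (volume : Measure G) = (volume : Measure V).prod volume from rfl, h1]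
  have h2 : ∀ X : V, ∫⁻ Z, ‖∫ ν, slice m f ν (X, Z)‖ₑ ^ 2
      = ENNReal.ofReal ((2 * Real.pi) ^ Module.finrank ℝ V)
        * ∫⁻ ν, ‖slice m f ν (X, 0)‖ₑ ^ 2 := by
    intro X
    obtain ⟨C, hC, h⟩ := exists_norm_slice_le f
    have hi := integrable_slice hm hm1' f (X, 0)
    rw [← lintegral_phase_sq hi (memLp_two_of_bounded hi (C := C) fun ν => (h m hm1' ν _).trans
      (mul_le_of_le_one_right hC (inv_le_one_of_one_le₀ (one_le_pow₀ (by simp)))))]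
    refine lintegral_congr fun Z => ?_
    simp_rw [slice_section hR hm hm1' f _ X Z]
  simp_rw [h2]
  have h3 : Measurable (Function.uncurry fun (X ν : V) => ‖slice m f ν (X, 0)‖ₑ ^ 2) :=
    ((measurable_slice hm f (ν := fun z : V × V => z.2) (p := fun z => (z.1, 0)) measurable_snd
      (by fun_prop)).enorm).pow_const 2
  rw [lintegral_const_mul _ h3.lintegral_prod_right, lintegral_lintegral_swap h3.aemeasurable]
  congr 1
  have hae : ∀ᵐ ν : V, ν ≠ 0 := by
    rw [ae_iff]
    simp
  exact lintegral_congr_ae (hae.mono fun ν hν => lintegral_slice_sq hν (hR (dir ν)) hm hm1 f)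

/-- The operator `m(L)` on functions. -/
def mulP (R : S → V ≃ₗᵢ[ℝ] V) (m : ℝ → ℂ) (f : G → ℂ) (p : G) : ℂ :=
  ∫ μ in Ioi (0 : ℝ), m μ * P R μ f p

lemma measurable_mulP (hR : ∀ ω : S, IsAdaptedRotation (ω : V) (R ω)) {m : ℝ → ℂ}
    (hm : Measurable m) (hm1 : ∀ t, ‖m t‖ ≤ 1) (f : 𝓢(G, ℂ)) : Measurable (mulP R m f) := by
  have : mulP R m f = fun p => cst * ∫ ν, slice m f ν p :=
    funext fun p => integral_mul_P hR hm hm1 f p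
  rw [this]
  exact (measurable_integral_slice hm f).const_mul cst

/-- The Plancherel identity: weights of modulus one preserve the `L²` norm. -/
lemma lintegral_mulP_sq (hR : ∀ ω : S, IsAdaptedRotation (ω : V) (R ω)) {m : ℝ → ℂ}
    (hm : Measurable m) (hm1 : ∀ t, ‖m t‖ = 1) (f : 𝓢(G, ℂ)) :
    ∫⁻ p : G, ‖mulP R m f p‖ₑ ^ 2 = ∫⁻ p : G, ‖f p‖ₑ ^ 2 := by
  have h : ∀ m : ℝ → ℂ, Measurable m → (∀ t, ‖m t‖ = 1) → ∫⁻ p : G, ‖mulP R m f p‖ₑ ^ 2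
      = ‖cst‖ₑ ^ 2 * ∫⁻ p : G, ‖∫ ν, slice m f ν p‖ₑ ^ 2 := by
    intro m hm hm1
    rw [← lintegral_const_mul _ ((measurable_integral_slice hm f).enorm.pow_const 2)]
    refine lintegral_congr fun p => ?_
    rw [mulP, integral_mul_P hR hm (fun t => (hm1 t).le), enorm_mul, mul_pow]
  have h1 : ∀ p, mulP R (fun _ => 1) f p = f p := fun p => by
    simp only [mulP, one_mul]
    exact integral_P hR f p
  -- The common value is evaluated at `m = 1`, where reconstruction gives `f`.
  have h2 := h (fun _ => 1) measurable_const (by simp)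
  rw [lintegral_integral_slice_sq hR measurable_const (by simp)] at h2
  simp only [h1] at h2
  rw [h m hm hm1, lintegral_integral_slice_sq hR hm hm1, h2]

open Classical in
/-- The weight equal to `ζ` on `B` and to `1` elsewhere. -/
def phaseOn (B : Set ℝ) (ζ : ℂ) (t : ℝ) : ℂ := if t ∈ B then ζ else 1

lemma measurable_phaseOn {B : Set ℝ} (hB : MeasurableSet B) (ζ : ℂ) : Measurable (phaseOn B ζ) :=
  Measurable.ite hB measurable_const measurable_const

lemma norm_phaseOn (B : Set ℝ) {ζ : ℂ} (hζ : ‖ζ‖ = 1) (t : ℝ) : ‖phaseOn B ζ t‖ = 1 := by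
  rw [phaseOn]
  split_ifs <;> simp [hζ]

/-- The function `∫_{B ∩ (0, ∞)} 𝒫_μ f dμ`. -/
def specFun (R : S → V ≃ₗᵢ[ℝ] V) (B : Set ℝ) (f : G → ℂ) (p : G) : ℂ :=
  ∫ μ in B ∩ Ioi (0 : ℝ), P R μ f p

lemma mulP_phaseOn (hR : ∀ ω : S, IsAdaptedRotation (ω : V) (R ω)) {B : Set ℝ}
    (hB : MeasurableSet B) (ζ : ℂ) (f : 𝓢(G, ℂ)) (p : G) :
    mulP R (phaseOn B ζ) f p = f p + (ζ - 1) * specFun R B f p := by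
  have h0 := integrableOn_P hR f p
  have h1 : ∀ μ, phaseOn B ζ μ * P R μ f p
      = P R μ f p + (ζ - 1) * B.indicator (fun μ => P R μ f p) μ := by
    intro μ
    by_cases h : μ ∈ B
    · simp [phaseOn, h]
      ring
    · simp [phaseOn, h]
  simp only [mulP, h1]
  rw [integral_add h0 ((h0.indicator hB).const_mul _), integral_const_mul, integral_P hR,
    integral_indicator hB, Measure.restrict_restrict hB, specFun]

/-- With `ζ = -1` the function is half the difference of `f` and a function of the same `L²` norm;
this is how its square integrability is obtained. -/
lemma specFun_eq (hR : ∀ ω : S, IsAdaptedRotation (ω : V) (R ω)) {B : Set ℝ}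
    (hB : MeasurableSet B) (f : 𝓢(G, ℂ)) :
    specFun R B f = fun p => 2⁻¹ * (f p - mulP R (phaseOn B (-1)) f p) := by
  funext p
  rw [mulP_phaseOn hR hB]
  ring

lemma memLp_of_lintegral_sq {α : Type*} [MeasurableSpace α] {μ : Measure α} {h : α → ℂ}
    (hm : AEStronglyMeasurable h μ) (hi : ∫⁻ x, ‖h x‖ₑ ^ 2 ∂μ < ⊤) : MemLp h 2 μ := by
  refine ⟨hm, ?_⟩
  rw [eLpNorm_lt_top_iff_lintegral_rpow_enorm_lt_top two_ne_zero ENNReal.ofNat_ne_top]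
  simpa using hi

lemma memLp_mulP (hR : ∀ ω : S, IsAdaptedRotation (ω : V) (R ω)) {m : ℝ → ℂ}
    (hm : Measurable m) (hm1 : ∀ t, ‖m t‖ = 1) (f : 𝓢(G, ℂ)) : MemLp (mulP R m f) 2 volume := by
  refine memLp_of_lintegral_sq (measurable_mulP hR hm (fun t => (hm1 t).le) f).aestronglyMeasurable ?_
  rw [lintegral_mulP_sq hR hm hm1]
  have h := lintegral_enorm_sq_eq (f.toLp 2 volume)
  rw [lintegral_congr_ae ((f.coeFn_toLp 2 volume).mono fun p hp => by beta_reduce; rw [hp])] at h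
  rw [h]
  exact ENNReal.ofReal_lt_top

lemma memLp_specFun (hR : ∀ ω : S, IsAdaptedRotation (ω : V) (R ω)) {B : Set ℝ}
    (hB : MeasurableSet B) (f : 𝓢(G, ℂ)) : MemLp (specFun R B f) 2 volume := by
  rw [specFun_eq hR hB]
  exact ((f.memLp 2 volume).sub (memLp_mulP hR (measurable_phaseOn hB _)
    (norm_phaseOn B (by simp)) f)).const_mul _

/-! ### Linearity in `f`, and extension of the projections to `L²` -/

lemma density_add (f g : 𝓢(G, ℂ)) (p : G) (μ : ℝ) (x : S × ℕ × ℝ) :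
    density (f + g) p μ x = density f p μ x + density g p μ x := by
  simp only [density, radial]
  split_ifs
  · rw [coeff_add f g (norm_eq_of_mem_sphere x.1) (abs_nonneg _)]
    ring
  · simp

lemma coeff_smul (c : ℂ) (f : G → ℂ) (ω : V) (lam : ℝ) (k : ℕ) (ξ : ℝ) (p : G) :
    coeff (c • f) ω lam k ξ p = c * coeff f ω lam k ξ p := by
  simp only [coeff, Pi.smul_apply, smul_eq_mul, mul_assoc]
  rw [integral_const_mul]
  ring

lemma density_smul (c : ℂ) (f : G → ℂ) (p : G) (μ : ℝ) (x : S × ℕ × ℝ) :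
    density (c • f) p μ x = c * density f p μ x := by
  simp only [density, radial, coeff_smul]
  split_ifs
  · ring
  · simp

lemma P_add (hR : ∀ ω : S, IsAdaptedRotation (ω : V) (R ω)) (f g : 𝓢(G, ℂ)) (μ : ℝ) (p : G) :
    P R μ (f + g : 𝓢(G, ℂ)) p = P R μ f p + P R μ g p := by
  rw [P_eq hR, P_eq hR, P_eq hR, ← mul_add,
    ← integral_add (integrable_density f p μ) (integrable_density g p μ)]
  congr 1
  exact integral_congr_ae (Eventually.of_forall fun x => density_add f g p μ x)

lemma P_smul (hR : ∀ ω : S, IsAdaptedRotation (ω : V) (R ω)) (c : ℂ) (f : 𝓢(G, ℂ)) (μ : ℝ)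
    (p : G) : P R μ (c • f : 𝓢(G, ℂ)) p = c * P R μ f p := by
  have h : ∫ x, density (c • f : 𝓢(G, ℂ)) p μ x ∂paramMeasure
      = c * ∫ x, density f p μ x ∂paramMeasure := by
    rw [← integral_const_mul]
    exact integral_congr_ae (Eventually.of_forall fun x => density_smul c f p μ x)
  rw [P_eq hR, P_eq hR, h]
  ring

lemma specFun_add (hR : ∀ ω : S, IsAdaptedRotation (ω : V) (R ω)) (B : Set ℝ)
    (f g : 𝓢(G, ℂ)) (p : G) :
    specFun R B (f + g : 𝓢(G, ℂ)) p = specFun R B f p + specFun R B g p := by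
  simp only [specFun, P_add hR]
  exact integral_add ((integrableOn_P hR f p).mono_set inter_subset_right)
    ((integrableOn_P hR g p).mono_set inter_subset_right)

lemma specFun_smul (hR : ∀ ω : S, IsAdaptedRotation (ω : V) (R ω)) (B : Set ℝ) (c : ℂ)
    (f : 𝓢(G, ℂ)) (p : G) : specFun R B (c • f : 𝓢(G, ℂ)) p = c * specFun R B f p := by
  simp only [specFun, P_smul hR]
  exact integral_const_mul _ _

/-- The map `f ↦ ∫_{B ∩ (0, ∞)} 𝒫_μ f dμ` from Schwartz functions to `L²`. -/
def specLin (hR : ∀ ω : S, IsAdaptedRotation (ω : V) (R ω)) {B : Set ℝ} (hB : MeasurableSet B) :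
    𝓢(G, ℂ) →ₗ[ℂ] L2G where
  toFun f := (memLp_specFun hR hB f).toLp _
  map_add' f g := by
    rw [← MemLp.toLp_add]
    congr 1
    exact funext fun p => specFun_add hR B f g p
  map_smul' c f := by
    rw [RingHom.id_apply, ← MemLp.toLp_const_smul]
    congr 1
    exact funext fun p => specFun_smul hR B c f p

/-- The inclusion of the Schwartz functions in `L²`. -/
def toL2 : 𝓢(G, ℂ) →ₗ[ℂ] L2G := (SchwartzMap.toLpCLM ℂ ℂ 2 (volume : Measure G)).toLinearMap

lemma toL2_apply (f : 𝓢(G, ℂ)) : toL2 f = f.toLp 2 volume := rfl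

lemma denseRange_toL2 : DenseRange toL2 :=
  SchwartzMap.denseRange_toLpCLM (E := G) (F := ℂ) (p := 2) (μ := volume) ENNReal.ofNat_ne_top

lemma norm_add_smul_specLin (hR : ∀ ω : S, IsAdaptedRotation (ω : V) (R ω)) {B : Set ℝ}
    (hB : MeasurableSet B) {ζ : ℂ} (hζ : ‖ζ‖ = 1) (f : 𝓢(G, ℂ)) :
    ‖toL2 f + (ζ - 1) • specLin hR hB f‖ = ‖toL2 f‖ := by
  have h1 := lintegral_enorm_sq_eq (toL2 f + (ζ - 1) • specLin hR hB f)
  have h2 := lintegral_enorm_sq_eq (toL2 f)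
  have e1 : ⇑(toL2 f + (ζ - 1) • specLin hR hB f) =ᵐ[volume] mulP R (phaseOn B ζ) f := by
    have a1 := Lp.coeFn_add (toL2 f) ((ζ - 1) • specLin hR hB f)
    have a2 := Lp.coeFn_smul (ζ - 1) (specLin hR hB f)
    have a3 : specLin hR hB f =ᵐ[volume] specFun R B f := (memLp_specFun hR hB f).coeFn_toLp
    have a4 : toL2 f =ᵐ[volume] f := f.coeFn_toLp 2 volume
    filter_upwards [a1, a2, a3, a4] with p h1 h2 h3 h4
    rw [h1, Pi.add_apply, h2, Pi.smul_apply, h3, h4, mulP_phaseOn hR hB, smul_eq_mul]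
  rw [lintegral_congr_ae (e1.mono fun p hp => by beta_reduce; rw [hp]),
    lintegral_mulP_sq hR (measurable_phaseOn hB ζ) (norm_phaseOn B hζ)] at h1
  rw [lintegral_congr_ae ((f.coeFn_toLp 2 volume).mono fun p hp => by
    beta_reduce; rw [toL2_apply, hp]), h1] at h2
  have h3 := (ENNReal.ofReal_eq_ofReal_iff (sq_nonneg _) (sq_nonneg _)).1 h2
  exact (sq_eq_sq₀ (norm_nonneg _) (norm_nonneg _)).1 h3

/-- If all the rotations `ζ a + b`, `|ζ| = 1`, have the same length, then `a ⟂ b`. -/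
lemma inner_eq_zero_of_norm_rotation {H : Type*} [NormedAddCommGroup H] [InnerProductSpace ℂ H]
    {a b : H} (h : ∀ ζ : ℂ, ‖ζ‖ = 1 → ‖ζ • a + b‖ = ‖a + b‖) : inner ℂ a b = 0 := by
  have key : ∀ ζ : ℂ, ‖ζ‖ = 1 → (inner ℂ (ζ • a) b).re = (inner ℂ a b).re := by
    intro ζ hζ
    have h1 := @norm_add_sq ℂ H _ _ _ (ζ • a) b
    have h2 := @norm_add_sq ℂ H _ _ _ a b
    rw [h ζ hζ, norm_smul, hζ, one_mul, h2] at h1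
    simp only [RCLike.re_to_complex] at h1
    linarith
  -- `ζ = -1` kills the real part of the inner product, and `ζ = i` then its imaginary part.
  have h1 := key (-1) (by simp)
  have h2 := key Complex.I (by simp)
  simp only [inner_smul_left, map_neg, map_one, neg_mul, one_mul, Complex.neg_re, Complex.conj_I,
    Complex.mul_re, Complex.I_re, Complex.I_im, zero_mul, zero_sub] at h1 h2
  apply Complex.ext
  · simp only [Complex.zero_re]
    linarith
  · simp only [Complex.zero_im]
    linarith

/-- The vector `ζ E(B) f + (f - E(B) f)` is the weight `ζ` on `B` applied to `f`, so its length does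
not depend on `ζ`. -/
lemma inner_specLin (hR : ∀ ω : S, IsAdaptedRotation (ω : V) (R ω)) {B : Set ℝ}
    (hB : MeasurableSet B) (f : 𝓢(G, ℂ)) :
    inner ℂ (specLin hR hB f) (toL2 f - specLin hR hB f) = 0 := by
  refine inner_eq_zero_of_norm_rotation fun ζ hζ => ?_
  rw [add_sub_cancel, ← norm_add_smul_specLin hR hB hζ f]
  congr 1
  module

lemma norm_specLin_le (hR : ∀ ω : S, IsAdaptedRotation (ω : V) (R ω)) {B : Set ℝ}
    (hB : MeasurableSet B) (f : 𝓢(G, ℂ)) : ‖specLin hR hB f‖ ≤ 1 * ‖toL2 f‖ := by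
  have h := inner_specLin hR hB f
  have h1 : ‖toL2 f‖ ^ 2 = ‖specLin hR hB f‖ ^ 2 + ‖toL2 f - specLin hR hB f‖ ^ 2 := by
    have := @norm_add_sq ℂ L2G _ _ _ (specLin hR hB f) (toL2 f - specLin hR hB f)
    rw [add_sub_cancel, h] at this
    simpa using this
  rw [one_mul]
  exact le_of_sq_le_sq (by rw [h1]; nlinarith [sq_nonneg ‖toL2 f - specLin hR hB f‖])
    (norm_nonneg _)

open Classical in
/-- The spectral projections of the subLaplacian. -/
def specProj (hR : ∀ ω : S, IsAdaptedRotation (ω : V) (R ω)) (B : Set ℝ) : L2G →L[ℂ] L2G :=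
  if hB : MeasurableSet B then (specLin hR hB).extendOfNorm toL2 else 0

lemma specProj_toL2 (hR : ∀ ω : S, IsAdaptedRotation (ω : V) (R ω)) {B : Set ℝ}
    (hB : MeasurableSet B) (f : 𝓢(G, ℂ)) : specProj hR B (toL2 f) = specLin hR hB f := by
  rw [specProj, dif_pos hB]
  exact LinearMap.extendOfNorm_eq denseRange_toL2 ⟨1, norm_specLin_le hR hB⟩ f

lemma specProj_ae_eq (hR : ∀ ω : S, IsAdaptedRotation (ω : V) (R ω)) {B : Set ℝ}
    (hB : MeasurableSet B) (f : 𝓢(G, ℂ)) :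
    specProj hR B (f.toLp 2 volume) =ᵐ[volume] specFun R B f := by
  rw [← toL2_apply, specProj_toL2 hR hB]
  exact (memLp_specFun hR hB f).coeFn_toLp

lemma norm_specProj_le (hR : ∀ ω : S, IsAdaptedRotation (ω : V) (R ω)) {B : Set ℝ}
    (hB : MeasurableSet B) (u : L2G) : ‖specProj hR B u‖ ≤ ‖u‖ := by
  rw [specProj, dif_pos hB, ← one_mul ‖u‖]
  exact LinearMap.norm_extendOfNorm_apply_le denseRange_toL2 1 (norm_specLin_le hR hB) u

/-- An operator with `⟨E u, u⟩ = ‖E u‖²` is an orthogonal projection. -/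
lemma isStarProjection_of_inner {H : Type*} [NormedAddCommGroup H] [InnerProductSpace ℂ H]
    [CompleteSpace H] {E : H →L[ℂ] H} (h : ∀ u, inner ℂ (E u) u = inner ℂ (E u) (E u)) :
    IsStarProjection E := by
  have h1 : ContinuousLinearMap.adjoint E = ContinuousLinearMap.adjoint E * E := by
    have h0 := (ext_inner_map ((ContinuousLinearMap.adjoint E : H →L[ℂ] H) : H →ₗ[ℂ] H)
      ((ContinuousLinearMap.adjoint E * E : H →L[ℂ] H) : H →ₗ[ℂ] H)).1 fun u => by
        have e1 := congrArg (starRingEnd ℂ) (h u)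
        rw [inner_conj_symm, inner_conj_symm] at e1
        change inner ℂ (ContinuousLinearMap.adjoint E u) u
          = inner ℂ (ContinuousLinearMap.adjoint E (E u)) u
        rw [ContinuousLinearMap.adjoint_inner_left, ContinuousLinearMap.adjoint_inner_left, e1]
    exact ContinuousLinearMap.coe_injective h0
  rw [← ContinuousLinearMap.star_eq_adjoint] at h1
  have h2 : star E = E := by
    have h3 := congrArg star h1
    rw [star_mul, star_star] at h3
    exact h1.trans h3.symm
  refine ⟨?_, h2⟩
  rw [h2] at h1
  exact h1.symm

lemma isStarProjection_specProj (hR : ∀ ω : S, IsAdaptedRotation (ω : V) (R ω)) {B : Set ℝ}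
    (hB : MeasurableSet B) : IsStarProjection (specProj hR B) := by
  refine isStarProjection_of_inner fun u => ?_
  refine denseRange_toL2.induction_on (p := fun u => inner ℂ (specProj hR B u) u
    = inner ℂ (specProj hR B u) (specProj hR B u)) u ?_ fun f => ?_
  · exact isClosed_eq (by fun_prop) (by fun_prop)
  · have h := inner_specLin hR hB f
    rw [inner_sub_right, sub_eq_zero] at h
    rw [specProj_toL2 hR hB, h]

lemma specProj_univ (hR : ∀ ω : S, IsAdaptedRotation (ω : V) (R ω)) : specProj hR univ = 1 := by
  refine ContinuousLinearMap.ext fun u => ?_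
  refine denseRange_toL2.induction_on (p := fun u => specProj hR univ u
    = (1 : L2G →L[ℂ] L2G) u) u (isClosed_eq (by fun_prop) (by fun_prop)) fun f => ?_
  rw [specProj_toL2 hR MeasurableSet.univ]
  refine Lp.ext (((memLp_specFun hR MeasurableSet.univ f).coeFn_toLp).trans ?_)
  refine EventuallyEq.trans (Eventually.of_forall fun p => ?_) (f.coeFn_toLp 2 volume).symm
  rw [specFun, univ_inter, integral_P hR]

lemma specProj_union (hR : ∀ ω : S, IsAdaptedRotation (ω : V) (R ω)) {B C : Set ℝ}
    (hB : MeasurableSet B) (hC : MeasurableSet C) (hBC : Disjoint B C) (u : L2G) :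
    specProj hR (B ∪ C) u = specProj hR B u + specProj hR C u := by
  refine denseRange_toL2.induction_on (p := fun u => specProj hR (B ∪ C) u
    = specProj hR B u + specProj hR C u) u (isClosed_eq (by fun_prop) (by fun_prop)) fun f => ?_
  rw [specProj_toL2 hR (hB.union hC), specProj_toL2 hR hB, specProj_toL2 hR hC]
  refine Eq.trans ?_ (MemLp.toLp_add (memLp_specFun hR hB f) (memLp_specFun hR hC f))
  refine MemLp.toLp_congr (memLp_specFun hR (hB.union hC) f)
    ((memLp_specFun hR hB f).add (memLp_specFun hR hC f)) (Eventually.of_forall fun p => ?_)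
  have h := integrableOn_P hR f p
  rw [specFun, union_inter_distrib_right, Pi.add_apply]
  exact setIntegral_union (hBC.mono inter_subset_left inter_subset_left)
    (hC.inter measurableSet_Ioi) (h.mono_set inter_subset_right) (h.mono_set inter_subset_right)

end FreeTwoStep
end

noncomputable section
namespace FreeTwoStep
open Filter Topology

/-! ### Convolution of Schwartz functions with bounded kernels -/

lemma norm_bracket_le (X Y : V) : ‖bracket X Y‖ ≤ ‖bracketL‖ * ‖X‖ * ‖Y‖ := by
  rw [← bracketL_apply]
  exact bracketL.le_opNorm₂ X Y

/-- The linear part of the affine map `p ↦ gmul p (-q)`. -/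
def divLin (q : G) : G →L[ℝ] G :=
  ContinuousLinearMap.id ℝ G + (2⁻¹ : ℝ) • (ContinuousLinearMap.inr ℝ V V).comp
    ((bracketL q.1).comp (ContinuousLinearMap.fst ℝ V V))

lemma continuous_divLin : Continuous divLin := by
  unfold divLin
  fun_prop

lemma gmul_neg_eq (p q : G) : gmul p (-q) = divLin q p - q := by
  ext1
  · simp [divLin, gmul, sub_eq_add_neg]
  · simp only [gmul, divLin, Prod.fst_neg, Prod.snd_neg, bracket_neg_right, add_apply,
      ContinuousLinearMap.id_apply, smul_apply, ContinuousLinearMap.comp_apply,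
      ContinuousLinearMap.inr_apply, ContinuousLinearMap.coe_fst', bracketL_apply, Prod.snd_sub,
      Prod.snd_add, Prod.smul_snd]
    rw [bracket_skew q.1 p.1]
    abel

lemma exists_norm_divLin_le : ∃ C : ℝ, 0 ≤ C ∧ ∀ q, ‖divLin q‖ ≤ C * (1 + ‖q‖) := by
  refine ⟨1 + ‖bracketL‖, by positivity, fun q => ?_⟩
  refine ContinuousLinearMap.opNorm_le_bound _ (by positivity) fun h => ?_
  have h1 : ‖((0, bracket q.1 h.1) : G)‖ ≤ ‖bracketL‖ * ‖q‖ * ‖h‖ := by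
    rw [Prod.norm_def, norm_zero, max_eq_right (norm_nonneg _)]
    refine (norm_bracket_le _ _).trans ?_
    gcongr
    · exact norm_fst_le q
    · exact norm_fst_le h
  have h2 : divLin q h = h + (2⁻¹ : ℝ) • ((0, bracket q.1 h.1) : G) := by
    simp [divLin, bracketL_apply]
  rw [h2]
  refine (norm_add_le _ _).trans ?_
  rw [norm_smul, Real.norm_of_nonneg (by norm_num)]
  have := norm_nonneg bracketL
  have := norm_nonneg q
  have := norm_nonneg h
  have h3 : 0 ≤ ‖bracketL‖ * ‖q‖ * ‖h‖ := by positivity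
  nlinarith [mul_nonneg (norm_nonneg bracketL) (norm_nonneg h), mul_nonneg (norm_nonneg q)
    (norm_nonneg h)]

/-- With `r = pq⁻¹` one has `q = r⁻¹p`, whose size is at most linear in `r` for bounded `p`. Decay
of `f` at `pq⁻¹` is therefore decay in `q`. -/
lemma exists_norm_le_gmul_neg (M : ℝ) (hM : 0 ≤ M) : ∃ C : ℝ, 0 < C ∧ ∀ p q : G, ‖p‖ ≤ M →
    1 + ‖q‖ ≤ C * (1 + ‖gmul p (-q)‖) := by
  obtain ⟨C, hC, h⟩ := exists_norm_divLin_le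
  refine ⟨1 + C * M + 1, by positivity, fun p q hp => ?_⟩
  set r := gmul p (-q) with hr
  have h1 : q = -gmul (-p) (-(-r)) := by
    rw [hr, neg_neg, neg_gmul, neg_neg, neg_gmul, neg_neg, gmul_neg_cancel]
  have h3 : ‖q‖ ≤ C * (1 + ‖r‖) * M + ‖r‖ := by
    rw [h1, norm_neg, gmul_neg_eq]
    refine (norm_sub_le _ _).trans (add_le_add ?_ (norm_neg r).le)
    refine ((divLin (-r)).le_opNorm (-p)).trans ?_
    have := h (-r)
    rw [norm_neg] at this
    rw [norm_neg]
    gcongr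
  have := norm_nonneg r
  nlinarith [mul_nonneg hM hC]

/-- Uniform decay of the translates of a Schwartz function. -/
lemma exists_norm_translate_le {E : Type*} [NormedAddCommGroup E] [NormedSpace ℝ E]
    (F : 𝓢(G, E)) (N : ℕ) {M : ℝ} (hM : 0 ≤ M) : ∃ C : ℝ, 0 ≤ C ∧ ∀ p q : G, ‖p‖ ≤ M →
      ‖F (gmul p (-q))‖ ≤ C * ((1 + ‖q‖) ^ N)⁻¹ := by
  obtain ⟨C, hC, h⟩ := exists_norm_le_gmul_neg M hM
  obtain ⟨D, hD⟩ : ∃ D : ℝ, ∀ r, (1 + ‖r‖) ^ N * ‖F r‖ ≤ D := by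
    refine ⟨2 ^ N * ((Finset.Iic (N, 0)).sup fun m => SchwartzMap.seminorm ℝ m.1 m.2) F,
      fun r => ?_⟩
    have := SchwartzMap.one_add_le_sup_seminorm_apply (𝕜 := ℝ) (m := (N, 0)) le_rfl le_rfl F r
    rw [norm_iteratedFDeriv_zero] at this
    exact this
  have hD0 : 0 ≤ D := le_trans (by positivity) (hD 0)
  refine ⟨C ^ N * D, by positivity, fun p q hp => ?_⟩
  rw [← div_eq_mul_inv, le_div_iff₀' (by positivity)]
  calc (1 + ‖q‖) ^ N * ‖F (gmul p (-q))‖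
      ≤ (C * (1 + ‖gmul p (-q)‖)) ^ N * ‖F (gmul p (-q))‖ := by gcongr; exact h p q hp
    _ = C ^ N * ((1 + ‖gmul p (-q)‖) ^ N * ‖F (gmul p (-q))‖) := by rw [mul_pow, mul_assoc]
    _ ≤ C ^ N * D := by gcongr; exact hD _

/-- The exponent exceeds `dim G = 6`. -/
lemma integrable_weight_G : Integrable fun q : G => ((1 + ‖q‖) ^ 7)⁻¹ := by
  have h := integrable_one_add_norm (E := G) (μ := volume) (r := 7) (by
    rw [Module.finrank_prod, finrank_V]; norm_num)
  refine h.congr (Eventually.of_forall fun q => ?_)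
  beta_reduce
  rw [Real.rpow_neg (by positivity)]
  norm_cast

/-- Differentiation under the integral for locally uniformly dominated families. -/
lemma hasFDerivAt_integral_family {E : Type*} [NormedAddCommGroup E] [NormedSpace ℝ E]
    [CompleteSpace E] {g : G → G → E} {g' : G → G → G →L[ℝ] E}
    (hg : ∀ q p, HasFDerivAt (g q) (g' q p) p)
    (hm : ∀ p, AEStronglyMeasurable fun q => g q p)
    (hm' : ∀ p, AEStronglyMeasurable fun q => g' q p)
    (hb : ∀ M : ℝ, 0 ≤ M → ∃ C : ℝ, ∀ p q, ‖p‖ ≤ M → ‖g q p‖ ≤ C * ((1 + ‖q‖) ^ 7)⁻¹)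
    (hb' : ∀ M : ℝ, 0 ≤ M → ∃ C : ℝ, ∀ p q, ‖p‖ ≤ M → ‖g' q p‖ ≤ C * ((1 + ‖q‖) ^ 7)⁻¹)
    (p : G) : HasFDerivAt (fun p => ∫ q, g q p) (∫ q, g' q p) p := by
  obtain ⟨C, hC⟩ := hb ‖p‖ (norm_nonneg p)
  obtain ⟨C', hC'⟩ := hb' (‖p‖ + 1) (by positivity)
  refine hasFDerivAt_integral_of_dominated_of_fderiv_le (F := fun p q => g q p)
    (F' := fun p q => g' q p) (bound := fun q => C' * ((1 + ‖q‖) ^ 7)⁻¹)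
    (Metric.ball_mem_nhds p one_pos)
    (Eventually.of_forall hm) ?_ (hm' p) (Eventually.of_forall fun q x hx => hC' x q ?_)
    (integrable_weight_G.const_mul _) (Eventually.of_forall fun q x _ => hg q x)
  · exact (integrable_weight_G.const_mul C).mono' (hm p)
      (Eventually.of_forall fun q => hC p q le_rfl)
  · rw [mem_ball_iff_norm] at hx
    have := norm_le_norm_add_norm_sub' x p
    linarith

lemma continuous_integral_family {E : Type*} [NormedAddCommGroup E] [NormedSpace ℝ E]
    {g : G → G → E} (hg : ∀ q, Continuous (g q)) (hm : ∀ p, AEStronglyMeasurable fun q => g q p)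
    (hb : ∀ M : ℝ, 0 ≤ M → ∃ C : ℝ, ∀ p q, ‖p‖ ≤ M → ‖g q p‖ ≤ C * ((1 + ‖q‖) ^ 7)⁻¹) :
    Continuous fun p => ∫ q, g q p := by
  refine continuous_iff_continuousAt.2 fun p => ?_
  obtain ⟨C, hC⟩ := hb (‖p‖ + 1) (by positivity)
  refine continuousAt_of_dominated (bound := fun q => C * ((1 + ‖q‖) ^ 7)⁻¹)
    (Eventually.of_forall hm) ?_ (integrable_weight_G.const_mul _)
    (Eventually.of_forall fun q => (hg q).continuousAt)
  filter_upwards [Metric.ball_mem_nhds p one_pos] with x hx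
  refine Eventually.of_forall fun q => hC x q ?_
  rw [mem_ball_iff_norm] at hx
  have := norm_le_norm_add_norm_sub' x p
  linarith

/-- The first derivative of `p ↦ f (gmul p (-q))`. -/
def divDeriv (f : 𝓢(G, ℂ)) (q p : G) : G →L[ℝ] ℂ :=
  (SchwartzMap.fderivCLM ℝ G ℂ f (gmul p (-q))).comp (divLin q)

/-- The second derivative of `p ↦ f (gmul p (-q))`. -/
def divDeriv₂ (f : 𝓢(G, ℂ)) (q p : G) : G →L[ℝ] G →L[ℝ] ℂ :=
  ((ContinuousLinearMap.compL ℝ G G ℂ).flip (divLin q)).comp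
    ((SchwartzMap.fderivCLM ℝ G (G →L[ℝ] ℂ) (SchwartzMap.fderivCLM ℝ G ℂ f)
      (gmul p (-q))).comp (divLin q))

lemma hasFDerivAt_translate {E : Type*} [NormedAddCommGroup E] [NormedSpace ℝ E]
    (F : 𝓢(G, E)) (q p : G) : HasFDerivAt (fun p => F (gmul p (-q)))
      ((SchwartzMap.fderivCLM ℝ G E F (gmul p (-q))).comp (divLin q)) p := by
  have h1 : HasFDerivAt (fun p => gmul p (-q)) (divLin q) p := by
    simp_rw [gmul_neg_eq]
    exact (divLin q).hasFDerivAt.sub_const q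
  exact (F.hasFDerivAt (x := gmul p (-q))).comp p h1

lemma hasFDerivAt_divDeriv (f : 𝓢(G, ℂ)) (q p : G) :
    HasFDerivAt (divDeriv f q) (divDeriv₂ f q p) p := by
  have h := hasFDerivAt_translate (SchwartzMap.fderivCLM ℝ G ℂ f) q p
  exact ((ContinuousLinearMap.compL ℝ G G ℂ).flip (divLin q)).hasFDerivAt.comp p h

lemma continuous_divDeriv (f : 𝓢(G, ℂ)) : Continuous fun z : G × G => divDeriv f z.1 z.2 := by
  have h := continuous_divLin
  have h1 := (SchwartzMap.fderivCLM ℝ G ℂ f).continuous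
  unfold divDeriv
  fun_prop

lemma continuous_divDeriv₂ (f : 𝓢(G, ℂ)) : Continuous fun z : G × G => divDeriv₂ f z.1 z.2 := by
  have h := continuous_divLin
  have h1 := (SchwartzMap.fderivCLM ℝ G (G →L[ℝ] ℂ) (SchwartzMap.fderivCLM ℝ G ℂ f)).continuous
  unfold divDeriv₂
  fun_prop

/-- Each differentiation in `p` costs a factor `1 + ‖q‖`, the growth of `divLin q`. Hence decay of
order `8` is used here and `9` for the second derivative. -/
lemma exists_norm_divDeriv_le (f : 𝓢(G, ℂ)) {M : ℝ} (hM : 0 ≤ M) : ∃ C : ℝ, ∀ p q, ‖p‖ ≤ M →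
    ‖divDeriv f q p‖ ≤ C * ((1 + ‖q‖) ^ 7)⁻¹ := by
  obtain ⟨A, hA, h⟩ := exists_norm_divLin_le
  obtain ⟨C, hC, h1⟩ := exists_norm_translate_le (SchwartzMap.fderivCLM ℝ G ℂ f) 8 hM
  refine ⟨C * A, fun p q hp => ?_⟩
  calc ‖divDeriv f q p‖ ≤ (C * ((1 + ‖q‖) ^ 8)⁻¹) * (A * (1 + ‖q‖)) := by
        refine (ContinuousLinearMap.opNorm_comp_le _ _).trans ?_
        gcongr
        · exact h1 p q hp
        · exact h q
    _ = _ := by field_simp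

lemma exists_norm_divDeriv₂_le (f : 𝓢(G, ℂ)) {M : ℝ} (hM : 0 ≤ M) : ∃ C : ℝ, ∀ p q, ‖p‖ ≤ M →
    ‖divDeriv₂ f q p‖ ≤ C * ((1 + ‖q‖) ^ 7)⁻¹ := by
  obtain ⟨A, hA, h⟩ := exists_norm_divLin_le
  obtain ⟨C, hC, h1⟩ := exists_norm_translate_le (SchwartzMap.fderivCLM ℝ G (G →L[ℝ] ℂ)
    (SchwartzMap.fderivCLM ℝ G ℂ f)) 9 hM
  refine ⟨C * A ^ 2, fun p q hp => ?_⟩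
  calc ‖divDeriv₂ f q p‖ ≤ (C * ((1 + ‖q‖) ^ 9)⁻¹) * (A * (1 + ‖q‖)) * (A * (1 + ‖q‖)) := by
        refine ContinuousLinearMap.opNorm_le_bound _ (by positivity) fun v => ?_
        refine (ContinuousLinearMap.opNorm_comp_le _ _).trans ?_
        rw [mul_right_comm]
        gcongr
        · refine (ContinuousLinearMap.le_opNorm _ _).trans ?_
          gcongr
          refine (ContinuousLinearMap.opNorm_comp_le _ _).trans ?_
          gcongr
          · exact h1 p q hp
          · exact h q
        · exact h q
    _ = _ := by field_simp

/-- The second derivative along a line. -/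
lemma deriv_deriv_line {F : G → ℂ} {F' : G → G →L[ℝ] ℂ} {F'' : G → G →L[ℝ] G →L[ℝ] ℂ}
    (h : ∀ p, HasFDerivAt F (F' p) p) (h' : ∀ p, HasFDerivAt F' (F'' p) p) (p d : G) :
    deriv (deriv fun t : ℝ => F (p + t • d)) 0 = F'' p d d := by
  have hl : ∀ t : ℝ, HasDerivAt (fun t : ℝ => p + t • d) d t := fun t => by
    simpa using ((hasDerivAt_id t).smul_const d).const_add p
  have h1 : deriv (fun t : ℝ => F (p + t • d)) = fun t => F' (p + t • d) d :=
    funext fun t => ((h _).comp_hasDerivAt t (hl t)).deriv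
  rw [h1]
  have h2 : HasDerivAt (fun t : ℝ => F' (p + t • d)) (F'' (p + (0 : ℝ) • d) d) 0 :=
    (h' _).comp_hasDerivAt 0 (hl 0)
  have h3 := ((ContinuousLinearMap.apply ℝ ℂ d).hasFDerivAt.comp_hasDerivAt 0 h2).deriv
  rw [zero_smul, add_zero] at h3
  exact h3

lemma subLaplacian_eq_of_hasFDerivAt {F : G → ℂ} {F' : G → G →L[ℝ] ℂ}
    {F'' : G → G →L[ℝ] G →L[ℝ] ℂ} (h : ∀ p, HasFDerivAt F (F' p) p)
    (h' : ∀ p, HasFDerivAt F' (F'' p) p) (p : G) :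
    subLaplacian F p = -∑ a, F'' p (leftDir a p) (leftDir a p) := by
  simp only [subLaplacian, leftField_leftField, gmul_single, deriv_deriv_line h h']

/-- The Schwartz function `q ↦ f (gmul p (-q))`. -/
def divS (f : 𝓢(G, ℂ)) (p : G) : 𝓢(G, ℂ) :=
  SchwartzMap.compCLM ℝ (g := fun q => gmul p (-q))
    ((hasTemperateGrowth_gmul p).comp (-ContinuousLinearMap.id ℝ G).hasTemperateGrowth) (by
      obtain ⟨C, hC, h⟩ := exists_norm_le_gmul_neg ‖p‖ (norm_nonneg p)
      refine ⟨1, C, fun q => ?_⟩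
      have := h p q le_rfl
      rw [pow_one]
      linarith) f

lemma divS_apply (f : 𝓢(G, ℂ)) (p q : G) : divS f p q = f (gmul p (-q)) := rfl

/-- Since `p (q exp(tX_a))⁻¹ = p exp(-tX_a) q⁻¹`, moving `q` along the field moves `p` backwards
along it, and the sign disappears in second derivatives. So `L` in `q` equals `L` in `p`. -/
lemma subLaplacianS_divS (f : 𝓢(G, ℂ)) (p q : G) :
    subLaplacianS (divS f p) q = -∑ a, divDeriv₂ f q p (leftDir a p) (leftDir a p) := by
  rw [← subLaplacian_coe]
  simp only [subLaplacian, leftField_leftField]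
  congr 1
  refine Finset.sum_congr rfl fun a _ => ?_
  have h := deriv_deriv_line (fun p => hasFDerivAt_translate f q p)
    (fun p => hasFDerivAt_divDeriv f q p) p (-leftDir a p)
  have e : divDeriv₂ f q p (-leftDir a p) (-leftDir a p)
      = divDeriv₂ f q p (leftDir a p) (leftDir a p) := by
    rw [map_neg, map_neg, neg_apply, neg_neg]
  rw [e] at h
  rw [← h]
  congr 2
  funext t
  rw [divS_apply, neg_gmul, ← gmul_assoc]
  congr 2
  rw [smul_neg, ← neg_smul, ← gmul_single]
  congr 1
  simp

section
variable {E : Type*} [NormedAddCommGroup E] [NormedSpace ℂ E] {K : G → ℂ}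

lemma norm_kernel_smul_le {c : ℝ} (hc : ∀ q, ‖K q‖ ≤ c) {g : G → G → E}
    (hb : ∀ M : ℝ, 0 ≤ M → ∃ C : ℝ, ∀ p q, ‖p‖ ≤ M → ‖g q p‖ ≤ C * ((1 + ‖q‖) ^ 7)⁻¹) (M : ℝ)
    (hM : 0 ≤ M) : ∃ C : ℝ, ∀ p q, ‖p‖ ≤ M → ‖K q • g q p‖ ≤ C * ((1 + ‖q‖) ^ 7)⁻¹ := by
  obtain ⟨C, h⟩ := hb M hM
  refine ⟨c * C, fun p q hp => ?_⟩
  rw [norm_smul, mul_assoc]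
  exact mul_le_mul (hc q) (h p q hp) (norm_nonneg _) ((norm_nonneg _).trans (hc 0))

lemma aestronglyMeasurable_kernel_smul (hK : AEStronglyMeasurable K) {g : G → G → E}
    (hg : Continuous fun z : G × G => g z.1 z.2) (p : G) :
    AEStronglyMeasurable fun q => K q • g q p :=
  hK.smul (hg.comp (Continuous.prodMk_left p)).aestronglyMeasurable

lemma integrable_kernel_smul (hK : AEStronglyMeasurable K) {c : ℝ} (hc : ∀ q, ‖K q‖ ≤ c)
    {g : G → G → E} (hg : Continuous fun z : G × G => g z.1 z.2)
    (hb : ∀ M : ℝ, 0 ≤ M → ∃ C : ℝ, ∀ p q, ‖p‖ ≤ M → ‖g q p‖ ≤ C * ((1 + ‖q‖) ^ 7)⁻¹) (p : G) :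
    Integrable fun q => K q • g q p := by
  obtain ⟨C, h⟩ := norm_kernel_smul_le hc hb ‖p‖ (norm_nonneg p)
  exact (integrable_weight_G.const_mul C).mono' (aestronglyMeasurable_kernel_smul hK hg p)
    (Eventually.of_forall fun q => h p q le_rfl)

lemma continuous_kernel_smul [NormedSpace ℝ E] (hK : AEStronglyMeasurable K) {c : ℝ} (hc : ∀ q, ‖K q‖ ≤ c)
    {g : G → G → E} (hg : Continuous fun z : G × G => g z.1 z.2)
    (hb : ∀ M : ℝ, 0 ≤ M → ∃ C : ℝ, ∀ p q, ‖p‖ ≤ M → ‖g q p‖ ≤ C * ((1 + ‖q‖) ^ 7)⁻¹) :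
    Continuous fun p => ∫ q, K q • g q p :=
  continuous_integral_family
    (fun q => (hg.comp (Continuous.prodMk_right q)).const_smul (K q))
    (aestronglyMeasurable_kernel_smul hK hg) (norm_kernel_smul_le hc hb)

lemma hasFDerivAt_kernel_smul [NormedSpace ℝ E] [SMulCommClass ℝ ℂ E] [CompleteSpace E]
    (hK : AEStronglyMeasurable K) {c : ℝ}
    (hc : ∀ q, ‖K q‖ ≤ c) {g : G → G → E} {g' : G → G → G →L[ℝ] E}
    (hd : ∀ q p, HasFDerivAt (g q) (g' q p) p)
    (hg : Continuous fun z : G × G => g z.1 z.2) (hg' : Continuous fun z : G × G => g' z.1 z.2)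
    (hb : ∀ M : ℝ, 0 ≤ M → ∃ C : ℝ, ∀ p q, ‖p‖ ≤ M → ‖g q p‖ ≤ C * ((1 + ‖q‖) ^ 7)⁻¹)
    (hb' : ∀ M : ℝ, 0 ≤ M → ∃ C : ℝ, ∀ p q, ‖p‖ ≤ M → ‖g' q p‖ ≤ C * ((1 + ‖q‖) ^ 7)⁻¹) (p : G) :
    HasFDerivAt (fun p => ∫ q, K q • g q p) (∫ q, K q • g' q p) p :=
  hasFDerivAt_integral_family (g' := fun q p => K q • g' q p)
    (fun q p => (hd q p).const_smul (K q))
    (aestronglyMeasurable_kernel_smul hK hg) (aestronglyMeasurable_kernel_smul hK hg')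
    (norm_kernel_smul_le hc hb) (norm_kernel_smul_le hc hb') p

end

variable {K : G → ℂ}

lemma kernel_hasFDerivAt (hK : AEStronglyMeasurable K) {c : ℝ} (hc : ∀ q, ‖K q‖ ≤ c)
    (f : 𝓢(G, ℂ)) (p : G) : HasFDerivAt (fun p => ∫ q, K q • f (gmul p (-q)))
      (∫ q, K q • divDeriv f q p) p :=
  hasFDerivAt_kernel_smul hK hc (g := fun q p => f (gmul p (-q))) (hasFDerivAt_translate f)
    (f.continuous.comp (by fun_prop)) (continuous_divDeriv f)
    (fun _ hM => (exists_norm_translate_le f 7 hM).imp fun _ h => h.2)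
    (fun _ hM => exists_norm_divDeriv_le f hM) p

lemma kernel_hasFDerivAt₂ (hK : AEStronglyMeasurable K) {c : ℝ} (hc : ∀ q, ‖K q‖ ≤ c)
    (f : 𝓢(G, ℂ)) (p : G) : HasFDerivAt (fun p => ∫ q, K q • divDeriv f q p)
      (∫ q, K q • divDeriv₂ f q p) p :=
  hasFDerivAt_kernel_smul hK hc (hasFDerivAt_divDeriv f)
    (continuous_divDeriv f) (continuous_divDeriv₂ f)
    (fun _ hM => exists_norm_divDeriv_le f hM) (fun _ hM => exists_norm_divDeriv₂_le f hM) p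

lemma contDiff_two_kernel (hK : AEStronglyMeasurable K) {c : ℝ} (hc : ∀ q, ‖K q‖ ≤ c)
    (f : 𝓢(G, ℂ)) : ContDiff ℝ 2 fun p => ∫ q, K q • f (gmul p (-q)) := by
  have h1 : ContDiff ℝ 1 fun p => ∫ q, K q • divDeriv f q p :=
    contDiff_one_iff_hasFDerivAt.2 ⟨_, continuous_kernel_smul hK hc (continuous_divDeriv₂ f)
      (fun _ hM => exists_norm_divDeriv₂_le f hM), kernel_hasFDerivAt₂ hK hc f⟩
  exact contDiff_succ_iff_hasFDerivAt (n := 1).2 ⟨_, h1, kernel_hasFDerivAt hK hc f⟩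

/-- The subLaplacian of a convolution with a bounded kernel. -/
lemma subLaplacian_kernel (hK : AEStronglyMeasurable K) {c : ℝ} (hc : ∀ q, ‖K q‖ ≤ c)
    (f : 𝓢(G, ℂ)) (p : G) : subLaplacian (fun p => ∫ q, K q • f (gmul p (-q))) p
      = ∫ q, K q * subLaplacianS (divS f p) q := by
  rw [subLaplacian_eq_of_hasFDerivAt (kernel_hasFDerivAt hK hc f) (kernel_hasFDerivAt₂ hK hc f)]
  have hi := integrable_kernel_smul (E := G →L[ℝ] G →L[ℝ] ℂ) hK hc (continuous_divDeriv₂ f)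
    (fun _ hM => exists_norm_divDeriv₂_le f hM) p
  have h1 : ∀ a, (∫ q, K q • divDeriv₂ f q p) (leftDir a p) (leftDir a p)
      = ∫ q, K q * divDeriv₂ f q p (leftDir a p) (leftDir a p) := by
    intro a
    rw [ContinuousLinearMap.integral_apply hi,
      ContinuousLinearMap.integral_apply (hi.apply_continuousLinearMap _)]
    rfl
  simp only [h1, subLaplacianS_divS]
  rw [← integral_finsetSum, ← integral_neg]
  · simp only [mul_neg, Finset.mul_sum]
  · intro a _
    exact (hi.apply_continuousLinearMap _).apply_continuousLinearMap _

end FreeTwoStep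
end

noncomputable section
namespace FreeTwoStep
open Filter Topology

/-! ### The eigenfunction equation for `𝒫_μ f` -/

variable {R : S → V ≃ₗᵢ[ℝ] V}

/-- The eigenfunction with parameters `(ω, k, ξ)` and eigenvalue `μ`. -/
def waveAt (μ : ℝ) (x : S × ℕ × ℝ) (q : G) : ℂ :=
  wave x.1 |(μ - x.2.2 ^ 2) / (2 * x.2.1 + 1)| x.2.1 x.2.2 q

/-- The weight of the eigenfunction `waveAt μ x`. -/
def weight (μ : ℝ) (x : S × ℕ × ℝ) : ℝ :=
  if x.2.2 ^ 2 < μ then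
    ((2 * x.2.1 + 1 : ℝ) ^ 3)⁻¹ * (μ - x.2.2 ^ 2) ^ 2
      * ((μ - x.2.2 ^ 2) / (2 * x.2.1 + 1) / (2 * Real.pi))
  else 0

lemma density_eq_weight (f : G → ℂ) (p : G) (μ : ℝ) (x : S × ℕ × ℝ) :
    density f p μ x = weight μ x * ∫ q, f (gmul p (-q)) * waveAt μ x q := by
  by_cases h : x.2.2 ^ 2 < μ
  · have h0 : 0 < (μ - x.2.2 ^ 2) / (2 * x.2.1 + 1) := div_pos (by linarith) (by positivity)
    simp only [density_eq f p h, weight, if_pos h, coeff, waveAt, abs_of_pos h0]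
    push_cast
    ring
  · rw [density_eq_zero f p (not_lt.1 h), weight, if_neg h]
    simp

lemma norm_waveAt_le (μ : ℝ) (x : S × ℕ × ℝ) (q : G) : ‖waveAt μ x q‖ ≤ 1 :=
  norm_wave_le (norm_eq_of_mem_sphere x.1) (abs_nonneg _) _ _ _

lemma hasTemperateGrowth_waveAt (μ : ℝ) (x : S × ℕ × ℝ) : (waveAt μ x).HasTemperateGrowth :=
  hasTemperateGrowth_wave (norm_eq_of_mem_sphere x.1) (abs_nonneg _) _ _

lemma subLaplacian_waveAt {μ : ℝ} {x : S × ℕ × ℝ} (h : x.2.2 ^ 2 < μ) (q : G) :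
    subLaplacian (waveAt μ x) q = (μ : ℂ) * waveAt μ x q := by
  have h0 : 0 < (μ - x.2.2 ^ 2) / (2 * x.2.1 + 1) := div_pos (by linarith) (by positivity)
  have h1 : (2 * x.2.1 + 1 : ℝ) ≠ 0 := by positivity
  have h2 := subLaplacian_wave (norm_eq_of_mem_sphere x.1)
    |(μ - x.2.2 ^ 2) / (2 * x.2.1 + 1)| x.2.1 x.2.2 q
  rw [abs_of_pos h0, div_mul_cancel₀ _ h1, sub_add_cancel] at h2
  have h3 : waveAt μ x = wave x.1 ((μ - x.2.2 ^ 2) / (2 * x.2.1 + 1)) x.2.1 x.2.2 := by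
    funext q
    rw [waveAt, abs_of_pos h0]
  rw [h3]
  exact h2

lemma measurable_wave {α : Type*} [MeasurableSpace α] {ω : α → S} {lam ξ : α → ℝ} {k : α → ℕ}
    {q : α → G} (hω : Measurable ω) (hlam : Measurable lam) (hk : Measurable k)
    (hξ : Measurable ξ) (hq : Measurable q) :
    Measurable fun a => wave (ω a) (lam a) (k a) (ξ a) (q a) := by
  have h : Measurable fun x : (S × ℝ × ℝ × G) × ℕ =>
      wave (x.1.1 : V) x.1.2.1 x.2 x.1.2.2.1 x.1.2.2.2 := by
    refine measurable_from_prod_countable_left fun k => ?_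
    refine Continuous.measurable (α := S × ℝ × ℝ × G) ?_
    exact continuous_wave (ω := fun x : S × ℝ × ℝ × G => (x.1 : V))
      (continuous_subtype_val.comp continuous_fst) (continuous_fst.comp continuous_snd) k
      (continuous_fst.comp (continuous_snd.comp continuous_snd))
      (continuous_snd.comp (continuous_snd.comp continuous_snd))
  have h' := h.comp ((hω.prodMk (hlam.prodMk (hξ.prodMk hq))).prodMk hk)
  simp only [Function.comp_def] at h'
  exact h'

lemma measurable_waveAt {α : Type*} [MeasurableSpace α] (μ : ℝ) {x : α → S × ℕ × ℝ} {q : α → G}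
    (hx : Measurable x) (hq : Measurable q) : Measurable fun a => waveAt μ (x a) (q a) := by
  have h1 : Measurable fun a => (((x a).2.1 : ℕ) : ℝ) := measurable_natCast_real.comp hx.snd.fst
  have h2 : Measurable fun a => (x a).2.2 := hx.snd.snd
  unfold waveAt
  exact measurable_wave hx.fst (by fun_prop) hx.snd.fst h2 hq

lemma measurable_weight (μ : ℝ) : Measurable (weight μ) := by
  have h1 : Measurable fun x : S × ℕ × ℝ => ((x.2.1 : ℕ) : ℝ) :=
    measurable_natCast_real.comp (by fun_prop)
  unfold weight
  exact Measurable.ite (measurableSet_lt (by fun_prop) measurable_const) (by fun_prop)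
    measurable_const

lemma integrable_weight (μ : ℝ) : Integrable (weight μ) paramMeasure := by
  refine (integrable_majorant.const_mul (|μ| ^ 3 * (1 + |μ|))).mono'
    (measurable_weight μ).aestronglyMeasurable (Eventually.of_forall fun x => ?_)
  have hm := majorant_nonneg x
  by_cases h : x.2.2 ^ 2 < μ
  · have hμ : 0 < μ := lt_of_le_of_lt (sq_nonneg _) h
    have hk : (0 : ℝ) ≤ x.2.1 := Nat.cast_nonneg _
    have hd : 0 < μ - x.2.2 ^ 2 := by linarith
    have hd' : μ - x.2.2 ^ 2 ≤ μ := by linarith [sq_nonneg x.2.2]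
    have hpi : (1 : ℝ) ≤ 2 * Real.pi := by linarith [Real.pi_gt_three]
    rw [weight, if_pos h, Real.norm_of_nonneg (by positivity), abs_of_pos hμ, majorant]
    calc ((2 * x.2.1 + 1 : ℝ) ^ 3)⁻¹ * (μ - x.2.2 ^ 2) ^ 2
          * ((μ - x.2.2 ^ 2) / (2 * x.2.1 + 1) / (2 * Real.pi))
        ≤ ((2 * x.2.1 + 1 : ℝ) ^ 2)⁻¹ * μ ^ 2 * (μ / 1 / 1) := by
          gcongr
          · linarith
          · norm_num
          · linarith
      _ = μ ^ 3 * 1 * ((2 * x.2.1 + 1 : ℝ) ^ 2)⁻¹ := by ring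
      _ ≤ μ ^ 3 * ((1 + μ) * (1 + x.2.2 ^ 2)⁻¹) * ((2 * x.2.1 + 1 : ℝ) ^ 2)⁻¹ := by
          gcongr
          rw [← div_eq_mul_inv, le_div_iff₀ (by positivity)]
          linarith
      _ = _ := by ring
  · rw [weight, if_neg h, norm_zero]
    positivity

/-- The convolution kernel of `𝒫_μ`. -/
def kernel (μ : ℝ) (q : G) : ℂ := cst * ∫ x, weight μ x * waveAt μ x q ∂paramMeasure

lemma measurable_kernel (μ : ℝ) : Measurable (kernel μ) := by
  have h : Measurable (Function.uncurry fun (q : G) (x : S × ℕ × ℝ) =>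
      (weight μ x : ℂ) * waveAt μ x q) :=
    (Complex.measurable_ofReal.comp ((measurable_weight μ).comp measurable_snd)).mul
      (measurable_waveAt μ measurable_snd measurable_fst)
  exact h.stronglyMeasurable.integral_prod_right.measurable.const_mul cst

lemma exists_norm_kernel_le (μ : ℝ) : ∃ c : ℝ, ∀ q, ‖kernel μ q‖ ≤ c := by
  refine ⟨‖cst‖ * ∫ x, ‖weight μ x‖ ∂paramMeasure, fun q => ?_⟩
  rw [kernel, norm_mul]
  gcongr
  refine norm_integral_le_of_norm_le (integrable_weight μ).norm (Eventually.of_forall fun x => ?_)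
  rw [norm_mul, Complex.norm_real]
  exact mul_le_of_le_one_right (norm_nonneg _) (norm_waveAt_le μ x q)

lemma integral_kernel_mul (μ : ℝ) {φ : G → ℂ} (hφ : Integrable φ) :
    ∫ q, kernel μ q * φ q
      = cst * ∫ x, weight μ x * ∫ q, φ q * waveAt μ x q ∂volume ∂paramMeasure := by
  have h1 : Integrable (fun z : (S × ℕ × ℝ) × G => ((weight μ z.1 : ℂ) * φ z.2)
      * waveAt μ z.1 z.2) (paramMeasure.prod volume) :=
    ((integrable_weight μ).ofReal.mul_prod hφ).mul_bdd (c := 1)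
      (measurable_waveAt μ measurable_fst measurable_snd).aestronglyMeasurable
      (Eventually.of_forall fun z => norm_waveAt_le μ z.1 z.2)
  have h2 := integral_integral_swap (f := fun x q => ((weight μ x : ℂ) * φ q) * waveAt μ x q) h1
  have h3 : ∀ x, ∫ q, ((weight μ x : ℂ) * φ q) * waveAt μ x q
      = weight μ x * ∫ q, φ q * waveAt μ x q := by
    intro x
    simp_rw [mul_assoc]
    exact integral_const_mul _ _
  simp_rw [h3] at h2
  rw [h2, ← integral_const_mul]
  refine integral_congr_ae (Eventually.of_forall fun q => ?_)
  simp only [kernel, mul_assoc]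
  rw [← integral_mul_const]
  congr 1
  refine integral_congr_ae (Eventually.of_forall fun x => ?_)
  simp only
  ring

/-- Only boundedness and measurability of the kernel are needed in this form, because the
derivatives in `p` fall on `f`. -/
lemma P_eq_kernel (hR : ∀ ω : S, IsAdaptedRotation (ω : V) (R ω)) (f : 𝓢(G, ℂ)) (μ : ℝ) :
    P R μ f = fun p => ∫ q, kernel μ q • f (gmul p (-q)) := by
  funext p
  have h := integral_kernel_mul μ (divS f p).integrable
  simp only [divS_apply] at h
  simp only [smul_eq_mul]
  rw [h, P_eq hR]
  simp only [density_eq_weight]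

lemma contDiff_P (hR : ∀ ω : S, IsAdaptedRotation (ω : V) (R ω)) (f : 𝓢(G, ℂ)) (μ : ℝ) :
    ContDiff ℝ 2 (P R μ f) := by
  obtain ⟨c, hc⟩ := exists_norm_kernel_le μ
  rw [P_eq_kernel hR]
  exact contDiff_two_kernel (measurable_kernel μ).aestronglyMeasurable hc f

/-- The functions `𝒫_μ f` are eigenfunctions of the subLaplacian. -/
lemma subLaplacian_P (hR : ∀ ω : S, IsAdaptedRotation (ω : V) (R ω)) (f : 𝓢(G, ℂ)) (μ : ℝ)
    (p : G) : subLaplacian (P R μ f) p = (μ : ℂ) * P R μ f p := by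
  obtain ⟨c, hc⟩ := exists_norm_kernel_le μ
  -- `L` is moved onto the single wave, of eigenvalue `μ` when `ξ² < μ`; otherwise the weight is
  -- zero. The kernel itself is never differentiated.
  have h1 : ∀ x, (weight μ x : ℂ) * ∫ q, subLaplacianS (divS f p) q * waveAt μ x q
      = (μ : ℂ) * density f p μ x := by
    intro x
    rw [density_eq_weight, integral_subLaplacianS_mul _ (hasTemperateGrowth_waveAt μ x)]
    by_cases h : x.2.2 ^ 2 < μ
    · simp only [subLaplacian_waveAt h, divS_apply, mul_left_comm _ (μ : ℂ)]
      rw [integral_const_mul]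
      ring
    · simp [weight, h]
  rw [P_eq hR, P_eq_kernel hR, subLaplacian_kernel (measurable_kernel μ).aestronglyMeasurable hc,
    integral_kernel_mul μ (subLaplacianS (divS f p)).integrable]
  simp only [h1]
  rw [integral_const_mul]
  ring

end FreeTwoStep
end

noncomputable section
namespace FreeTwoStep
open Filter Topology

/-! ### The spectral measure -/

variable {R : S → V ≃ₗᵢ[ℝ] V}

lemma exists_norm_P_le (hR : ∀ ω : S, IsAdaptedRotation (ω : V) (R ω)) (h : 𝓢(G, ℂ)) :
    ∃ C : ℝ, ∀ μ p, ‖P R μ h p‖ ≤ C * ((1 + |μ|) ^ 2)⁻¹ := by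
  obtain ⟨C, hC, hb⟩ := exists_norm_density_le h
  refine ⟨‖cst‖ * (C * ∫ x, majorant x ∂paramMeasure), fun μ p => ?_⟩
  have h1 := norm_integral_le_of_norm_le (integrable_majorant.const_mul (C * ((1 + |μ|) ^ 2)⁻¹))
    (Eventually.of_forall (hb p μ))
  rw [integral_const_mul] at h1
  rw [P_eq hR, norm_mul]
  calc _ ≤ ‖cst‖ * (C * ((1 + |μ|) ^ 2)⁻¹ * ∫ x, majorant x ∂paramMeasure) := by gcongr
    _ = _ := by ring

lemma measurable_P (hR : ∀ ω : S, IsAdaptedRotation (ω : V) (R ω)) (h : 𝓢(G, ℂ)) :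
    Measurable fun z : ℝ × G => P R z.1 h z.2 := by
  have h1 : Measurable (Function.uncurry fun (z : ℝ × G) (x : S × ℕ × ℝ) =>
      density h z.2 z.1 x) :=
    measurable_density h (measurable_snd.comp measurable_fst) measurable_snd
      (measurable_fst.comp measurable_fst)
  have h2 := (h1.stronglyMeasurable.integral_prod_right (ν := paramMeasure)).measurable.const_mul cst
  simp only [P_eq hR]
  exact h2

/-- The density of the complex measure `B ↦ ⟨E(B) h, f⟩`. -/
def rho (R : S → V ≃ₗᵢ[ℝ] V) (h f : G → ℂ) (μ : ℝ) : ℂ :=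
  ∫ p, P R μ h p * starRingEnd ℂ (f p)

lemma integrable_P_mul (hR : ∀ ω : S, IsAdaptedRotation (ω : V) (R ω)) (h f : 𝓢(G, ℂ)) :
    Integrable (fun z : ℝ × G => P R z.1 h z.2 * starRingEnd ℂ (f z.2))
      (volume.prod volume) := by
  obtain ⟨C, hC⟩ := exists_norm_P_le hR h
  refine ((integrable_weight_real.const_mul C).mul_prod (f.integrable (μ := volume)).norm).mono'
    ((measurable_P hR h).mul (Complex.continuous_conj.comp
      (f.continuous.comp continuous_snd)).measurable).aestronglyMeasurable
    (Eventually.of_forall fun z => ?_)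
  rw [norm_mul, RCLike.norm_conj]
  gcongr
  exact hC _ _

lemma integrable_rho (hR : ∀ ω : S, IsAdaptedRotation (ω : V) (R ω)) (h f : 𝓢(G, ℂ)) :
    Integrable (rho R h f) :=
  (integrable_P_mul hR h f).integral_prod_left

lemma integral_specFun_mul (hR : ∀ ω : S, IsAdaptedRotation (ω : V) (R ω)) (B : Set ℝ)
    (h f : 𝓢(G, ℂ)) :
    ∫ p, specFun R B h p * starRingEnd ℂ (f p) = ∫ μ in B ∩ Ioi 0, rho R h f μ := by
  have h1 : Integrable (fun z : ℝ × G => P R z.1 h z.2 * starRingEnd ℂ (f z.2))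
      ((volume.restrict (B ∩ Ioi 0)).prod volume) :=
    (integrable_P_mul hR h f).mono_measure (Measure.prod_mono Measure.restrict_le_self le_rfl)
  have h2 := integral_integral_swap (f := fun μ p => P R μ h p * starRingEnd ℂ (f p)) h1
  simp only [rho]
  rw [h2]
  refine integral_congr_ae (Eventually.of_forall fun p => ?_)
  simp only [specFun]
  exact (integral_mul_const _ _).symm

lemma integral_mul_conj (hR : ∀ ω : S, IsAdaptedRotation (ω : V) (R ω)) (h f : 𝓢(G, ℂ)) :
    ∫ p, h p * starRingEnd ℂ (f p) = ∫ μ in Ioi 0, rho R h f μ := by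
  have h1 := integral_specFun_mul hR univ h f
  simp only [specFun, univ_inter, integral_P hR] at h1
  exact h1

lemma inner_specProj (hR : ∀ ω : S, IsAdaptedRotation (ω : V) (R ω)) {B : Set ℝ}
    (hB : MeasurableSet B) (f : 𝓢(G, ℂ)) :
    inner ℂ (toL2 f) (specProj hR B (toL2 f)) = ∫ μ in B ∩ Ioi 0, rho R f f μ := by
  rw [← integral_specFun_mul hR, L2.inner_def]
  refine integral_congr_ae ?_
  filter_upwards [specProj_ae_eq hR hB f, f.coeFn_toLp 2 volume] with p h1 h2
  rw [RCLike.inner_apply, toL2_apply, h1, h2]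

/-- By orthogonality `‖E(B) f‖² = ⟨f, E(B) f⟩`, so these integrals of `rho` are real and nonnegative
for every Borel set; hence `rho` itself is, almost everywhere on `(0, ∞)`. -/
lemma norm_specProj_sq (hR : ∀ ω : S, IsAdaptedRotation (ω : V) (R ω)) {B : Set ℝ}
    (hB : MeasurableSet B) (f : 𝓢(G, ℂ)) :
    ((‖specProj hR B (toL2 f)‖ ^ 2 : ℝ) : ℂ) = ∫ μ in B ∩ Ioi 0, rho R f f μ := by
  have h := inner_specLin hR hB f
  rw [inner_sub_right, sub_eq_zero, ← specProj_toL2 hR hB] at h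
  have h1 := congrArg (starRingEnd ℂ) h
  rw [inner_conj_symm, inner_conj_symm] at h1
  rw [← inner_specProj hR hB, h1, inner_self_eq_norm_sq_to_K]
  push_cast
  rfl

lemma norm_specProj_sq_re (hR : ∀ ω : S, IsAdaptedRotation (ω : V) (R ω)) {B : Set ℝ}
    (hB : MeasurableSet B) (f : 𝓢(G, ℂ)) :
    ‖specProj hR B (toL2 f)‖ ^ 2 = ∫ μ in B ∩ Ioi 0, (rho R f f μ).re := by
  have h := congrArg Complex.re (norm_specProj_sq hR hB f)
  rw [Complex.ofReal_re] at h
  rw [h]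
  exact (integral_re (integrable_rho hR f f).integrableOn).symm

lemma rho_self_nonneg (hR : ∀ ω : S, IsAdaptedRotation (ω : V) (R ω)) (f : 𝓢(G, ℂ)) :
    ∀ᵐ μ ∂volume.restrict (Ioi (0 : ℝ)), 0 ≤ (rho R f f μ).re := by
  refine ae_nonneg_of_forall_setIntegral_nonneg (integrable_rho hR f f).integrableOn.re
    fun B hB _ => ?_
  rw [Measure.restrict_restrict hB]
  exact (sq_nonneg _).trans (norm_specProj_sq_re hR hB f).le

lemma rho_self_re (hR : ∀ ω : S, IsAdaptedRotation (ω : V) (R ω)) (f : 𝓢(G, ℂ)) :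
    ∀ᵐ μ ∂volume.restrict (Ioi (0 : ℝ)), rho R f f μ = ((rho R f f μ).re : ℂ) := by
  have h1 : (fun μ => (rho R f f μ).im) =ᵐ[volume.restrict (Ioi (0 : ℝ))] 0 := by
    refine (integrable_rho hR f f).integrableOn.im.ae_eq_zero_of_forall_setIntegral_eq_zero
      fun B hB _ => ?_
    rw [Measure.restrict_restrict hB]
    have h := congrArg Complex.im (norm_specProj_sq hR hB f)
    rw [Complex.ofReal_im] at h
    exact (integral_im (integrable_rho hR f f).integrableOn).trans h.symm
  filter_upwards [h1] with μ hμ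
  exact Complex.ext rfl (by simpa using hμ)

/-! ### Countable additivity -/

lemma specProj_empty (hR : ∀ ω : S, IsAdaptedRotation (ω : V) (R ω)) (u : L2G) :
    specProj hR ∅ u = 0 := by
  have h := specProj_union hR MeasurableSet.empty MeasurableSet.empty (disjoint_empty _) u
  rw [union_empty] at h
  exact left_eq_add.1 h

lemma specProj_biUnion (hR : ∀ ω : S, IsAdaptedRotation (ω : V) (R ω)) {B : ℕ → Set ℝ}
    (hB : ∀ n, MeasurableSet (B n)) (hd : Pairwise fun m n => Disjoint (B m) (B n))
    (s : Finset ℕ) (u : L2G) :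
    specProj hR (⋃ n ∈ s, B n) u = ∑ n ∈ s, specProj hR (B n) u := by
  classical
  induction s using Finset.induction_on with
  | empty => simp [specProj_empty]
  | insert a s ha ih =>
    rw [Finset.set_biUnion_insert, specProj_union hR (hB a) (s.measurableSet_biUnion fun n _ => hB n)
      ?_ u, ih, Finset.sum_insert ha]
    rw [disjoint_iUnion₂_right]
    exact fun n hn => hd (ne_of_mem_of_not_mem hn ha).symm

lemma specProj_iUnion (hR : ∀ ω : S, IsAdaptedRotation (ω : V) (R ω)) {B : ℕ → Set ℝ}
    (hB : ∀ n, MeasurableSet (B n)) (hd : Pairwise fun m n => Disjoint (B m) (B n))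
    (s : Finset ℕ) (u : L2G) :
    specProj hR (⋃ n, B n) u
      = ∑ n ∈ s, specProj hR (B n) u + specProj hR (⋃ n ∈ (s : Set ℕ)ᶜ, B n) u := by
  rw [← specProj_biUnion hR hB hd, ← specProj_union hR (s.measurableSet_biUnion fun n _ => hB n)
    (MeasurableSet.biUnion (to_countable _) fun n _ => hB n)]
  · congr 2
    ext x
    simp only [mem_iUnion, mem_union, mem_compl_iff, Finset.mem_coe, exists_prop]
    grind
  · simp only [disjoint_iUnion_left, disjoint_iUnion_right]
    exact fun n hn m hm => hd fun h => hn (h ▸ hm)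

/-- The squared norm of the remainder is a tail of the convergent series of integrals of `rho` over
the `B n`. -/
lemma tendsto_norm_specProj_compl (hR : ∀ ω : S, IsAdaptedRotation (ω : V) (R ω)) {B : ℕ → Set ℝ}
    (hB : ∀ n, MeasurableSet (B n)) (hd : Pairwise fun m n => Disjoint (B m) (B n))
    (f : 𝓢(G, ℂ)) :
    Tendsto (fun s : Finset ℕ => ‖specProj hR (⋃ n ∈ (s : Set ℕ)ᶜ, B n) (toL2 f)‖ ^ 2) atTop
      (𝓝 0) := by
  have h1 : HasSum (fun n => ∫ μ in B n ∩ Ioi 0, rho R f f μ)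
      (∫ μ in (⋃ n, B n) ∩ Ioi 0, rho R f f μ) := by
    rw [iUnion_inter]
    exact hasSum_integral_iUnion (fun n => (hB n).inter measurableSet_Ioi)
      (fun m n hmn => (hd hmn).mono inter_subset_left inter_subset_left)
      (integrable_rho hR f f).integrableOn
  have h2 : ∀ s : Finset ℕ, ((‖specProj hR (⋃ n ∈ (s : Set ℕ)ᶜ, B n) (toL2 f)‖ ^ 2 : ℝ) : ℂ)
      = (∫ μ in (⋃ n, B n) ∩ Ioi 0, rho R f f μ) - ∑ n ∈ s, ∫ μ in B n ∩ Ioi 0, rho R f f μ := by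
    intro s
    have hc : MeasurableSet (⋃ n ∈ (s : Set ℕ)ᶜ, B n) :=
      MeasurableSet.biUnion (to_countable _) fun n _ => hB n
    rw [norm_specProj_sq hR hc, ← inner_specProj hR hc, ← inner_specProj hR (MeasurableSet.iUnion hB),
      specProj_iUnion hR hB hd s, inner_add_right, inner_sum]
    simp only [inner_specProj hR (hB _)]
    ring
  have h3 := (tendsto_const_nhds (x := ∫ μ in (⋃ n, B n) ∩ Ioi 0, rho R f f μ)).sub h1
  rw [sub_self] at h3
  rw [SummationFilter.unconditional_filter] at h3
  have h4 := (Complex.continuous_re.tendsto 0).comp h3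
  rw [Complex.zero_re] at h4
  refine h4.congr fun s => ?_
  rw [Function.comp_apply, ← h2, Complex.ofReal_re]

/-- Remainders are small on Schwartz functions and are contractions, so density suffices. -/
lemma hasSum_specProj (hR : ∀ ω : S, IsAdaptedRotation (ω : V) (R ω)) {B : ℕ → Set ℝ}
    (hB : ∀ n, MeasurableSet (B n)) (hd : Pairwise fun m n => Disjoint (B m) (B n)) (u : L2G) :
    HasSum (fun n => specProj hR (B n) u) (specProj hR (⋃ n, B n) u) := by
  have hc : ∀ s : Finset ℕ, MeasurableSet (⋃ n ∈ (s : Set ℕ)ᶜ, B n) := fun s =>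
    MeasurableSet.biUnion (to_countable _) fun n _ => hB n
  rw [HasSum, SummationFilter.unconditional_filter, Metric.tendsto_nhds]
  intro ε hε
  obtain ⟨f, hf⟩ := denseRange_toL2.exists_dist_lt u (half_pos hε)
  have h1 := tendsto_norm_specProj_compl hR hB hd f
  filter_upwards [h1.eventually (gt_mem_nhds (pow_pos (half_pos hε) 2))] with s hs
  have h2 := lt_of_pow_lt_pow_left₀ 2 (by positivity) hs
  rw [dist_comm, dist_eq_norm, specProj_iUnion hR hB hd s, add_sub_cancel_left]
  calc _ = ‖specProj hR (⋃ n ∈ (s : Set ℕ)ᶜ, B n) (u - toL2 f)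
        + specProj hR (⋃ n ∈ (s : Set ℕ)ᶜ, B n) (toL2 f)‖ := by rw [← map_add, sub_add_cancel]
    _ ≤ ‖u - toL2 f‖ + ‖specProj hR (⋃ n ∈ (s : Set ℕ)ᶜ, B n) (toL2 f)‖ :=
        (norm_add_le _ _).trans (add_le_add (norm_specProj_le hR (hc s) _) le_rfl)
    _ < ε := by
        rw [← dist_eq_norm]
        linarith

lemma isSpectralMeasure_specProj (hR : ∀ ω : S, IsAdaptedRotation (ω : V) (R ω)) :
    IsSpectralMeasure (specProj hR) where
  isStarProjection _ hB := isStarProjection_specProj hR hB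
  map_univ := specProj_univ hR
  hasSum_iUnion _ hB hd u := hasSum_specProj hR hB hd u

/-! ### Scalar spectral measures and the moments of `L` -/

lemma rho_subLaplacianS (hR : ∀ ω : S, IsAdaptedRotation (ω : V) (R ω)) (h : 𝓢(G, ℂ)) (f : G → ℂ)
    (μ : ℝ) : rho R (subLaplacianS h) f μ = μ * rho R h f μ := by
  simp only [rho, P_subLaplacianS hR, mul_assoc]
  exact integral_const_mul _ _

lemma leftField_conj (a : Fin 3) (F : G → ℂ) :
    leftField a (fun p => starRingEnd ℂ (F p)) = fun p => starRingEnd ℂ (leftField a F p) := by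
  funext p
  simp only [leftField]
  exact deriv.star

lemma subLaplacian_conj (F : G → ℂ) (p : G) :
    subLaplacian (fun p => starRingEnd ℂ (F p)) p = starRingEnd ℂ (subLaplacian F p) := by
  simp only [subLaplacian, leftField_conj, map_neg, map_sum]

lemma hasTemperateGrowth_conj (f : 𝓢(G, ℂ)) :
    Function.HasTemperateGrowth fun p => starRingEnd ℂ (f p) :=
  Complex.conjCLE.toContinuousLinearMap.hasTemperateGrowth.comp f.hasTemperateGrowth

lemma integral_norm_subLaplacianS_sq (f : 𝓢(G, ℂ)) :
    ((∫ p, ‖subLaplacianS f p‖ ^ 2 : ℝ) : ℂ)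
      = ∫ p, subLaplacianS (subLaplacianS f) p * starRingEnd ℂ (f p) := by
  rw [integral_subLaplacianS_mul _ (hasTemperateGrowth_conj f), ← integral_complex_ofReal]
  refine integral_congr_ae (Eventually.of_forall fun p => ?_)
  simp only [subLaplacian_conj, subLaplacian_coe, Complex.mul_conj, Complex.normSq_eq_norm_sq]

/-- The scalar spectral measure of a Schwartz function. -/
def scalarMeasure (R : S → V ≃ₗᵢ[ℝ] V) (f : G → ℂ) : Measure ℝ :=
  (volume.restrict (Ioi 0)).withDensity fun μ => ENNReal.ofReal (rho R f f μ).re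

lemma measurable_rho (hR : ∀ ω : S, IsAdaptedRotation (ω : V) (R ω)) (h f : 𝓢(G, ℂ)) :
    Measurable (rho R h f) := by
  have h1 : Measurable (Function.uncurry fun (μ : ℝ) (p : G) =>
      P R μ h p * starRingEnd ℂ (f p)) :=
    (measurable_P hR h).mul (Complex.continuous_conj.comp
      (f.continuous.comp continuous_snd)).measurable
  exact h1.stronglyMeasurable.integral_prod_right.measurable

lemma scalarMeasure_apply (hR : ∀ ω : S, IsAdaptedRotation (ω : V) (R ω)) (f : 𝓢(G, ℂ))
    {B : Set ℝ} (hB : MeasurableSet B) :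
    scalarMeasure R f B = ENNReal.ofReal (‖specProj hR B (toL2 f)‖ ^ 2) := by
  rw [scalarMeasure, withDensity_apply _ hB, norm_specProj_sq_re hR hB,
    ← Measure.restrict_restrict hB, ofReal_integral_eq_lintegral_ofReal]
  · exact (integrable_rho hR f f).re.restrict.restrict
  · exact ae_restrict_of_ae (rho_self_nonneg hR f)

lemma integral_scalarMeasure (hR : ∀ ω : S, IsAdaptedRotation (ω : V) (R ω)) (f : 𝓢(G, ℂ))
    (g : ℝ → ℝ) : ((∫ t, g t ∂scalarMeasure R f : ℝ) : ℂ)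
      = ∫ μ in Ioi 0, (g μ : ℂ) * rho R f f μ := by
  have hm : Measurable fun μ => (rho R f f μ).re :=
    Complex.measurable_re.comp (measurable_rho hR f f)
  rw [scalarMeasure, integral_withDensity_eq_integral_toReal_smul (by fun_prop)
    (Eventually.of_forall fun _ => ENNReal.ofReal_lt_top), ← integral_complex_ofReal]
  refine integral_congr_ae ?_
  filter_upwards [rho_self_nonneg hR f, rho_self_re hR f] with μ h1 h2
  rw [ENNReal.toReal_ofReal h1, smul_eq_mul, mul_comm, Complex.ofReal_mul, ← h2]

lemma integrable_scalarMeasure (hR : ∀ ω : S, IsAdaptedRotation (ω : V) (R ω)) (f : 𝓢(G, ℂ))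
    {g : ℝ → ℝ} (hg : Integrable (fun μ => (g μ : ℂ) * rho R f f μ)) :
    Integrable g (scalarMeasure R f) := by
  have hm : Measurable fun μ => (rho R f f μ).re :=
    Complex.measurable_re.comp (measurable_rho hR f f)
  rw [scalarMeasure, integrable_withDensity_iff_integrable_smul' (by fun_prop)
    (Eventually.of_forall fun _ => ENNReal.ofReal_lt_top)]
  refine hg.re.restrict.congr ?_
  filter_upwards [rho_self_nonneg hR f] with μ h1
  rw [ENNReal.toReal_ofReal h1, smul_eq_mul, mul_comm]
  simp

/-- Replacing `f` by `L f` or `L² f` in the first slot multiplies `rho` by `μ` or `μ²`. The second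
moment is thus finite because `rho` of `L² f` and `f` is integrable, and it equals `⟨L² f, f⟩ = ‖L
f‖²`. -/
lemma resolvesSubLaplacian_specProj (hR : ∀ ω : S, IsAdaptedRotation (ω : V) (R ω)) :
    ResolvesSubLaplacian (specProj hR) := by
  intro f
  have h2 : ∀ μ : ℝ, rho R (subLaplacianS (subLaplacianS f)) f μ
      = ((μ ^ 2 : ℝ) : ℂ) * rho R f f μ := fun μ => by
    rw [rho_subLaplacianS hR, rho_subLaplacianS hR]
    push_cast
    ring
  refine ⟨scalarMeasure R f, fun B hB => scalarMeasure_apply hR f hB, ?_, ?_, ?_⟩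
  · refine integrable_scalarMeasure hR f ?_
    simp only [← h2]
    exact integrable_rho hR _ f
  · rw [subLaplacian_coe, integral_mul_conj hR, integral_scalarMeasure hR]
    simp only [rho_subLaplacianS hR]
  · rw [subLaplacian_coe, ← Complex.ofReal_inj, integral_norm_subLaplacianS_sq,
      integral_mul_conj hR, integral_scalarMeasure hR]
    simp only [h2]

end FreeTwoStep
end

theorem mainTheorem2
    (R : FreeTwoStep.S → FreeTwoStep.V ≃ₗᵢ[ℝ] FreeTwoStep.V)
    (hR : ∀ ω : FreeTwoStep.S, FreeTwoStep.IsAdaptedRotation (ω : FreeTwoStep.V) (R ω)) :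
    (∀ f : 𝓢(FreeTwoStep.G, ℂ),
      -- the formula for `𝒫_μ f` converges absolutely
      (∀ μ : ℝ, 0 < μ → ∀ p : FreeTwoStep.G,
        Integrable (fun q : FreeTwoStep.S × ℕ × ℝ =>
            FreeTwoStep.spectralIntegrand R μ f p q.1 q.2.1 q.2.2)
          ((volume : Measure FreeTwoStep.V).toSphere.prod
            (Measure.count.prod (volume.restrict (Ioc (-√μ) (√μ)))))) ∧
      -- `f = ∫_0^∞ 𝒫_μ f dμ`
      (∀ p : FreeTwoStep.G,
        IntegrableOn (fun μ : ℝ => FreeTwoStep.P R μ f p) (Ioi 0) ∧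
        f p = ∫ μ in Ioi (0 : ℝ), FreeTwoStep.P R μ f p) ∧
      -- `L 𝒫_μ f = μ 𝒫_μ f`
      (∀ μ : ℝ, 0 < μ → ContDiff ℝ 2 (FreeTwoStep.P R μ f) ∧
        ∀ p : FreeTwoStep.G,
          FreeTwoStep.subLaplacian (FreeTwoStep.P R μ f) p = (μ : ℂ) * FreeTwoStep.P R μ f p) ∧
      -- `L f = ∫_0^∞ μ 𝒫_μ f dμ`
      (∀ p : FreeTwoStep.G,
        IntegrableOn (fun μ : ℝ => (μ : ℂ) * FreeTwoStep.P R μ f p) (Ioi 0) ∧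
        FreeTwoStep.subLaplacian f p =
          ∫ μ in Ioi (0 : ℝ), (μ : ℂ) * FreeTwoStep.P R μ f p)) ∧
    -- the operators `f ↦ ∫_B 𝒫_μ f dμ` are the spectral projections of `L`
    (∃ E : Set ℝ → FreeTwoStep.L2G →L[ℂ] FreeTwoStep.L2G,
      FreeTwoStep.IsSpectralMeasure E ∧
      FreeTwoStep.ResolvesSubLaplacian E ∧
      ∀ f : 𝓢(FreeTwoStep.G, ℂ), ∀ B : Set ℝ, MeasurableSet B →
        E B (f.toLp 2 volume) =ᵐ[volume]
          fun p : FreeTwoStep.G => ∫ μ in B ∩ Ioi (0 : ℝ), FreeTwoStep.P R μ f p) := by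
  refine ⟨fun f => ⟨fun μ _ p => FreeTwoStep.integrable_spectralIntegrand hR f μ p,
    fun p => ⟨FreeTwoStep.integrableOn_P hR f p, (FreeTwoStep.integral_P hR f p).symm⟩,
    fun μ _ => ⟨FreeTwoStep.contDiff_P hR f μ, FreeTwoStep.subLaplacian_P hR f μ⟩,
    fun p => ?_⟩, FreeTwoStep.specProj hR, FreeTwoStep.isSpectralMeasure_specProj hR,
    FreeTwoStep.resolvesSubLaplacian_specProj hR, fun f B hB => FreeTwoStep.specProj_ae_eq hR hB f⟩
  -- Since `μ 𝒫_μ f = 𝒫_μ (L f)`, the last formula is reconstruction for the Schwartz function `L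
  -- f`.
  simp only [← FreeTwoStep.P_subLaplacianS hR]
  rw [FreeTwoStep.subLaplacian_coe]
  exact ⟨FreeTwoStep.integrableOn_P hR _ p, (FreeTwoStep.integral_P hR _ p).symm⟩
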